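/- **Setup.** Let $m,n\ge 1$, $\mathcal X=[m]\times[n]$, $K>0$, and let $\mathcal M_K$ be the set of $M\in[-1,1]^{\mathcal X}$ with $\|M\|_{\max}=\min_{UV^\top=M}\|U\|_{2,\infty}\|V\|_{2,\infty}\le K$, where $\|\cdot\|_{2,\infty}$ is the largest Euclidean row norm. Let $\mu$ be a probability distribution on $\mathcal X$ and $M^\star\in\mathcal M_K$. Entries $x_1,x_2,\dots$ are drawn i.i.d. from $\mu$ and $o_t=M^\star_{x_t}$ is observed. Put $\mathcal V_\delta=\{M\in\mathcal M_K:\mathbb E_{x\sim\mu}(M_x-M^\star_x)^2\le\delta\}$ and $G(C,M^1,M^2)=\sum_x C_x(M^1_x-M^2_x)$. There are two settings: 1. (simplex) $\mathcal C$ is the unit simplex $\Delta_{\mathcal X}\subset\mathbb R^{\mathcal X}$, $H(C)=-\sum_xC_x\log C_x$, $C_\mu=\mu$; 2. (cube) $\mathcal C=[0,(m+n)^{-3/2}]^{\mathcal X}$, $H(C)=\|C\|_1$ (entrywise), and $C_\mu$ is any element of $\mathcal C$ with $C_\mu/\|C_\mu\|_1=\mu$. **The algorithm (Online Dual Descent,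 ODD)** with parameters $\alpha,\theta>0$ and $T$ rounds plays $C_t$ and $M_t=(M^1_t,M^2_t)$ for $t=1,\dots,T$ and outputs $\bar C=\frac1T\sum_{t\le T}C_t$. The two players are updated as follows. *Confidence matrix.* Let $r_t(C)=H(C)-\alpha G(C,M_t)$, and let $B_R$ denote the Bregman divergence of $R$. Then $C_{t+1}=\arg\min_{C\in\mathcal C'}B_R(C,\hat C_{t+1})$, where $\nabla R(\hat C_{t+1})=\nabla R(C_t)+\eta\nabla r_t(C_t)$ for $t\ge1$. In the simplex setting $R=-H$, $\mathcal C'=\{C\in\Delta_{\mathcal X}:\min_xC_x\ge e^{1-\beta}\}$ with $\beta=1+2\log(mnT)$, all entries of $\hat C_1$ are $e^{-1}$, and $\eta=\sqrt{\log(mn)}/((\beta+2\alpha)\sqrt T)$. In the cube setting $R=\frac12\|\cdot\|_2^2$, $\mathcal C'=\mathcal C$, $\hat C_1=0$, and $\eta=\sqrt{mn/(2(m+n)^3)}\,/\,((1+2\alpha)\sqrt{mnT})$. *Completions.* Let $p=2(m+n)$, and let $\mathcal K$ be the set of symmetric positive semidefinite $X\in\mathbb R^{2p\times 2p}$ with diagonal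 $p\times p$ blocks $P$ and $N$ such that $\mathrm{Tr}\,X\le 2K(m+n)$, $X_{aa}\le K$ for all $a$, and $P-N\in[-1,1]^{p\times p}$. Start from $X_1=\frac K2 I$. The completions $M^1_t,M^2_t$ are the two diagonal $m\times n$ blocks of the upper right $2m\times 2n$ block of $P-N$ for $X=X_t$. Put $D_t=\begin{pmatrix}C_t-2\theta((M^1_t)_{x_t}-o_t)E_{x_t}&0\\0&-C_t-2\theta((M^2_t)_{x_t}-o_t)E_{x_t}\end{pmatrix}$ ($E_x$ the matrix unit), $S_t=\begin{pmatrix}0&D_t\\D_t^\top&0\end{pmatrix}$, $L_t=\begin{pmatrix}S_t&0\\0&-S_t\end{pmatrix}$. With $\Delta(X,Y)=\mathrm{Tr}(X\log X-X\log Y-X+Y)$ and $\eta'=\frac1{2(1+8\theta)}\sqrt{(m+n)\log(2p)/T}$, set $X_{t+1}=\arg\min_{X\in\mathcal K}\Delta\bigl(X,\exp(\log X_t+\eta'L_t)\bigr)$. **Theorem.** There are universal constants $c_1,c_2,A,B>0$ and $k\in\mathbb N$ such that the following holds for all $m,n,\mu,M^\star$ as above, all $K>0$, $\delta>0$, and all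 $$T\ \ge\ B\,\delta^{-2}\max(1,K)^2(m+n)\,\log^k\!\Bigl(e+\tfrac{(m+n)\max(1,K)}{\delta}\Bigr).$$ Run ODD for $T$ rounds with $\alpha=\delta^{-1/6}$. 1. In the simplex setting with $\theta=4\delta^{-2/3}$, with probability at least $1-c_1\exp(-c_2\delta^2T)$, (a) $H(\bar C)\ge H(C_\mu)-A\,\delta^{1/6}$, and (b) if $mn\ge2$, then $\max_{M^1,M^2\in\mathcal V_\delta}G(\bar C,M^1,M^2)\le A\,\delta^{1/6}\log(mn)$. 2. In the cube setting with $\theta=4\delta^{-2/3}\sqrt{m+n}$, for every such $C_\mu$, with probability at least $1-c_1\exp(-c_2\delta^2T)$, (a) $\|\bar C\|_1\ge\|C_\mu\|_1-A\,\delta^{1/6}\sqrt{m+n}$, and (b) $\max_{M^1,M^2\in\mathcal V_\delta}G(\bar C,M^1,M^2)\le A\,\delta^{1/6}\sqrt{m+n}$. -/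

import Mathlib

open MeasureTheory ProbabilityTheory

noncomputable section

namespace PMC

/-! Matrix classes, version spaces, coverage and disagreement. -/

/-- `‖U‖_{2,∞}`: the largest Euclidean norm of a row. -/
def rowNorm {m d : ℕ} (U : Matrix (Fin m) (Fin d) ℝ) : ℝ :=
  ⨆ i, Real.sqrt (∑ k, U i k ^ 2)

/-- The max-norm: the least `‖U‖_{2,∞} ‖V‖_{2,∞}` over all factorizations `M = U Vᵀ`. -/
def maxNorm {m n : ℕ} (M : Matrix (Fin m) (Fin n) ℝ) : ℝ :=
  sInf {r | ∃ (d : ℕ) (U : Matrix (Fin m) (Fin d) ℝ) (V : Matrix (Fin n) (Fin d) ℝ),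
    U * V.transpose = M ∧ r = rowNorm U * rowNorm V}

/-- Matrices with entries in `[-1, 1]` and max-norm at most `K`. -/
def maxClass (m n : ℕ) (K : ℝ) : Set (Matrix (Fin m) (Fin n) ℝ) :=
  {M | maxNorm M ≤ K ∧ ∀ i j, M i j ∈ Set.Icc (-1 : ℝ) 1}

/-- The population version space of radius `δ`, for index distribution `μ` and noiseless
observations of `Mstar`. -/
def versionSpace {m n : ℕ} (μ : Measure (Fin m × Fin n)) (Mstar : Matrix (Fin m) (Fin n) ℝ)
    (K δ : ℝ) : Set (Matrix (Fin m) (Fin n) ℝ) :=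
  {M | M ∈ maxClass m n K ∧ ∫ x, (M x.1 x.2 - Mstar x.1 x.2) ^ 2 ∂μ ≤ δ}

/-- The linear disagreement `∑ₓ Cₓ (M¹ₓ - M²ₓ)`. -/
def disagreement {m n : ℕ} (C M₁ M₂ : Matrix (Fin m) (Fin n) ℝ) : ℝ :=
  ∑ i, ∑ j, C i j * (M₁ i j - M₂ i j)

/-- Shannon entropy of a confidence matrix, with `0 log 0 = 0`. -/
def entropy {m n : ℕ} (C : Matrix (Fin m) (Fin n) ℝ) : ℝ :=
  ∑ i, ∑ j, Real.negMulLog (C i j)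

/-- The entrywise `ℓ₁` norm. -/
def l1Norm {m n : ℕ} (C : Matrix (Fin m) (Fin n) ℝ) : ℝ :=
  ∑ i, ∑ j, |C i j|

/-- The two settings: entropy over the unit simplex, `ℓ₁` norm over the scaled cube. -/
inductive Setting where
  | simplex
  | cube

/-- The side length `(m + n)^{-3/2}` of the scaled cube. -/
def cubeSide (m n : ℕ) : ℝ := ((m : ℝ) + n) ^ (-(3 / 2) : ℝ)

/-- The set of admissible confidence matrices. -/
def confidenceSet (m n : ℕ) : Setting → Set (Matrix (Fin m) (Fin n) ℝ)
  | .simplex => {C | (∀ i j, 0 ≤ C i j) ∧ ∑ i, ∑ j, C i j = 1}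
  | .cube => {C | ∀ i j, C i j ∈ Set.Icc 0 (cubeSide m n)}

/-- The coverage `H`. -/
def coverage {m n : ℕ} : Setting → Matrix (Fin m) (Fin n) ℝ → ℝ
  | .simplex => entropy
  | .cube => l1Norm

/-- A minimizer of `f` over `S` (an arbitrary value if there is none). -/
def argminOn {E : Type*} [Nonempty E] (S : Set E) (f : E → ℝ) : E :=
  Classical.epsilon fun a => a ∈ S ∧ IsMinOn f S a

/-! The coverage player: online mirror descent on `r_t(C) = H(C) - α G(C, M_t)`. -/

/-- Logarithmic truncation level of the simplex. -/
def truncation (m n T : ℕ) : ℝ := 1 + 2 * Real.log ((m : ℝ) * n * T)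

/-- The set onto which the coverage player projects: the simplex with all entries at least
`exp (1 - β)`, or the whole cube. -/
def projectionSet (m n T : ℕ) : Setting → Set (Matrix (Fin m) (Fin n) ℝ)
  | .simplex => {C | C ∈ confidenceSet m n .simplex ∧
      ∀ i j, Real.exp (1 - truncation m n T) ≤ C i j}
  | .cube => confidenceSet m n .cube

/-- The regularizer `R`: negative entropy, or half the squared Euclidean norm. -/
def regularizer {m n : ℕ} : Setting → Matrix (Fin m) (Fin n) ℝ → ℝ
  | .simplex => fun C => -entropy C
  | .cube => fun C => 1 / 2 * ∑ i, ∑ j, C i j ^ 2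

/-- The gradient of the regularizer (for the entropy, at matrices with positive entries). -/
def regularizerGrad {m n : ℕ} : Setting → Matrix (Fin m) (Fin n) ℝ → Matrix (Fin m) (Fin n) ℝ
  | .simplex => fun C => Matrix.of fun i j => 1 + Real.log (C i j)
  | .cube => fun C => C

/-- The inverse of the gradient map `∇R`. -/
def regularizerGradInv {m n : ℕ} :
    Setting → Matrix (Fin m) (Fin n) ℝ → Matrix (Fin m) (Fin n) ℝ
  | .simplex => fun W => Matrix.of fun i j => Real.exp (W i j - 1)
  | .cube => fun W => W

/-- The Bregman divergence `B_R(P, Q) = R(P) - R(Q) - ⟨∇R(Q), P - Q⟩`. -/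
def bregman {m n : ℕ} (s : Setting) (P Q : Matrix (Fin m) (Fin n) ℝ) : ℝ :=
  regularizer s P - regularizer s Q - ∑ i, ∑ j, regularizerGrad s Q i j * (P i j - Q i j)

/-- The gradient at `C` of the reward `H(C) - α G(C, M₁, M₂)`; on the cube `‖C‖₁` is the sum
of the entries. -/
def rewardGrad {m n : ℕ} (s : Setting) (α : ℝ) (C M₁ M₂ : Matrix (Fin m) (Fin n) ℝ) :
    Matrix (Fin m) (Fin n) ℝ :=
  match s with
  | .simplex => Matrix.of fun i j => -1 - Real.log (C i j) - α * (M₁ i j - M₂ i j)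
  | .cube => Matrix.of fun i j => 1 - α * (M₁ i j - M₂ i j)

/-- The step size `D_R / (G_R √T)`, with `D_R` the square-root diameter of `R` and `G_R` the
gradient bound. -/
def coverageStep (m n T : ℕ) (α : ℝ) : Setting → ℝ
  | .simplex => Real.sqrt (Real.log ((m : ℝ) * n)) /
      ((truncation m n T + 2 * α) * Real.sqrt T)
  | .cube => Real.sqrt (1 / 2 * ((m : ℝ) * n * cubeSide m n ^ 2)) /
      ((1 + 2 * α) * Real.sqrt ((m : ℝ) * n) * Real.sqrt T)

/-- The first confidence matrix. -/
def coverageInit (m n T : ℕ) (s : Setting) : Matrix (Fin m) (Fin n) ℝ :=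
  argminOn (projectionSet m n T s) fun C => bregman s C
    (match s with
      | .simplex => Matrix.of fun _ _ => Real.exp (-1)
      | .cube => 0)

/-- One mirror descent update of the confidence matrix. -/
def coverageUpdate {m n : ℕ} (T : ℕ) (s : Setting) (α : ℝ)
    (C M₁ M₂ : Matrix (Fin m) (Fin n) ℝ) : Matrix (Fin m) (Fin n) ℝ :=
  argminOn (projectionSet m n T s) fun C' => bregman s C'
    (regularizerGradInv s
      (regularizerGrad s C + coverageStep m n T α s • rewardGrad s α C M₁ M₂))

/-! The completion player: matrix multiplicative weights on
`γ_t(M) = G(C_t, M) - θ f_t(M)`. -/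

/-- Indices of the symmetric `p × p` matrices, `p = 2 (m + n)`: the rows of `M¹`, the rows of
`M²`, the columns of `M¹`, the columns of `M²`. -/
abbrev BlockIdx (m n : ℕ) : Type := (Fin m ⊕ Fin m) ⊕ (Fin n ⊕ Fin n)

/-- The `2p × 2p` matrices; the two diagonal blocks hold `P` and `N`. -/
abbrev LiftMat (m n : ℕ) : Type :=
  Matrix (BlockIdx m n ⊕ BlockIdx m n) (BlockIdx m n ⊕ BlockIdx m n) ℝ

/-- The difference `P - N` of the diagonal blocks. -/
def blockDiff {m n : ℕ} (X : LiftMat m n) : Matrix (BlockIdx m n) (BlockIdx m n) ℝ :=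
  X.toBlocks₁₁ - X.toBlocks₂₂

/-- The completion `M¹` read off from `P - N`. -/
def fst {m n : ℕ} (X : LiftMat m n) : Matrix (Fin m) (Fin n) ℝ :=
  (blockDiff X).toBlocks₁₂.toBlocks₁₁

/-- The completion `M²` read off from `P - N`. -/
def snd {m n : ℕ} (X : LiftMat m n) : Matrix (Fin m) (Fin n) ℝ :=
  (blockDiff X).toBlocks₁₂.toBlocks₂₂

/-- The feasible set of lifted matrices. -/
def liftSet (m n : ℕ) (K : ℝ) : Set (LiftMat m n) :=
  {X | X.PosSemidef ∧ X.trace ≤ 2 * K * ((m : ℝ) + n) ∧ (∀ a, X a a ≤ K) ∧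
    ∀ a b, blockDiff X a b ∈ Set.Icc (-1 : ℝ) 1}

/-- The logarithm of a symmetric positive semidefinite matrix, through its spectral
decomposition (`log 0` counts as `0`). -/
def matLog {ι : Type*} [Fintype ι] [DecidableEq ι] (X : Matrix ι ι ℝ) : Matrix ι ι ℝ :=
  cfc Real.log X

/-- Matrix relative entropy `Tr (X log X - X log Y - X + Y)`. -/
def relEntropy {ι : Type*} [Fintype ι] [DecidableEq ι] (X Y : Matrix ι ι ℝ) : ℝ :=
  (X * matLog X - X * matLog Y - X + Y).trace

/-- The descent matrix of `γ_t` for current confidence matrix `C`, completions `(M₁, M₂)` and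
observation `o` at entry `x`. -/
def descentMatrix {m n : ℕ} (θ : ℝ) (C M₁ M₂ : Matrix (Fin m) (Fin n) ℝ)
    (x : Fin m × Fin n) (o : ℝ) : LiftMat m n :=
  let D : Matrix (Fin m ⊕ Fin m) (Fin n ⊕ Fin n) ℝ := Matrix.fromBlocks
    (C - Matrix.single x.1 x.2 (2 * θ * (M₁ x.1 x.2 - o))) 0
    0 (-C - Matrix.single x.1 x.2 (2 * θ * (M₂ x.1 x.2 - o)))
  let S : Matrix (BlockIdx m n) (BlockIdx m n) ℝ := Matrix.fromBlocks 0 D D.transpose 0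
  Matrix.fromBlocks S 0 0 (-S)

/-- The step size of the completion player; here `2p = 4 (m + n)`. -/
def completionStep (m n T : ℕ) (θ : ℝ) : ℝ :=
  1 / (2 * (1 + 8 * θ)) *
    Real.sqrt (((m : ℝ) + n) * Real.log (4 * ((m : ℝ) + n)) / T)

/-- One update of the lifted completion matrix. -/
def completionUpdate {m n : ℕ} (T : ℕ) (K θ : ℝ) (C : Matrix (Fin m) (Fin n) ℝ)
    (X : LiftMat m n) (x : Fin m × Fin n) (o : ℝ) : LiftMat m n :=
  argminOn (liftSet m n K) fun X' => relEntropy X' (NormedSpace.exp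
    (matLog X + completionStep m n T θ • descentMatrix θ C (fst X) (snd X) x o))

/-! Online Dual Descent. -/

/-- Tuning of the algorithm. -/
structure Params where
  /-- number of rounds -/
  T : ℕ
  /-- max-norm radius -/
  K : ℝ
  /-- weight of the disagreement -/
  α : ℝ
  /-- weight of the deviation from the observations -/
  θ : ℝ

/-- The pair `(C_t, X_t)` held at the start of a round when the entries revealed so far are
given by `x` (rounds are numbered from `0`) and the observations are the entries of `Mstar`. -/
def oddState {m n : ℕ} (s : Setting) (q : Params) (Mstar : Matrix (Fin m) (Fin n) ℝ)
    (x : ℕ → Fin m × Fin n) : ℕ → Matrix (Fin m) (Fin n) ℝ × LiftMat m n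
  | 0 => (coverageInit m n q.T s, (q.K / 2) • (1 : LiftMat m n))
  | t + 1 =>
    let C := (oddState s q Mstar x t).1
    let X := (oddState s q Mstar x t).2
    (coverageUpdate q.T s q.α C (fst X) (snd X),
      completionUpdate q.T q.K q.θ C X (x t) (Mstar (x t).1 (x t).2))

/-- The output of the algorithm: the average of the `T` confidence matrices that were played. -/
def oddOutput {m n : ℕ} (s : Setting) (q : Params) (Mstar : Matrix (Fin m) (Fin n) ℝ)
    (x : ℕ → Fin m × Fin n) : Matrix (Fin m) (Fin n) ℝ :=
  (1 / (q.T : ℝ)) • ∑ t ∈ Finset.range q.T, (oddState s q Mstar x t).1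

/-- The tuning for accuracy `δ`: `α = δ^{-1/6}`, and `θ = 4 δ^{-2/3}` on the simplex,
`θ = 4 δ^{-2/3} √(m + n)` on the cube. -/
def tuning (m n : ℕ) (K δ : ℝ) (T : ℕ) (s : Setting) : Params where
  T := T
  K := K
  α := δ ^ (-(1 / 6) : ℝ)
  θ := match s with
    | .simplex => 4 * δ ^ (-(2 / 3) : ℝ)
    | .cube => 4 * δ ^ (-(2 / 3) : ℝ) * Real.sqrt ((m : ℝ) + n)

end PMC

end

/-! ### Matrix relative entropy in spectral coordinates. -/

namespace PMC

open Matrix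

section Spectral

variable {ι : Type*} [Fintype ι] [DecidableEq ι]

/-! The algorithm is a two-player game in which both players run mirror descent. Each therefore has
regret of order `√T` against every fixed comparator, along every realization of the draws
(`coverage_regret`, `completion_regret`). The coverage player, compared with `C_μ`, gives `T H(C_μ)
+ α ∑ G(C_t, M_t) ≤ T H(C̄) + α ∑ G(C_μ, M_t)` up to regret. Since `C_μ` is a multiple of `μ`, the
inequality of arithmetic and geometric means bounds `G(C_μ, M_t)` by `θ` times the population risks
of the two completions `M_t`, plus `ρ² / (2θ)` where `ρ` bounds the mass of `C_μ`. The completion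
player bounds `∑ G(C_t, M_t)` from below by `θ` times the empirical losses of the `M_t`, plus the
reward of any fixed pair. If the population risks of the `M_t` sum to at most their empirical losses
plus `δT`, the two `θ`-terms cancel. The fixed pair `(M⋆, M⋆)` then yields the coverage claim. A
pair from the version space, whose empirical losses are at most `2δT` each, yields the disagreement
claim. This is `oddOutput_of_typical`.

Chance enters only through the event `Typical`. For the completions actually played, the differences
between risk and loss form a bounded martingale. For fixed completions a uniform bound over the
max-norm class is needed. It comes from symmetrization, a contraction principle for exponential
moments (`supExp_sq_contraction`), and the regret bound of matrix multiplicative weights run on the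
random signs (`signAvg_iterate_supExp_le`). The inequality that drives the completion player thus
also controls the complexity of the class.

That inequality, `mwUpdate_spec`, combines the Pythagorean inequality for the entropy projection
(`relEntropy_argmin`) with local strong convexity of the relative entropy (`sq_trace_sub_mul_le`).
The max-norm enters through `exists_lift`: a pair of matrices of max-norm at most `K` lifts to the
feasible set.

With `v = δ^{1/6}` the tuning makes each error at most a constant times `ρ v` per round. For `δ > 1`
most bounds are trivial; only the entropy bound needs an argument, where the regret of the coverage
player alone suffices. -/

theorem exists_spectral {X : Matrix ι ι ℝ} (hX : X.IsHermitian) :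
    ∃ U : Matrix ι ι ℝ, Uᵀ * U = 1 ∧ U * Uᵀ = 1 ∧
      (∀ f : ℝ → ℝ, cfc f X = U * diagonal (fun i => f (hX.eigenvalues i)) * Uᵀ) ∧
      X = U * diagonal hX.eigenvalues * Uᵀ := by
  refine ⟨hX.eigenvectorUnitary, ?_, ?_, fun f => ?_, ?_⟩
  · simpa [star_eq_conjTranspose] using Unitary.coe_star_mul_self hX.eigenvectorUnitary
  · simpa [star_eq_conjTranspose] using Unitary.coe_mul_star_self hX.eigenvectorUnitary
  · rw [hX.cfc_eq, IsHermitian.cfc, Unitary.conjStarAlgAut_apply]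
    simp [star_eq_conjTranspose, Function.comp_def]
  · conv_lhs => rw [hX.spectral_theorem, Unitary.conjStarAlgAut_apply]
    simp [star_eq_conjTranspose]

theorem trace_conj_diagonal_mul (U V : Matrix ι ι ℝ) (a b : ι → ℝ) :
    (U * diagonal a * Uᵀ * (V * diagonal b * Vᵀ)).trace =
      ∑ i, ∑ j, a i * b j * (Uᵀ * V) i j ^ 2 := by
  have h : (U * diagonal a * Uᵀ * (V * diagonal b * Vᵀ)).trace =
      ((diagonal a * (Uᵀ * V)) * (diagonal b * (Uᵀ * V)ᵀ)).trace := by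
    rw [show U * diagonal a * Uᵀ * (V * diagonal b * Vᵀ) =
      U * (diagonal a * Uᵀ * (V * diagonal b * Vᵀ)) by simp only [Matrix.mul_assoc],
      trace_mul_comm]
    simp only [Matrix.mul_assoc, transpose_mul, transpose_transpose]
  rw [h]
  simp only [trace, diag_apply]
  refine Finset.sum_congr rfl fun i _ => ?_
  rw [Matrix.mul_apply]
  refine Finset.sum_congr rfl fun j _ => ?_
  rw [diagonal_mul, diagonal_mul, transpose_apply]
  ring

theorem sum_sq_row_of_mul_transpose {W : Matrix ι ι ℝ} (hW : W * Wᵀ = 1) (i : ι) :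
    ∑ j, W i j ^ 2 = 1 := by
  have := congrFun (congrFun hW i) i
  simpa [Matrix.mul_apply, sq] using this

theorem sum_sq_col_of_transpose_mul {W : Matrix ι ι ℝ} (hW : Wᵀ * W = 1) (j : ι) :
    ∑ i, W i j ^ 2 = 1 := by
  have := congrFun (congrFun hW j) j
  simpa [Matrix.mul_apply, sq] using this

/-- Scalar relative entropy. -/
noncomputable def scalarRelEntropy (a b : ℝ) : ℝ := a * Real.log a - a * Real.log b - a + b

/-- The bound `log y ≤ y - 1` at `y = √b / √a` shows that the relative entropy dominates the squared
Hellinger distance `(√a - √b)²`. Multiplying by `(√a + √b)² ≤ 2(a + b)` gives the claim. This is the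
scalar source of both strong convexity estimates, for matrices and for the simplex. -/
theorem sq_sub_div_le_scalarRelEntropy {a b : ℝ} (ha : 0 ≤ a) (hb : 0 < b) :
    (a - b) ^ 2 ≤ 2 * (a + b) * scalarRelEntropy a b := by
  have h1 : (√a - √b) ^ 2 ≤ scalarRelEntropy a b := by
    rcases ha.eq_or_lt with rfl | ha
    · simp [scalarRelEntropy, Real.sq_sqrt hb.le]
    · have h2 : Real.log (√b / √a) ≤ √b / √a - 1 :=
        Real.log_le_sub_one_of_pos (by positivity)
      rw [Real.log_div (by positivity) (by positivity), Real.log_sqrt hb.le,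
        Real.log_sqrt ha.le] at h2
      have h3 := mul_le_mul_of_nonneg_left h2 (by positivity : 0 ≤ 2 * a)
      have h4 : a * (√b / √a) = √a * √b := by
        have : a = √a * √a := (Real.mul_self_sqrt ha.le).symm
        field_simp
        rw [Real.sq_sqrt ha.le]
      have h5 := Real.sq_sqrt ha.le
      have h6 := Real.sq_sqrt hb.le
      unfold scalarRelEntropy
      nlinarith
  have h2 : (a - b) ^ 2 = (√a - √b) ^ 2 * (√a + √b) ^ 2 := by
    rw [← mul_pow, mul_comm, ← sq_sub_sq, Real.sq_sqrt ha, Real.sq_sqrt hb.le]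
  have h3 : (√a + √b) ^ 2 ≤ 2 * (a + b) := by
    nlinarith [Real.sq_sqrt ha, Real.sq_sqrt hb.le, sq_nonneg (√a - √b)]
  rw [h2]
  calc (√a - √b) ^ 2 * (√a + √b) ^ 2 ≤ scalarRelEntropy a b * (2 * (a + b)) := by
        gcongr
        exact (sq_nonneg _).trans h1
    _ = _ := by ring

theorem scalarRelEntropy_nonneg {a b : ℝ} (ha : 0 ≤ a) (hb : 0 < b) :
    0 ≤ scalarRelEntropy a b := by
  have h := (sq_nonneg (a - b)).trans (sq_sub_div_le_scalarRelEntropy ha hb)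
  exact nonneg_of_mul_nonneg_right h (by positivity)

/-- The squared overlaps of two orthonormal eigenbases form a doubly stochastic matrix, so sums over
one spectrum can be spread over pairs of eigenvalues. Noncommutativity survives only in these
nonnegative weights, and scalar inequalities transfer term by term. -/
theorem relEntropy_eq_sum {X Y : Matrix ι ι ℝ} {U V : Matrix ι ι ℝ} {a b : ι → ℝ}
    (hU : Uᵀ * U = 1) (hU' : U * Uᵀ = 1) (hV : Vᵀ * V = 1) (hV' : V * Vᵀ = 1)
    (hX : X = U * diagonal a * Uᵀ) (hY : Y = V * diagonal b * Vᵀ)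
    (hlX : matLog X = U * diagonal (fun i => Real.log (a i)) * Uᵀ)
    (hlY : matLog Y = V * diagonal (fun i => Real.log (b i)) * Vᵀ) :
    relEntropy X Y = ∑ i, ∑ j, scalarRelEntropy (a i) (b j) * (Uᵀ * V) i j ^ 2 := by
  have hW : (Uᵀ * V) * (Uᵀ * V)ᵀ = 1 := by
    rw [transpose_mul, transpose_transpose, show Uᵀ * V * (Vᵀ * U) = Uᵀ * (V * Vᵀ) * U by
      simp only [Matrix.mul_assoc], hV', Matrix.mul_one, hU]
  have hW' : (Uᵀ * V)ᵀ * (Uᵀ * V) = 1 := by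
    rw [transpose_mul, transpose_transpose, show Vᵀ * U * (Uᵀ * V) = Vᵀ * (U * Uᵀ) * V by
      simp only [Matrix.mul_assoc], hU', Matrix.mul_one, hV]
  have hr := sum_sq_row_of_mul_transpose hW
  have hc := sum_sq_col_of_transpose_mul hW'
  have h1 : (X * matLog X).trace = ∑ i, a i * Real.log (a i) := by
    rw [hlX]
    conv_lhs => rw [hX]
    rw [trace_conj_diagonal_mul, hU]
    refine Finset.sum_congr rfl fun i _ => ?_
    rw [Finset.sum_eq_single i]
    · simp
    · intro j _ hj
      simp [Matrix.one_apply_ne hj.symm]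
    · simp
  have h2 : (X * matLog Y).trace = ∑ i, ∑ j, a i * Real.log (b j) * (Uᵀ * V) i j ^ 2 := by
    rw [hlY, hX, trace_conj_diagonal_mul]
  have h3 : ∀ (Q : Matrix ι ι ℝ) (d : ι → ℝ), Qᵀ * Q = 1 →
      (Q * diagonal d * Qᵀ).trace = ∑ i, d i := by
    intro Q d hQ
    rw [trace_mul_comm, ← Matrix.mul_assoc, hQ, Matrix.one_mul, trace_diagonal]
  unfold relEntropy
  rw [trace_add, trace_sub, trace_sub, h1, h2]
  conv_lhs => rw [hX, hY, h3 U a hU, h3 V b hV]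
  have e1 : ∑ i, a i * Real.log (a i) =
      ∑ i, ∑ j, a i * Real.log (a i) * (Uᵀ * V) i j ^ 2 := by
    simp_rw [← Finset.mul_sum, hr, mul_one]
  have e2 : ∑ i, a i = ∑ i, ∑ j, a i * (Uᵀ * V) i j ^ 2 := by
    simp_rw [← Finset.mul_sum, hr, mul_one]
  have e3 : ∑ j, b j = ∑ i, ∑ j, b j * (Uᵀ * V) i j ^ 2 := by
    rw [Finset.sum_comm]
    simp_rw [← Finset.mul_sum, hc, mul_one]
  rw [e1, e2, e3]
  simp only [← Finset.sum_sub_distrib, ← Finset.sum_add_distrib, scalarRelEntropy]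
  refine Finset.sum_congr rfl fun i _ => Finset.sum_congr rfl fun j _ => by ring

theorem relEntropy_nonneg {X Y : Matrix ι ι ℝ} (hX : X.PosSemidef) (hY : Y.PosDef) :
    0 ≤ relEntropy X Y := by
  obtain ⟨U, hU, hU', hf, hXU⟩ := exists_spectral hX.isHermitian
  obtain ⟨V, hV, hV', hg, hYV⟩ := exists_spectral hY.isHermitian
  rw [relEntropy_eq_sum hU hU' hV hV' hXU hYV (hf _) (hg _)]
  exact Finset.sum_nonneg fun i _ => Finset.sum_nonneg fun j _ =>
    mul_nonneg (scalarRelEntropy_nonneg (hX.eigenvalues_nonneg i) (hY.eigenvalues_pos j))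
      (sq_nonneg _)

/-- Local strong convexity of the relative entropy against a symmetric matrix. -/
theorem sq_trace_sub_mul_le {X Y L : Matrix ι ι ℝ} (hX : X.PosSemidef) (hY : Y.PosDef)
    (hL : Lᵀ = L) :
    ((X - Y) * L).trace ^ 2 ≤
      2 * relEntropy X Y * ((X * (L * L)).trace + (Y * (L * L)).trace) := by
  obtain ⟨U, hU, hU', hf, hXU⟩ := exists_spectral hX.isHermitian
  obtain ⟨V, hV, hV', hg, hYV⟩ := exists_spectral hY.isHermitian
  set a := hX.isHermitian.eigenvalues
  set b := hY.isHermitian.eigenvalues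
  have ha : ∀ i, 0 ≤ a i := hX.eigenvalues_nonneg
  have hb : ∀ i, 0 < b i := hY.eigenvalues_pos
  rw [relEntropy_eq_sum hU hU' hV hV' hXU hYV (hf _) (hg _)]
  set W := Uᵀ * V with hW
  -- `L` is written in the mixed bases, rows for `X` and columns for `Y`, so that both traces become
  -- sums against the same `Q` and the eigenvalue differences `a i - b j` appear.
  set Q := Uᵀ * L * V with hQ
  have t1 : ((X - Y) * L).trace = ∑ i, ∑ j, (a i - b j) * W i j * Q i j := by
    have h1 : (X * L).trace = ∑ i, ∑ j, a i * W i j * Q i j := by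
      have : (X * L).trace = ((diagonal a * W) * Qᵀ).trace := by
        conv_lhs => rw [hXU]
        rw [show U * diagonal a * Uᵀ * L = U * (diagonal a * Uᵀ * L) by
          simp only [Matrix.mul_assoc], trace_mul_comm]
        rw [hQ, hW, transpose_mul, transpose_mul, transpose_transpose, hL]
        rw [show diagonal a * (Uᵀ * V) * (Vᵀ * (L * U)) = diagonal a * Uᵀ * (V * Vᵀ) * (L * U) by
          simp only [Matrix.mul_assoc], hV', Matrix.mul_one]
        simp only [Matrix.mul_assoc]
      rw [this]
      simp only [trace, diag_apply]
      refine Finset.sum_congr rfl fun i _ => ?_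
      rw [Matrix.mul_apply]
      refine Finset.sum_congr rfl fun j _ => ?_
      rw [diagonal_mul, transpose_apply]
    have h2 : (Y * L).trace = ∑ i, ∑ j, b j * W i j * Q i j := by
      have : (Y * L).trace = (W * diagonal b * Qᵀ).trace := by
        conv_lhs => rw [hYV]
        rw [show V * diagonal b * Vᵀ * L = (V * diagonal b * Vᵀ * L) * (U * Uᵀ) by
          rw [hU', Matrix.mul_one]]
        rw [← Matrix.mul_assoc, trace_mul_comm]
        rw [hQ, hW, transpose_mul, transpose_mul, transpose_transpose, hL]
        simp only [Matrix.mul_assoc]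
      rw [this]
      simp only [trace, diag_apply]
      refine Finset.sum_congr rfl fun i _ => ?_
      rw [Matrix.mul_apply]
      refine Finset.sum_congr rfl fun j _ => ?_
      rw [mul_diagonal, transpose_apply]
      ring
    rw [Matrix.sub_mul, trace_sub, h1, h2]
    simp only [← Finset.sum_sub_distrib]
    refine Finset.sum_congr rfl fun i _ => Finset.sum_congr rfl fun j _ => by ring
  have t2 : (X * (L * L)).trace + (Y * (L * L)).trace = ∑ i, ∑ j, (a i + b j) * Q i j ^ 2 := by
    have h1 : (X * (L * L)).trace = ∑ i, ∑ j, a i * Q i j ^ 2 := by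
      have : (X * (L * L)).trace = ((diagonal a * Q) * Qᵀ).trace := by
        conv_lhs => rw [hXU]
        rw [show U * diagonal a * Uᵀ * (L * L) = U * (diagonal a * Uᵀ * (L * L)) by
          simp only [Matrix.mul_assoc], trace_mul_comm]
        rw [hQ, transpose_mul, transpose_mul, transpose_transpose, hL]
        rw [show diagonal a * (Uᵀ * L * V) * (Vᵀ * (L * U)) =
            diagonal a * Uᵀ * L * (V * Vᵀ) * (L * U) by
          simp only [Matrix.mul_assoc], hV', Matrix.mul_one]
        simp only [Matrix.mul_assoc]
      rw [this]
      simp only [trace, diag_apply]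
      refine Finset.sum_congr rfl fun i _ => ?_
      rw [Matrix.mul_apply]
      refine Finset.sum_congr rfl fun j _ => ?_
      rw [diagonal_mul, transpose_apply]
      ring
    have h2 : (Y * (L * L)).trace = ∑ i, ∑ j, b j * Q i j ^ 2 := by
      have : (Y * (L * L)).trace = (Q * diagonal b * Qᵀ).trace := by
        conv_lhs => rw [hYV]
        rw [show V * diagonal b * Vᵀ * (L * L) = (V * diagonal b * Vᵀ * L) * (U * Uᵀ) * L by
          rw [hU', Matrix.mul_one]; simp only [Matrix.mul_assoc]]
        rw [show V * diagonal b * Vᵀ * L * (U * Uᵀ) * L =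
          (V * diagonal b * Vᵀ * L * U) * (Uᵀ * L) by simp only [Matrix.mul_assoc]]
        rw [trace_mul_comm, hQ, transpose_mul, transpose_mul, transpose_transpose, hL]
        simp only [Matrix.mul_assoc]
      rw [this]
      simp only [trace, diag_apply]
      refine Finset.sum_congr rfl fun i _ => ?_
      rw [Matrix.mul_apply]
      refine Finset.sum_congr rfl fun j _ => ?_
      rw [mul_diagonal, transpose_apply]
      ring
    rw [h1, h2]
    simp only [← Finset.sum_add_distrib]
    refine Finset.sum_congr rfl fun i _ => Finset.sum_congr rfl fun j _ => by ring
  rw [t1, t2]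
  simp only [← Finset.sum_product', Finset.univ_product_univ]
  -- Cauchy-Schwarz, with the overlaps `W` in the entropy factor and the direction `Q` in the other.
  calc (∑ x : ι × ι, (a x.1 - b x.2) * W x.1 x.2 * Q x.1 x.2) ^ 2
      ≤ (∑ x : ι × ι, 2 * scalarRelEntropy (a x.1) (b x.2) * W x.1 x.2 ^ 2) *
        ∑ x : ι × ι, (a x.1 + b x.2) * Q x.1 x.2 ^ 2 := by
        refine Finset.sum_sq_le_sum_mul_sum_of_sq_le_mul _ (fun x _ => ?_) (fun x _ => ?_)
          (fun x _ => ?_)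
        · have := scalarRelEntropy_nonneg (ha x.1) (hb x.2)
          positivity
        · have := ha x.1
          have := (hb x.2).le
          positivity
        · have h := sq_sub_div_le_scalarRelEntropy (ha x.1) (hb x.2)
          calc ((a x.1 - b x.2) * W x.1 x.2 * Q x.1 x.2) ^ 2
              = (a x.1 - b x.2) ^ 2 * (W x.1 x.2 ^ 2 * Q x.1 x.2 ^ 2) := by ring
            _ ≤ (2 * (a x.1 + b x.2) * scalarRelEntropy (a x.1) (b x.2)) *
                  (W x.1 x.2 ^ 2 * Q x.1 x.2 ^ 2) := by gcongr
            _ = _ := by ring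
    _ = _ := by
        congr 1
        simp only [mul_assoc, ← Finset.mul_sum]
end Spectral

end PMC

/-! ### First-order optimality along segments. -/

namespace PMC

open Matrix

/-- If `x` minimizes `R - ℓ` over a convex set, then the excess of `R - ℓ` at `z` dominates the
Bregman divergence from `z` to every point of the segment from `x` to `z`. -/
theorem bregman_segment_le {E : Type*} [AddCommGroup E] [Module ℝ E] {S : Set E}
    (hS : Convex ℝ S) (R : E → ℝ) (G : E → E →ₗ[ℝ] ℝ) (ℓ : E →ₗ[ℝ] ℝ) {x z : E}
    (hx : x ∈ S) (hz : z ∈ S) (hmin : IsMinOn (fun y => R y - ℓ y) S x) {s : ℝ}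
    (hs : 0 < s) (hs1 : s ≤ 1)
    (hB : 0 ≤ R x - R (x + s • (z - x)) - G (x + s • (z - x)) (x - (x + s • (z - x)))) :
    R z - R (x + s • (z - x)) - G (x + s • (z - x)) (z - (x + s • (z - x))) ≤
      (R z - ℓ z) - (R x - ℓ x) := by
  have hmem : x + s • (z - x) ∈ S := hS.add_smul_sub_mem hx hz ⟨hs.le, hs1⟩
  have h1 := isMinOn_iff.1 hmin _ hmem
  have e1 : x - (x + s • (z - x)) = (-s) • (z - x) := by rw [neg_smul]; abel
  have e2 : z - (x + s • (z - x)) = (1 - s) • (z - x) := by rw [sub_smul, one_smul]; abel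
  rw [e1] at hB
  rw [e2]
  set w := x + s • (z - x) with hw
  have e3 : ℓ w = ℓ x + s * (ℓ z - ℓ x) := by
    rw [hw, map_add, map_smul, map_sub, smul_eq_mul]
  rw [map_smul, smul_eq_mul] at hB ⊢
  simp only [e3] at h1
  set g := G w (z - x)
  -- Minimality is tested only at `w`, and nonnegativity of the divergence based at `w` replaces a
  -- derivative at `x`. Hence `R` may fail to be differentiable at the minimizer, which is not yet
  -- known to be an interior point.
  have h2 : 0 ≤ (1 - s) * (R x - R w - -s * g) := mul_nonneg (by linarith) hB
  have h3 : s * (R z - R w - (1 - s) * g) ≤ s * ((R z - ℓ z) - (R x - ℓ x)) := by nlinarith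
  exact le_of_mul_le_mul_left h3 hs

/-! ### Continuity of the functional calculus; logarithm and exponential. -/

section Continuity

variable {ι : Type*} [Fintype ι] [DecidableEq ι]

theorem eigenvalues_mem_Icc {X : Matrix ι ι ℝ} (hX : X.IsHermitian) {a b : ℝ}
    (ha : (X - a • (1 : Matrix ι ι ℝ)).PosSemidef) (hb : (b • (1 : Matrix ι ι ℝ) - X).PosSemidef)
    (i : ι) : hX.eigenvalues i ∈ Set.Icc a b := by
  obtain ⟨U, hU, hU', -, hXU⟩ := exists_spectral hX
  have key : Uᵀ * X * U = diagonal hX.eigenvalues := by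
    conv_lhs => rw [hXU]
    rw [show Uᵀ * (U * diagonal hX.eigenvalues * Uᵀ) * U =
      (Uᵀ * U) * diagonal hX.eigenvalues * (Uᵀ * U) by simp only [Matrix.mul_assoc], hU]
    simp
  have h1 := (ha.conjTranspose_mul_mul_same U).diag_nonneg (i := i)
  have h2 := (hb.conjTranspose_mul_mul_same U).diag_nonneg (i := i)
  rw [conjTranspose_eq_transpose_of_trivial] at h1 h2
  rw [Matrix.mul_sub, Matrix.sub_mul, key] at h1 h2
  simp only [Matrix.mul_smul, Matrix.smul_mul, Matrix.mul_one, hU, Matrix.sub_apply, Matrix.smul_apply,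
    one_apply_eq, diagonal_apply_eq, smul_eq_mul] at h1 h2
  constructor <;> linarith

/-- In spectral form an entry is a sum of values at the eigenvalues weighted by products of
eigenvector entries, each of modulus at most `1`. A uniform estimate on the spectrum thus passes to
entries. -/
theorem cfc_apply_sub_le {X : Matrix ι ι ℝ} (hX : X.IsHermitian) {f g : ℝ → ℝ} {ε : ℝ}
    (hfg : ∀ i, |f (hX.eigenvalues i) - g (hX.eigenvalues i)| ≤ ε) (i j : ι) :
    |cfc f X i j - cfc g X i j| ≤ ε * Fintype.card ι := by
  obtain ⟨U, hU, hU', hf, hXU⟩ := exists_spectral hX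
  have hentry : ∀ h : ℝ → ℝ, cfc h X i j = ∑ k, h (hX.eigenvalues k) * (U i k * U j k) := by
    intro h
    rw [hf, Matrix.mul_apply]
    refine Finset.sum_congr rfl fun k _ => ?_
    rw [mul_diagonal, transpose_apply]
    ring
  have hU1 : ∀ i k, |U i k| ≤ 1 := by
    intro i k
    have h1 := sum_sq_row_of_mul_transpose hU' i
    have h2 : U i k ^ 2 ≤ ∑ j, U i j ^ 2 :=
      Finset.single_le_sum (f := fun j => U i j ^ 2) (fun j _ => sq_nonneg _) (Finset.mem_univ k)
    exact (sq_le_one_iff_abs_le_one _).1 (h2.trans h1.le)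
  rw [hentry, hentry, ← Finset.sum_sub_distrib]
  calc |∑ k, (f (hX.eigenvalues k) * (U i k * U j k) - g (hX.eigenvalues k) * (U i k * U j k))|
      ≤ ∑ k : ι, ε := by
        refine (Finset.abs_sum_le_sum_abs _ _).trans (Finset.sum_le_sum fun k _ => ?_)
        rw [← sub_mul, abs_mul, abs_mul]
        have h0 : 0 ≤ ε := (abs_nonneg _).trans (hfg k)
        calc _ ≤ ε * (1 * 1) := by
              gcongr
              · exact hfg k
              · exact hU1 i k
              · exact hU1 j k
          _ = ε := by ring
    _ = ε * Fintype.card ι := by simp [mul_comm]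

/-- By the Weierstrass theorem `f` is a uniform limit of polynomials on the interval containing all
the spectra, and polynomials in a matrix are continuous. -/
theorem continuousOn_cfc_of_spectrum_Icc {f : ℝ → ℝ} {a b : ℝ}
    (hf : ContinuousOn f (Set.Icc a b)) :
    ContinuousOn (fun X : Matrix ι ι ℝ => cfc f X)
      {X | (X - a • (1 : Matrix ι ι ℝ)).PosSemidef ∧ (b • (1 : Matrix ι ι ℝ) - X).PosSemidef} := by
  refine continuousOn_pi.2 fun i => continuousOn_pi.2 fun j => ?_
  refine continuousOn_of_uniform_approx_of_continuousOn fun u hu => ?_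
  obtain ⟨ε, hε, hu⟩ := Metric.mem_uniformity_dist.1 hu
  obtain ⟨p, hp⟩ := exists_polynomial_near_of_continuousOn a b f hf
    (ε / (Fintype.card ι + 1)) (by positivity)
  refine ⟨fun X => (Polynomial.aeval X p) i j, ?_, fun X hX => hu ?_⟩
  · have : Continuous fun X : Matrix ι ι ℝ => Polynomial.aeval X p := p.continuous_aeval
    exact ((continuous_apply_apply i j).comp this).continuousOn
  · have hH : X.IsHermitian := by
      have := hX.1.isHermitian.add (isHermitian_one.smul (R := ℝ) (k := a) (IsSelfAdjoint.all a))
      simpa using this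
    have h1 : Polynomial.aeval X p = cfc p.eval X := (cfc_polynomial p X hH).symm
    have h2 : |cfc f X i j - Polynomial.aeval X p i j| < ε := by
      rw [h1]
      refine (cfc_apply_sub_le (ε := ε / (Fintype.card ι + 1)) hH (fun k => ?_) i j).trans_lt ?_
      · rw [abs_sub_comm]
        exact (hp _ (eigenvalues_mem_Icc hH hX.1 hX.2 k)).le
      · rw [div_mul_eq_mul_div, div_lt_iff₀ (by positivity)]
        nlinarith
    exact h2

theorem matLog_exp {X : Matrix ι ι ℝ} (hX : X.IsHermitian) :
    matLog (NormedSpace.exp X) = X := by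
  obtain ⟨U, hU, hU', hf, hXU⟩ := exists_spectral hX
  have h1 : NormedSpace.exp X = cfc Real.exp X := by
    have hinv : U⁻¹ = Uᵀ := Matrix.inv_eq_left_inv hU
    rw [hf Real.exp]
    conv_lhs => rw [hXU, ← hinv]
    rw [Matrix.exp_conj _ _ (IsUnit.of_mul_eq_one _ hU'), Matrix.exp_diagonal, hinv]
    congr 3
    ext i
    rw [Pi.coe_exp, ← Real.exp_eq_exp_ℝ]
  have hsp : ∀ f : ℝ → ℝ, ContinuousOn f (spectrum ℝ X) := fun f =>
    Set.Finite.continuousOn X.finite_real_spectrum f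
  rw [h1, matLog]
  refine (cfc_comp' Real.log Real.exp X ((X.finite_real_spectrum.image _).continuousOn _)
    (hsp _) hX).symm.trans ?_
  simp only [Real.log_exp]
  exact cfc_id' ℝ X hX

theorem matLog_isHermitian (X : Matrix ι ι ℝ) : (matLog X).IsHermitian :=
  cfc_predicate Real.log X

end Continuity

end PMC

/-! ### Entropy projections and their Pythagorean inequality. -/

namespace PMC

open Matrix Filter Topology

section Argmin

variable {ι : Type*} [Fintype ι] [DecidableEq ι]

theorem argminOn_spec {E : Type*} [Nonempty E] {S : Set E} {f : E → ℝ}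
    (h : ∃ a ∈ S, IsMinOn f S a) : argminOn S f ∈ S ∧ IsMinOn f S (argminOn S f) :=
  Classical.epsilon_spec (p := fun a => a ∈ S ∧ IsMinOn f S a) h

theorem relEntropy_eq_trace (X Y : Matrix ι ι ℝ) :
    relEntropy X Y = (X * matLog X).trace - X.trace - (X * matLog Y).trace + Y.trace := by
  simp only [relEntropy, trace_add, trace_sub]
  ring

theorem mul_matLog_self {X : Matrix ι ι ℝ} (hX : X.IsHermitian) :
    X * matLog X = cfc (fun x => x * Real.log x) X := by
  have hsp : ∀ f : ℝ → ℝ, ContinuousOn f (spectrum ℝ X) := fun f =>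
    Set.Finite.continuousOn X.finite_real_spectrum f
  refine Eq.trans ?_ (cfc_mul (fun x => x) Real.log X (hsp _) (hsp _)).symm
  exact congrArg (· * cfc Real.log X) (cfc_id' ℝ X hX).symm

theorem posSemidef_smul_one_sub {X : Matrix ι ι ℝ} (hX : X.IsHermitian) {b : ℝ}
    (hb : ∀ i, hX.eigenvalues i ≤ b) : (b • (1 : Matrix ι ι ℝ) - X).PosSemidef := by
  obtain ⟨U, hU, hU', -, hXU⟩ := exists_spectral hX
  have h : b • (1 : Matrix ι ι ℝ) - X = U * diagonal (fun i => b - hX.eigenvalues i) * Uᵀ := by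
    conv_lhs => rw [hXU, ← hU']
    rw [show diagonal (fun i => b - hX.eigenvalues i) =
      b • (1 : Matrix ι ι ℝ) - diagonal hX.eigenvalues by
        rw [smul_one_eq_diagonal, diagonal_sub]]
    simp [Matrix.mul_sub, Matrix.sub_mul]
  rw [h]
  have := (PosSemidef.diagonal (d := fun i => b - hX.eigenvalues i)
    (fun i => sub_nonneg.2 (hb i))).mul_mul_conjTranspose_same U
  simpa using this

theorem posSemidef_sub_smul_one {X : Matrix ι ι ℝ} (hX : X.IsHermitian) {a : ℝ}
    (ha : ∀ i, a ≤ hX.eigenvalues i) : (X - a • (1 : Matrix ι ι ℝ)).PosSemidef := by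
  obtain ⟨U, hU, hU', -, hXU⟩ := exists_spectral hX
  have h : X - a • (1 : Matrix ι ι ℝ) = U * diagonal (fun i => hX.eigenvalues i - a) * Uᵀ := by
    conv_lhs => rw [hXU, ← hU']
    rw [show diagonal (fun i => hX.eigenvalues i - a) =
      diagonal hX.eigenvalues - a • (1 : Matrix ι ι ℝ) by
        rw [smul_one_eq_diagonal, diagonal_sub]]
    simp [Matrix.mul_sub, Matrix.sub_mul]
  rw [h]
  have := (PosSemidef.diagonal (d := fun i => hX.eigenvalues i - a)
    (fun i => sub_nonneg.2 (ha i))).mul_mul_conjTranspose_same U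
  simpa using this

theorem eigenvalues_le_trace {X : Matrix ι ι ℝ} (hX : X.PosSemidef) (i : ι) :
    hX.isHermitian.eigenvalues i ≤ X.trace := by
  rw [hX.isHermitian.trace_eq_sum_eigenvalues]
  simpa using Finset.single_le_sum (f := fun i => hX.isHermitian.eigenvalues i)
    (fun j _ => hX.eigenvalues_nonneg j) (Finset.mem_univ i)

theorem posSemidef_smul_one_sub_of_trace_le {X : Matrix ι ι ℝ} (hX : X.PosSemidef) {b : ℝ}
    (hb : X.trace ≤ b) : (b • (1 : Matrix ι ι ℝ) - X).PosSemidef :=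
  posSemidef_smul_one_sub hX.isHermitian fun i => (eigenvalues_le_trace hX i).trans hb

/-- The relative entropy is continuous in its first argument on bounded sets of positive
semidefinite matrices. -/
theorem continuousOn_relEntropy_left (Y : Matrix ι ι ℝ) {S : Set (Matrix ι ι ℝ)} {b : ℝ}
    (hS : ∀ X ∈ S, X.PosSemidef ∧ X.trace ≤ b) :
    ContinuousOn (fun X => relEntropy X Y) S := by
  -- With `0 log 0 = 0` the function `x log x` is continuous up to `0`, so singular matrices are
  -- allowed although `matLog` is discontinuous there.
  have h1 : ContinuousOn (fun X : Matrix ι ι ℝ => cfc (fun x : ℝ => x * Real.log x) X) S := by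
    refine (continuousOn_cfc_of_spectrum_Icc (a := 0) (b := b)
      Real.continuous_mul_log.continuousOn).mono fun X hX => ⟨?_, ?_⟩
    · simpa using (hS X hX).1
    · exact posSemidef_smul_one_sub_of_trace_le (hS X hX).1 (hS X hX).2
  have h2 : ContinuousOn (fun X : Matrix ι ι ℝ =>
      (cfc (fun x : ℝ => x * Real.log x) X).trace - X.trace -
        (X * matLog Y).trace + Y.trace) S := by
    have ht : Continuous fun X : Matrix ι ι ℝ => X.trace := continuous_id.matrix_trace
    have hm : Continuous fun X : Matrix ι ι ℝ => (X * matLog Y).trace :=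
      (continuous_id.matrix_mul continuous_const).matrix_trace
    exact (((ht.comp_continuousOn h1).sub ht.continuousOn).sub hm.continuousOn).add
      continuousOn_const
  refine h2.congr fun X hX => ?_
  simp only
  rw [relEntropy_eq_trace, mul_matLog_self (hS X hX).1.isHermitian]

/-- Generalized Pythagorean inequality for a minimizer of the relative entropy over a convex set
that contains a positive multiple of the identity. -/
theorem relEntropy_argmin {S : Set (Matrix ι ι ℝ)} (hS : Convex ℝ S)
    (hpsd : ∀ X ∈ S, X.PosSemidef) {c : ℝ} (hc : 0 < c) (hcS : c • (1 : Matrix ι ι ℝ) ∈ S)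
    {Y X : Matrix ι ι ℝ} (hX : X ∈ S) (hmin : IsMinOn (fun X' => relEntropy X' Y) S X) :
    X.PosDef ∧ ∀ Z ∈ S, relEntropy Z X ≤ relEntropy Z Y - relEntropy X Y := by
  let R : Matrix ι ι ℝ → ℝ := fun Z => (Z * matLog Z).trace - Z.trace
  let G : Matrix ι ι ℝ → Matrix ι ι ℝ →ₗ[ℝ] ℝ := fun W =>
    (traceLinearMap ι ℝ ℝ) ∘ₗ (LinearMap.mulRight ℝ (matLog W))
  have hG : ∀ W Z, G W Z = (Z * matLog W).trace := fun W Z => rfl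
  have hD : ∀ Z W, R Z - R W - G W (Z - W) = relEntropy Z W := by
    intro Z W
    rw [relEntropy_eq_trace, hG, Matrix.sub_mul, trace_sub]
    simp only [R]
    ring
  have hR : ∀ Z, R Z - G Y Z = relEntropy Z Y - Y.trace := by
    intro Z
    rw [relEntropy_eq_trace, hG]
    simp only [R]
    ring
  have hmin' : IsMinOn (fun Z => R Z - G Y Z) S X := by
    refine isMinOn_iff.2 fun Z hZ => ?_
    rw [hR, hR]
    have := isMinOn_iff.1 hmin Z hZ
    linarith
  have hstep : ∀ Z ∈ S, ∀ s : ℝ, 0 < s → s ≤ 1 → (X + s • (Z - X)).PosDef →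
      relEntropy Z (X + s • (Z - X)) ≤ relEntropy Z Y - relEntropy X Y := by
    intro Z hZ s hs hs1 hpd
    have h := bregman_segment_le hS R G (G Y) hX hZ hmin' hs hs1
      (by rw [hD]; exact relEntropy_nonneg (hpsd X hX) hpd)
    rw [hD, hR, hR] at h
    linarith
  have hline : ∀ Z : Matrix ι ι ℝ, Continuous fun s : ℝ => X + s • (Z - X) := fun Z => by fun_prop
  -- The multiple `c • 1` serves as comparator. The divergences from it to points of the segment
  -- stay bounded as `s → 0`, while the logarithmic term in them is `-c log det`. The determinants
  -- therefore stay away from `0`, and the limit `X` is nonsingular.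
  have hpd : X.PosDef := by
    set Z := c • (1 : Matrix ι ι ℝ) with hZ
    have hZpd : Z.PosDef := PosDef.one.smul hc
    have hseg : ∀ s : ℝ, 0 < s → s ≤ 1 → (X + s • (Z - X)).PosDef := by
      intro s hs hs1
      have h1 : X + s • (Z - X) = (1 - s) • X + s • Z := by
        rw [smul_sub, sub_smul, one_smul]; abel
      rw [h1]
      exact PosDef.posSemidef_add ((hpsd X hX).smul (by linarith)) (hZpd.smul hs)
    have hlog : ∀ W : Matrix ι ι ℝ, W.PosDef → (Z * matLog W).trace = c * Real.log W.det := by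
      intro W hW
      obtain ⟨V, hV, hV', hg, hWV⟩ := exists_spectral hW.isHermitian
      rw [hZ, Matrix.smul_mul, Matrix.one_mul, trace_smul, smul_eq_mul, matLog, hg, trace_mul_comm,
        ← Matrix.mul_assoc, hV, Matrix.one_mul, trace_diagonal,
        hW.isHermitian.det_eq_prod_eigenvalues]
      simp only [RCLike.ofReal_real_eq_id, id]
      rw [Real.log_prod fun i _ => (hW.eigenvalues_pos i).ne']
    obtain ⟨C, hC⟩ : ∃ C, ∀ s : ℝ, 0 < s → s ≤ 1 → C ≤ Real.log (X + s • (Z - X)).det := by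
      refine ⟨((Z * matLog Z).trace - Z.trace - (relEntropy Z Y - relEntropy X Y)) / c,
        fun s hs hs1 => ?_⟩
      have h1 := hstep Z hcS s hs hs1 (hseg s hs hs1)
      rw [relEntropy_eq_trace Z (X + s • (Z - X)), hlog _ (hseg s hs hs1)] at h1
      rw [div_le_iff₀ hc]
      have h2 := (hseg s hs hs1).posSemidef.trace_nonneg
      linarith
    have hdet : Real.exp C ≤ X.det := by
      have hcont : Tendsto (fun s : ℝ => (X + s • (Z - X)).det) (𝓝[>] 0) (𝓝 X.det) := by
        have h1 : Continuous fun s : ℝ => (X + s • (Z - X)).det := (hline Z).matrix_det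
        have h2 := h1.tendsto 0
        rw [zero_smul, add_zero] at h2
        exact h2.mono_left nhdsWithin_le_nhds
      refine ge_of_tendsto hcont ?_
      filter_upwards [Ioo_mem_nhdsGT (zero_lt_one' ℝ)] with s hs
      rw [← Real.le_log_iff_exp_le (hseg s hs.1 hs.2.le).det_pos]
      exact hC s hs.1 hs.2.le
    exact ((hpsd X hX).posDef_iff_det_ne_zero).2 ((Real.exp_pos C).trans_le hdet).ne'
  refine ⟨hpd, fun Z hZ => ?_⟩
  -- For `s ≤ 1/2` the spectra along the segment lie between `a / 2` and the sum of the two traces,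
  -- away from the singularity of the logarithm. The segment inequality can then be passed to the
  -- limit `s → 0`.
  obtain ⟨a, ha, haX⟩ : ∃ a : ℝ, 0 < a ∧ (X - a • (1 : Matrix ι ι ℝ)).PosSemidef := by
    rcases isEmpty_or_nonempty ι with h | h
    · exact ⟨1, one_pos, by rw [Subsingleton.elim (X - _) 0]; exact PosSemidef.zero⟩
    · obtain ⟨i, hi⟩ := Finite.exists_min hpd.isHermitian.eigenvalues
      exact ⟨_, hpd.eigenvalues_pos i, posSemidef_sub_smul_one hpd.isHermitian hi⟩
  set b := X.trace + Z.trace with hb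
  have hmem : ∀ s : ℝ, 0 ≤ s → s ≤ 1 / 2 →
      ((X + s • (Z - X)) - (a / 2) • (1 : Matrix ι ι ℝ)).PosSemidef ∧
      (b • (1 : Matrix ι ι ℝ) - (X + s • (Z - X))).PosSemidef := by
    intro s hs hs1
    constructor
    · have h1 : (X + s • (Z - X)) - (a / 2) • (1 : Matrix ι ι ℝ) =
          (1 - s) • (X - a • (1 : Matrix ι ι ℝ)) + s • Z +
            ((1 - s) * a - a / 2) • (1 : Matrix ι ι ℝ) := by
        ext i j
        simp only [Matrix.sub_apply, Matrix.add_apply, Matrix.smul_apply, smul_eq_mul]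
        ring
      rw [h1]
      exact ((haX.smul (by linarith)).add ((hpsd Z hZ).smul hs)).add
        (PosSemidef.one.smul (by nlinarith))
    · have hp : (X + s • (Z - X)).PosSemidef :=
        hpsd _ (hS.add_smul_sub_mem hX hZ ⟨hs, by linarith⟩)
      refine posSemidef_smul_one_sub_of_trace_le hp ?_
      have h1 := (hpsd X hX).trace_nonneg
      have h2 := (hpsd Z hZ).trace_nonneg
      rw [trace_add, trace_smul, trace_sub, smul_eq_mul, hb]
      nlinarith
  have hlim : Tendsto (fun s : ℝ => relEntropy Z (X + s • (Z - X))) (𝓝[>] 0)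
      (𝓝 (relEntropy Z X)) := by
    have hcont : ContinuousOn (fun s : ℝ => relEntropy Z (X + s • (Z - X)))
        (Set.Icc 0 (1 / 2)) := by
      have hl : ContinuousOn (fun s : ℝ => matLog (X + s • (Z - X))) (Set.Icc 0 (1 / 2)) := by
        have h1 := continuousOn_cfc_of_spectrum_Icc (ι := ι) (f := Real.log) (a := a / 2) (b := b)
          (Real.continuousOn_log.mono fun x hx => by
            simp only [Set.mem_compl_iff, Set.mem_singleton_iff]
            have := hx.1
            intro h
            linarith)
        exact h1.comp (hline Z).continuousOn fun s hs => hmem s hs.1 hs.2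
      simp only [relEntropy_eq_trace]
      have ht : Continuous fun X : Matrix ι ι ℝ => X.trace := continuous_id.matrix_trace
      have hm : Continuous fun W : Matrix ι ι ℝ => (Z * W).trace :=
        (continuous_const.matrix_mul continuous_id).matrix_trace
      exact (continuousOn_const.sub (hm.comp_continuousOn hl)).add
        (ht.comp (hline Z)).continuousOn
    have h0 := hcont 0 ⟨le_refl _, by norm_num⟩
    have h1 : Tendsto (fun s : ℝ => relEntropy Z (X + s • (Z - X))) (𝓝[Set.Icc 0 (1 / 2)] 0)
        (𝓝 (relEntropy Z X)) := by
      have h2 := h0.tendsto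
      rwa [zero_smul, add_zero] at h2
    refine h1.mono_left ?_
    rw [← nhdsWithin_Ioc_eq_nhdsGT (show (0 : ℝ) < 1 / 2 by norm_num)]
    exact nhdsWithin_mono _ Set.Ioc_subset_Icc_self
  refine le_of_tendsto hlim ?_
  filter_upwards [Ioo_mem_nhdsGT (show (0 : ℝ) < 1 / 2 by norm_num)] with s hs
  refine hstep Z hZ s hs.1 (by linarith [hs.2]) ?_
  have h1 := PosDef.posSemidef_add (hmem s hs.1.le hs.2.le).1
    ((PosDef.one (n := ι) (R := ℝ)).smul (half_pos ha))
  simpa using h1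

end Argmin

end PMC

/-! ### Positive semidefinite matrices with bounded diagonal. -/

namespace PMC

open Matrix Filter Topology

section PSD

variable {ι κ : Type*} [Fintype ι] [Fintype κ]

theorem isClosed_posSemidef : IsClosed {X : Matrix ι ι ℝ | X.PosSemidef} := by
  simp only [posSemidef_iff_dotProduct_mulVec, Set.ofPred_and, Set.ofPred_forall]
  refine IsClosed.inter (isClosed_eq continuous_id.matrix_conjTranspose continuous_id)
    (isClosed_iInter fun x => isClosed_le continuous_const ?_)
  exact continuous_const.dotProduct (continuous_id.matrix_mulVec continuous_const)

/-- The quadratic form is nonnegative at the sum and at the difference of two basis vectors. -/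
theorem abs_apply_le_of_posSemidef [DecidableEq ι] {X : Matrix ι ι ℝ} (hX : X.PosSemidef) {K : ℝ}
    (hK : ∀ a, X a a ≤ K) (a b : ι) : |X a b| ≤ K := by
  have hsymm : X b a = X a b := by simpa using hX.isHermitian.apply a b
  have key : ∀ c : ℝ, 0 ≤ X a a + 2 * c * X a b + c ^ 2 * X b b := by
    intro c
    have h := hX.dotProduct_mulVec_nonneg (Pi.single a 1 + c • Pi.single b 1)
    simp only [star_trivial, mulVec_add, mulVec_smul, add_dotProduct, dotProduct_add,
      smul_dotProduct, dotProduct_smul, mulVec_single_one, single_one_dotProduct, col_apply,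
      smul_eq_mul, hsymm] at h
    linarith
  have h1 := key 1
  have h2 := key (-1)
  have h3 := hK a
  have h4 := hK b
  rw [abs_le]
  constructor <;> linarith

/-- The second-order term of multiplicative weights is controlled by the entrywise `ℓ₁` norm of `L`,
because the gradients of the completion player are small in that norm: a confidence matrix plus one
entry. -/
theorem trace_mul_mul_self_le {X L : Matrix ι ι ℝ} {K : ℝ} (hX : ∀ a b, |X a b| ≤ K) :
    (X * (L * L)).trace ≤ K * (∑ a, ∑ b, |L a b|) ^ 2 := by
  have h1 : (X * (L * L)).trace = ∑ a, ∑ b, ∑ c, X a b * (L b c * L c a) := by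
    simp only [trace, diag_apply, Matrix.mul_apply, Finset.mul_sum]
  have h2 : ∀ a b c, X a b * (L b c * L c a) ≤ K * (|L b c| * |L c a|) := by
    intro a b c
    refine (le_abs_self _).trans ?_
    rw [abs_mul, abs_mul]
    gcongr
    exact hX a b
  rw [h1]
  calc ∑ a, ∑ b, ∑ c, X a b * (L b c * L c a)
      ≤ ∑ a, ∑ b, ∑ c, K * (|L b c| * |L c a|) :=
        Finset.sum_le_sum fun a _ => Finset.sum_le_sum fun b _ => Finset.sum_le_sum fun c _ =>
          h2 a b c
    _ = ∑ c, K * ((∑ b, |L b c|) * ∑ a, |L c a|) := by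
        rw [Finset.sum_congr rfl fun a _ => Finset.sum_comm, Finset.sum_comm]
        refine Finset.sum_congr rfl fun c _ => ?_
        rw [Finset.sum_mul_sum, Finset.sum_comm, Finset.mul_sum]
        refine Finset.sum_congr rfl fun b _ => ?_
        rw [Finset.mul_sum]
    _ ≤ ∑ c, K * ((∑ a, ∑ b, |L a b|) * ∑ a, |L c a|) := by
        rcases isEmpty_or_nonempty ι with h | ⟨⟨i⟩⟩
        · simp
        have hK : 0 ≤ K := (abs_nonneg _).trans (hX i i)
        gcongr with c _ b _
        exact Finset.single_le_sum (f := fun c => |L b c|) (fun _ _ => abs_nonneg _)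
          (Finset.mem_univ c)
    _ = _ := by
        rw [← Finset.mul_sum, ← Finset.mul_sum, sq]

theorem posSemidef_fromBlocks_diagonal {A : Matrix ι ι ℝ} {B : Matrix κ κ ℝ}
    (hA : A.PosSemidef) (hB : B.PosSemidef) : (fromBlocks A 0 0 B).PosSemidef := by
  refine PosSemidef.of_dotProduct_mulVec_nonneg ?_ fun x => ?_
  · exact IsHermitian.fromBlocks hA.isHermitian (by simp) hB.isHermitian
  · have h1 := hA.dotProduct_mulVec_nonneg (x ∘ Sum.inl)
    have h2 := hB.dotProduct_mulVec_nonneg (x ∘ Sum.inr)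
    have h3 : star x ⬝ᵥ fromBlocks A 0 0 B *ᵥ x =
        star (x ∘ Sum.inl) ⬝ᵥ A *ᵥ (x ∘ Sum.inl) + star (x ∘ Sum.inr) ⬝ᵥ B *ᵥ (x ∘ Sum.inr) := by
      rw [fromBlocks_mulVec]
      simp [dotProduct, Fintype.sum_sum_type]
    rw [h3]
    positivity

end PSD

/-! ### From the max-norm to feasible lifts. -/

section Lift

variable {m n : ℕ} {K : ℝ}

theorem rowNorm_nonneg {m d : ℕ} (U : Matrix (Fin m) (Fin d) ℝ) : 0 ≤ rowNorm U :=
  Real.iSup_nonneg fun _ => Real.sqrt_nonneg _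

theorem sum_sq_le_rowNorm_sq {m d : ℕ} (U : Matrix (Fin m) (Fin d) ℝ) (i : Fin m) :
    ∑ k, U i k ^ 2 ≤ rowNorm U ^ 2 := by
  have h : √(∑ k, U i k ^ 2) ≤ rowNorm U :=
    le_ciSup (f := fun i => √(∑ k, U i k ^ 2)) (Set.finite_range _).bddAbove i
  rw [← Real.sqrt_le_left (rowNorm_nonneg U)]
  exact h

/-- Positive semidefinite completions with diagonal at most `b` and off-diagonal block `M`. -/
def gramSet (M : Matrix (Fin m) (Fin n) ℝ) (b : ℝ) :
    Set (Matrix (Fin m ⊕ Fin n) (Fin m ⊕ Fin n) ℝ) :=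
  {Q | Q.PosSemidef ∧ (∀ a, Q a a ≤ b) ∧ Q.toBlocks₁₂ = M}

theorem isClosed_gramSet (M : Matrix (Fin m) (Fin n) ℝ) (b : ℝ) : IsClosed (gramSet M b) := by
  refine isClosed_posSemidef.inter (IsClosed.inter ?_ ?_)
  · have h : IsClosed (⋂ a, {Q : Matrix (Fin m ⊕ Fin n) (Fin m ⊕ Fin n) ℝ | Q a a ≤ b}) :=
      isClosed_iInter fun a => isClosed_le (continuous_id.matrix_elem a a) continuous_const
    rwa [← Set.ofPred_forall] at h
  · refine isClosed_eq ?_ continuous_const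
    exact continuous_pi fun i => continuous_pi fun j => by
      simp only [toBlocks₁₂, of_apply]; fun_prop

theorem isCompact_of_posSemidef {ι : Type*} [Fintype ι] [DecidableEq ι] {S : Set (Matrix ι ι ℝ)}
    (hS : IsClosed S) {b : ℝ} (h : ∀ X ∈ S, X.PosSemidef ∧ ∀ a, X a a ≤ b) : IsCompact S := by
  refine IsCompact.of_isClosed_subset
    (isCompact_univ_pi fun _ => isCompact_univ_pi fun _ => isCompact_Icc (a := -b) (b := b)) hS
    fun X hX => ?_
  intro i _ j _
  exact abs_le.1 (abs_apply_le_of_posSemidef (h X hX).1 (h X hX).2 i j)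

/-- Stack the two factors of a near-optimal factorization, rescaled so that their row norms balance,
and take the Gram matrix. -/
theorem gramSet_nonempty_of_maxNorm_lt {M : Matrix (Fin m) (Fin n) ℝ} {b : ℝ}
    (h : maxNorm M < b) : (gramSet M b).Nonempty := by
  have hne : {r | ∃ (d : ℕ) (U : Matrix (Fin m) (Fin d) ℝ) (V : Matrix (Fin n) (Fin d) ℝ),
      U * V.transpose = M ∧ r = rowNorm U * rowNorm V}.Nonempty :=
    ⟨_, n, M, 1, by simp, rfl⟩
  obtain ⟨r, ⟨d, U, V, hUV, rfl⟩, hr⟩ := exists_lt_of_csInf_lt hne h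
  set u := rowNorm U with hu
  set v := rowNorm V with hv
  have hu0 : 0 ≤ u := rowNorm_nonneg U
  have hv0 : 0 ≤ v := rowNorm_nonneg V
  -- The slack `τ > 0` keeps the balancing factor `c` finite and positive even if a row norm
  -- vanishes; its size ensures `u v + τ (u + v) ≤ b`.
  set τ := (b - u * v) / (u + v + 1) with hτ
  have hτ0 : 0 < τ := div_pos (by linarith) (by linarith)
  have hτ1 : τ * (u + v + 1) = b - u * v := div_mul_cancel₀ _ (by positivity)
  set c := (v + τ) / (u + τ) with hc
  have hc0 : 0 < c := by positivity
  let B : Matrix (Fin m ⊕ Fin n) (Fin d) ℝ := fromRows (√c • U) ((√c)⁻¹ • V)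
  have hsc : 0 < √c := Real.sqrt_pos.2 hc0
  refine ⟨B * Bᴴ, posSemidef_self_mul_conjTranspose B, ?_, ?_⟩
  · rintro (i | j)
    · have h1 : (B * Bᴴ) (Sum.inl i) (Sum.inl i) = c * ∑ k, U i k ^ 2 := by
        rw [Matrix.mul_apply, Finset.mul_sum]
        refine Finset.sum_congr rfl fun k _ => ?_
        simp only [B, conjTranspose_apply, fromRows_apply_inl, Matrix.smul_apply, smul_eq_mul,
          star_trivial]
        nlinarith [Real.sq_sqrt hc0.le]
      rw [h1]
      have h2 : c * ∑ k, U i k ^ 2 ≤ c * u ^ 2 := by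
        gcongr; exact sum_sq_le_rowNorm_sq U i
      have h3 : c * u ^ 2 ≤ u * (v + τ) := by
        rw [hc, div_mul_eq_mul_div, div_le_iff₀ (by positivity)]
        nlinarith [mul_nonneg hu0 (mul_nonneg hτ0.le (add_nonneg hv0 hτ0.le))]
      nlinarith [mul_nonneg hτ0.le hv0]
    · have h1 : (B * Bᴴ) (Sum.inr j) (Sum.inr j) = c⁻¹ * ∑ k, V j k ^ 2 := by
        rw [Matrix.mul_apply, Finset.mul_sum]
        refine Finset.sum_congr rfl fun k _ => ?_
        simp only [B, conjTranspose_apply, fromRows_apply_inr, Matrix.smul_apply, smul_eq_mul,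
          star_trivial]
        have : (√c)⁻¹ * (√c)⁻¹ = c⁻¹ := by rw [← mul_inv, Real.mul_self_sqrt hc0.le]
        rw [← this]
        ring
      rw [h1]
      have h2 : c⁻¹ * ∑ k, V j k ^ 2 ≤ c⁻¹ * v ^ 2 := by
        gcongr; exact sum_sq_le_rowNorm_sq V j
      have h3 : c⁻¹ * v ^ 2 ≤ v * (u + τ) := by
        rw [hc, inv_div, div_mul_eq_mul_div, div_le_iff₀ (by positivity)]
        nlinarith [mul_nonneg hv0 (mul_nonneg hτ0.le (add_nonneg hu0 hτ0.le))]
      nlinarith [mul_nonneg hτ0.le hu0]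
  · ext i j
    rw [← hUV]
    simp only [toBlocks₁₂, of_apply, Matrix.mul_apply]
    refine Finset.sum_congr rfl fun k _ => ?_
    simp only [B, conjTranspose_apply, fromRows_apply_inl, fromRows_apply_inr, Matrix.smul_apply,
      smul_eq_mul, star_trivial, transpose_apply]
    field_simp

/-- The infimum defining the max-norm is handled by compactness: the nested compact sets with
diagonal bound `K + 1/(k+1)` have a common point. -/
theorem gramSet_nonempty {M : Matrix (Fin m) (Fin n) ℝ} (h : maxNorm M ≤ K) :
    (gramSet M K).Nonempty := by
  have hpos : ∀ k : ℕ, (0 : ℝ) < 1 / (k + 1) := fun k => Nat.one_div_pos_of_nat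
  have key : (⋂ k : ℕ, gramSet M (K + 1 / (k + 1))).Nonempty := by
    refine IsCompact.nonempty_iInter_of_sequence_nonempty_isCompact_isClosed _ ?_ ?_ ?_ ?_
    · intro k Q hQ
      refine ⟨hQ.1, fun a => (hQ.2.1 a).trans ?_, hQ.2.2⟩
      gcongr
      simp
    · exact fun k => gramSet_nonempty_of_maxNorm_lt (by linarith [hpos k])
    · exact isCompact_of_posSemidef (isClosed_gramSet M _) fun X hX => ⟨hX.1, hX.2.1⟩
    · exact fun k => isClosed_gramSet M _
  obtain ⟨Q, hQ⟩ := key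
  simp only [Set.mem_iInter] at hQ
  refine ⟨Q, (hQ 0).1, fun a => ?_, (hQ 0).2.2⟩
  have hlim : Tendsto (fun k : ℕ => K + 1 / ((k : ℝ) + 1)) atTop (𝓝 (K + 0)) :=
    tendsto_const_nhds.add tendsto_one_div_add_atTop_nhds_zero_nat
  rw [add_zero] at hlim
  exact ge_of_tendsto' hlim fun k => (hQ k).2.1 a

/-- The lift of a pair of completions given by two Gram matrices. -/
noncomputable def gramLift (Q₁ Q₂ : Matrix (Fin m ⊕ Fin n) (Fin m ⊕ Fin n) ℝ) : LiftMat m n :=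
  let e : BlockIdx m n → (Fin m ⊕ Fin n) ⊕ (Fin m ⊕ Fin n) :=
    Sum.elim (Sum.map Sum.inl Sum.inl) (Sum.map Sum.inr Sum.inr)
  let P : Matrix (BlockIdx m n) (BlockIdx m n) ℝ := (fromBlocks Q₁ 0 0 Q₂).submatrix e e
  let J : Matrix (BlockIdx m n) (BlockIdx m n) ℝ := diagonal (Sum.elim (fun _ => 1) fun _ => -1)
  (1 / 2 : ℝ) • fromBlocks P 0 0 (J * P * Jᴴ)

theorem gramLift_posSemidef {Q₁ Q₂ : Matrix (Fin m ⊕ Fin n) (Fin m ⊕ Fin n) ℝ}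
    (h₁ : Q₁.PosSemidef) (h₂ : Q₂.PosSemidef) : (gramLift Q₁ Q₂).PosSemidef := by
  have hP := (posSemidef_fromBlocks_diagonal h₁ h₂).submatrix
    (Sum.elim (Sum.map Sum.inl Sum.inl) (Sum.map Sum.inr Sum.inr) :
      BlockIdx m n → (Fin m ⊕ Fin n) ⊕ (Fin m ⊕ Fin n))
  exact (posSemidef_fromBlocks_diagonal hP (hP.mul_mul_conjTranspose_same _)).smul (by norm_num)

/-- Conjugating the Gram matrix `P` by the signs `J`, which are `-1` on column indices, keeps it
semidefinite and flips exactly the row-column blocks. Thus `(P - J P J) / 2` has zero row-row and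
column-column blocks and carries the two completions off the diagonal, which meets the entry
constraint. The factor `1/2` leaves a diagonal of at most `K / 2`, so the trace constraint holds as
well. -/
theorem exists_lift (hK : 0 < K) {M₁ M₂ : Matrix (Fin m) (Fin n) ℝ} (h₁ : M₁ ∈ maxClass m n K)
    (h₂ : M₂ ∈ maxClass m n K) : ∃ X ∈ liftSet m n K, fst X = M₁ ∧ snd X = M₂ := by
  obtain ⟨Q₁, hp₁, hd₁, rfl⟩ := gramSet_nonempty h₁.1
  obtain ⟨Q₂, hp₂, hd₂, rfl⟩ := gramSet_nonempty h₂.1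
  have hdiag : ∀ a, gramLift Q₁ Q₂ a a ≤ K / 2 := by
    rintro (((a | a) | (a | a)) | ((a | a) | (a | a)))
    all_goals
      simp only [gramLift, Matrix.smul_apply, fromBlocks_apply₁₁, fromBlocks_apply₂₂,
        submatrix_apply, Sum.elim_inl, Sum.elim_inr, Sum.map_inl, Sum.map_inr, smul_eq_mul,
        diagonal_conjTranspose, diagonal_mul, mul_diagonal, star_trivial]
      first
        | linarith [hd₁ (Sum.inl a)]
        | linarith [hd₁ (Sum.inr a)]
        | linarith [hd₂ (Sum.inl a)]
        | linarith [hd₂ (Sum.inr a)]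
  have hsymm₁ : ∀ a b, Q₁ a b = Q₁ b a := fun a b => by simpa using hp₁.isHermitian.apply b a
  have hsymm₂ : ∀ a b, Q₂ a b = Q₂ b a := fun a b => by simpa using hp₂.isHermitian.apply b a
  have he₁ : ∀ i j, Q₁ (Sum.inl i) (Sum.inr j) ∈ Set.Icc (-1 : ℝ) 1 := h₁.2
  have he₂ : ∀ i j, Q₂ (Sum.inl i) (Sum.inr j) ∈ Set.Icc (-1 : ℝ) 1 := h₂.2
  refine ⟨gramLift Q₁ Q₂, ⟨gramLift_posSemidef hp₁ hp₂, ?_, fun a => (hdiag a).trans (by linarith),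
    ?_⟩, ?_, ?_⟩
  · calc (gramLift Q₁ Q₂).trace ≤ ∑ a : BlockIdx m n ⊕ BlockIdx m n, K / 2 :=
          Finset.sum_le_sum fun a _ => hdiag a
      _ = _ := by simp; ring
  · rintro ((a | a) | (a | a)) ((b | b) | (b | b))
    all_goals
      simp [blockDiff, gramLift, toBlocks₁₁, toBlocks₂₂]
    · constructor <;> linarith [(he₁ a b).1, (he₁ a b).2]
    · constructor <;> linarith [(he₂ a b).1, (he₂ a b).2]
    · rw [hsymm₁]
      constructor <;> linarith [(he₁ b a).1, (he₁ b a).2]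
    · rw [hsymm₂]
      constructor <;> linarith [(he₂ b a).1, (he₂ b a).2]
  · ext i j
    simp [fst, blockDiff, gramLift, toBlocks₁₁, toBlocks₂₂, toBlocks₁₂]
    ring
  · ext i j
    simp [snd, blockDiff, gramLift, toBlocks₁₁, toBlocks₂₂, toBlocks₁₂]
    ring

end Lift

end PMC

/-! ### Matrix multiplicative weights over the lifted set. -/

namespace PMC

open Matrix Filter Topology

section LiftSet

variable {m n : ℕ} {K : ℝ}

theorem blockDiff_add_smul (X Y : LiftMat m n) (a b : ℝ) :
    blockDiff (a • X + b • Y) = a • blockDiff X + b • blockDiff Y := by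
  ext i j
  simp [blockDiff, toBlocks₁₁, toBlocks₂₂]
  ring

theorem convex_liftSet : Convex ℝ (liftSet m n K) := by
  intro X hX Y hY a b ha hb hab
  refine ⟨(hX.1.smul ha).add (hY.1.smul hb), ?_, fun i => ?_, fun i j => ?_⟩
  · rw [trace_add, trace_smul, trace_smul, smul_eq_mul, smul_eq_mul]
    have h1 := mul_le_mul_of_nonneg_left hX.2.1 ha
    have h2 := mul_le_mul_of_nonneg_left hY.2.1 hb
    calc _ ≤ a * (2 * K * ((m : ℝ) + n)) + b * (2 * K * ((m : ℝ) + n)) := add_le_add h1 h2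
      _ = (a + b) * (2 * K * ((m : ℝ) + n)) := by ring
      _ = _ := by rw [hab, one_mul]
  · have h1 := mul_le_mul_of_nonneg_left (hX.2.2.1 i) ha
    have h2 := mul_le_mul_of_nonneg_left (hY.2.2.1 i) hb
    calc _ ≤ a * K + b * K := add_le_add h1 h2
      _ = (a + b) * K := by ring
      _ = _ := by rw [hab, one_mul]
  · rw [blockDiff_add_smul]
    exact convex_Icc (-1 : ℝ) 1 (hX.2.2.2 i j) (hY.2.2.2 i j) ha hb hab

theorem isClosed_liftSet : IsClosed (liftSet m n K) := by
  have h1 : IsClosed {X : LiftMat m n | X.trace ≤ 2 * K * ((m : ℝ) + n)} :=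
    isClosed_le continuous_id.matrix_trace continuous_const
  have h2 : IsClosed (⋂ a, {X : LiftMat m n | X a a ≤ K}) :=
    isClosed_iInter fun a => isClosed_le (continuous_id.matrix_elem a a) continuous_const
  have h3 : IsClosed (⋂ a, ⋂ b, {X : LiftMat m n | blockDiff X a b ∈ Set.Icc (-1 : ℝ) 1}) :=
    isClosed_iInter fun a => isClosed_iInter fun b => by
      have hc : Continuous fun X : LiftMat m n => blockDiff X a b :=
        (continuous_id.matrix_elem (Sum.inl a) (Sum.inl b)).sub
          (continuous_id.matrix_elem (Sum.inr a) (Sum.inr b))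
      exact isClosed_Icc.preimage hc
  convert isClosed_posSemidef.inter (h1.inter (h2.inter h3)) using 1
  ext X
  simp [liftSet]

theorem isCompact_liftSet : IsCompact (liftSet m n K) :=
  isCompact_of_posSemidef isClosed_liftSet fun _ hX => ⟨hX.1, hX.2.2.1⟩

theorem half_smul_one_mem_liftSet (hK : 0 < K) : (K / 2) • (1 : LiftMat m n) ∈ liftSet m n K := by
  refine ⟨PosSemidef.one.smul (by positivity), ?_, fun a => ?_, fun a b => ?_⟩
  · rw [trace_smul, trace_one, smul_eq_mul]
    simp
    linarith
  · simp; linarith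
  · rw [show blockDiff ((K / 2) • (1 : LiftMat m n)) = 0 by
      ext a b
      simp [blockDiff, toBlocks₁₁, toBlocks₂₂, Matrix.one_apply]]
    simp

theorem abs_fst_le {X : LiftMat m n} (hX : X ∈ liftSet m n K) (i : Fin m) (j : Fin n) :
    |fst X i j| ≤ 1 := abs_le.2 (hX.2.2.2 (Sum.inl (Sum.inl i)) (Sum.inr (Sum.inl j)))

theorem abs_snd_le {X : LiftMat m n} (hX : X ∈ liftSet m n K) (i : Fin m) (j : Fin n) :
    |snd X i j| ≤ 1 := abs_le.2 (hX.2.2.2 (Sum.inl (Sum.inr i)) (Sum.inr (Sum.inr j)))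

/-- The symmetric lift of a pair of linear functionals on the two completions. -/
def liftFunctional (D₁ D₂ : Matrix (Fin m) (Fin n) ℝ) : LiftMat m n :=
  let D : Matrix (Fin m ⊕ Fin m) (Fin n ⊕ Fin n) ℝ := fromBlocks D₁ 0 0 D₂
  let S : Matrix (BlockIdx m n) (BlockIdx m n) ℝ := fromBlocks 0 D Dᵀ 0
  fromBlocks S 0 0 (-S)

/-- Entrywise pairing of two matrices. -/
def pair (A B : Matrix (Fin m) (Fin n) ℝ) : ℝ := ∑ i, ∑ j, A i j * B i j

theorem liftFunctional_transpose (D₁ D₂ : Matrix (Fin m) (Fin n) ℝ) :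
    (liftFunctional D₁ D₂)ᵀ = liftFunctional D₁ D₂ := by
  simp [liftFunctional, fromBlocks_transpose]

theorem sum_abs_liftFunctional (D₁ D₂ : Matrix (Fin m) (Fin n) ℝ) :
    ∑ a, ∑ b, |liftFunctional D₁ D₂ a b| = 4 * (l1Norm D₁ + l1Norm D₂) := by
  have h : ∀ D : Matrix (Fin m) (Fin n) ℝ, ∑ j, ∑ i, |D i j| = l1Norm D := fun D =>
    Finset.sum_comm
  simp only [liftFunctional, Fintype.sum_sum_type, fromBlocks_apply₁₁, fromBlocks_apply₁₂,
    fromBlocks_apply₂₁, fromBlocks_apply₂₂, Matrix.zero_apply, Matrix.neg_apply, abs_zero, abs_neg,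
    Finset.sum_const_zero, transpose_apply, add_zero, zero_add, h]
  simp only [l1Norm]
  ring

/-- The factor `2` arises because each block of the functional occurs together with its transpose.
-/
theorem trace_mul_liftFunctional {X : LiftMat m n} (hX : X.IsHermitian)
    (D₁ D₂ : Matrix (Fin m) (Fin n) ℝ) :
    (X * liftFunctional D₁ D₂).trace = 2 * (pair D₁ (fst X) + pair D₂ (snd X)) := by
  have hs : ∀ a b, X a b = X b a := fun a b => by simpa using hX.apply b a
  have h : (X * liftFunctional D₁ D₂).trace = ∑ a, ∑ b, X a b * liftFunctional D₁ D₂ a b := by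
    simp only [trace, diag_apply, Matrix.mul_apply]
    refine Finset.sum_congr rfl fun a _ => Finset.sum_congr rfl fun b _ => ?_
    rw [show liftFunctional D₁ D₂ b a = liftFunctional D₁ D₂ a b from
      congrFun (congrFun (liftFunctional_transpose D₁ D₂) a) b]
  rw [h]
  simp only [liftFunctional, Fintype.sum_sum_type, fromBlocks_apply₁₁, fromBlocks_apply₁₂,
    fromBlocks_apply₂₁, fromBlocks_apply₂₂, Matrix.zero_apply, Matrix.neg_apply, mul_zero,
    Finset.sum_const_zero, transpose_apply, add_zero, zero_add, neg_zero, pair, fst, snd, blockDiff,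
    toBlocks₁₁, toBlocks₂₂, toBlocks₁₂, of_apply, Matrix.sub_apply]
  have hc : ∀ (Y : LiftMat m n) (D : Matrix (Fin m) (Fin n) ℝ)
        (e : Fin m → BlockIdx m n ⊕ BlockIdx m n)
      (f : Fin n → BlockIdx m n ⊕ BlockIdx m n), (∀ a b, Y a b = Y b a) →
      ∑ j, ∑ i, Y (f j) (e i) * D i j = ∑ i, ∑ j, Y (e i) (f j) * D i j := by
    intro Y D e f hY
    rw [Finset.sum_comm]
    refine Finset.sum_congr rfl fun a _ => Finset.sum_congr rfl fun b _ => ?_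
    rw [hY]
  simp only [mul_neg, Finset.sum_neg_distrib]
  rw [hc X D₁ (fun i => Sum.inl (Sum.inl (Sum.inl i))) (fun i => Sum.inl (Sum.inr (Sum.inl i))) hs,
    hc X D₂ (fun i => Sum.inl (Sum.inl (Sum.inr i))) (fun i => Sum.inl (Sum.inr (Sum.inr i))) hs,
    hc X D₁ (fun i => Sum.inr (Sum.inl (Sum.inl i))) (fun i => Sum.inr (Sum.inr (Sum.inl i))) hs,
    hc X D₂ (fun i => Sum.inr (Sum.inl (Sum.inr i))) (fun i => Sum.inr (Sum.inr (Sum.inr i))) hs]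
  simp only [mul_comm (D₁ _ _), mul_comm (D₂ _ _), sub_mul, Finset.sum_sub_distrib]
  ring

/-- One step of matrix multiplicative weights over the lifted set. -/
noncomputable def mwUpdate (K η : ℝ) (L X : LiftMat m n) : LiftMat m n :=
  argminOn (liftSet m n K) fun X' => relEntropy X' (NormedSpace.exp (matLog X + η • L))

/-- One step of regret: the Pythagorean inequality gives the gain measured at the new iterate, and
strong convexity pays for replacing it by the old one. It is used for the completion player and
again for the random signs in the uniform deviation bound. -/
theorem mwUpdate_spec (hK : 0 < K) {η : ℝ} {L X : LiftMat m n} (hL : Lᵀ = L)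
    (hX : X ∈ liftSet m n K) (hXpd : X.PosDef) {ℓ : ℝ} (hℓ : ∑ a, ∑ b, |L a b| ≤ ℓ) :
    mwUpdate K η L X ∈ liftSet m n K ∧ (mwUpdate K η L X).PosDef ∧
      ∀ Z ∈ liftSet m n K, η * ((Z - X) * L).trace ≤
        relEntropy Z X - relEntropy Z (mwUpdate K η L X) + η ^ 2 * K * ℓ ^ 2 := by
  set Y := NormedSpace.exp (matLog X + η • L) with hY
  have hmin : mwUpdate K η L X ∈ liftSet m n K ∧
      IsMinOn (fun X' => relEntropy X' Y) (liftSet m n K) (mwUpdate K η L X) :=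
    argminOn_spec (isCompact_liftSet.exists_isMinOn ⟨X, hX⟩
      (continuousOn_relEntropy_left Y fun X hX => ⟨hX.1, hX.2.1⟩))
  set X' := mwUpdate K η L X
  obtain ⟨hpd, hpyth⟩ := relEntropy_argmin convex_liftSet (fun X hX => hX.1) (half_pos hK)
    (half_smul_one_mem_liftSet hK) hmin.1 hmin.2
  refine ⟨hmin.1, hpd, fun Z hZ => ?_⟩
  have hLH : L.IsHermitian := by simpa [IsHermitian] using hL
  have hlog : matLog Y = matLog X + η • L :=
    matLog_exp ((matLog_isHermitian X).add (hLH.smul (IsSelfAdjoint.all η)))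
  have h1 := hpyth Z hZ
  -- Three-point identity: by `matLog_exp`, the logarithms of `Y` and `X` differ by exactly `η • L`.
  have h2 : relEntropy Z Y - relEntropy X' Y =
      relEntropy Z X - relEntropy X' X - η * ((Z - X') * L).trace := by
    simp only [relEntropy_eq_trace, hlog, Matrix.mul_add, Matrix.mul_smul, trace_add, trace_smul,
      smul_eq_mul, Matrix.sub_mul, trace_sub]
    ring
  have hentry : ∀ W ∈ liftSet m n K, (W * (L * L)).trace ≤ K * ℓ ^ 2 := by
    intro W hW
    refine (trace_mul_mul_self_le (abs_apply_le_of_posSemidef hW.1 hW.2.2.1)).trans ?_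
    have : 0 ≤ ∑ a, ∑ b, |L a b| :=
      Finset.sum_nonneg fun _ _ => Finset.sum_nonneg fun _ _ => abs_nonneg _
    gcongr
  have h3 := sq_trace_sub_mul_le hmin.1.1 hXpd hL
  have hD := relEntropy_nonneg hmin.1.1 hXpd
  set D := relEntropy X' X
  set t := ((X' - X) * L).trace
  have h4 : t ^ 2 ≤ 4 * D * (K * ℓ ^ 2) := by
    have h5 := add_le_add (hentry X' hmin.1) (hentry X hX)
    nlinarith
  -- Arithmetic-geometric means: `η² t²` is at most `4 D` times `η² K ℓ²`. The `D` on the right is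
  -- absorbed by the term `-D` of the three-point identity.
  have h6 : η * t ≤ D + η ^ 2 * K * ℓ ^ 2 := by
    have hq : 0 ≤ η ^ 2 * K * ℓ ^ 2 := by positivity
    refine (le_abs_self _).trans (abs_le_of_sq_le_sq ?_ (by positivity))
    have h7 := mul_le_mul_of_nonneg_left h4 (sq_nonneg η)
    nlinarith [sq_nonneg (D - η ^ 2 * K * ℓ ^ 2)]
  have h8 : ((Z - X) * L).trace = ((Z - X') * L).trace + t := by
    simp only [t, Matrix.sub_mul, trace_sub]
    ring
  rw [h8, mul_add]
  linarith

theorem matLog_smul_one {ι : Type*} [Fintype ι] [DecidableEq ι] (c : ℝ) :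
    matLog (c • (1 : Matrix ι ι ℝ)) = Real.log c • 1 := by
  rw [matLog, ← Algebra.algebraMap_eq_smul_one, ← Algebra.algebraMap_eq_smul_one]
  exact cfc_algebraMap c Real.log

/-- All eigenvalues are at most the trace bound `2K(m + n)`, whose ratio to the initial eigenvalue
`K / 2` is `4(m + n)`; this produces the logarithm. -/
theorem relEntropy_init_le (hK : 0 < K) (hm : 1 ≤ m) (hn : 1 ≤ n) {Z : LiftMat m n}
    (hZ : Z ∈ liftSet m n K) : relEntropy Z ((K / 2) • (1 : LiftMat m n)) ≤
      4 * K * ((m : ℝ) + n) * Real.log (4 * ((m : ℝ) + n)) := by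
  have hm' : (1 : ℝ) ≤ m := by exact_mod_cast hm
  have hn' : (1 : ℝ) ≤ n := by exact_mod_cast hn
  set N : ℝ := (m : ℝ) + n with hN
  have hH := hZ.1.isHermitian
  obtain ⟨U, hU, hU', hf, hZU⟩ := exists_spectral hH
  have htr : ∀ d : (BlockIdx m n ⊕ BlockIdx m n) → ℝ, (U * diagonal d * Uᵀ).trace = ∑ i, d i := by
    intro d
    rw [trace_mul_comm, ← Matrix.mul_assoc, hU, Matrix.one_mul, trace_diagonal]
  have h1 : (Z * matLog Z).trace ≤ Z.trace * Real.log (2 * K * N) := by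
    rw [mul_matLog_self hH, hf, htr, hH.trace_eq_sum_eigenvalues, Finset.sum_mul]
    refine Finset.sum_le_sum fun i _ => ?_
    have h0 := hZ.1.eigenvalues_nonneg i
    have h2 := (eigenvalues_le_trace hZ.1 i).trans hZ.2.1
    rcases h0.eq_or_lt with h0 | h0
    · simp [← h0]
    · exact mul_le_mul_of_nonneg_left (Real.log_le_log h0 h2) h0.le
  have h2 : (Z * matLog ((K / 2) • (1 : LiftMat m n))).trace = Z.trace * Real.log (K / 2) := by
    rw [matLog_smul_one, Matrix.mul_smul, Matrix.mul_one, trace_smul, smul_eq_mul, mul_comm]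
  have h3 : ((K / 2) • (1 : LiftMat m n)).trace = 2 * K * N := by
    rw [trace_smul, trace_one, smul_eq_mul]
    simp
    ring
  have h4 : Real.log (2 * K * N) = Real.log (K / 2) + Real.log (4 * N) := by
    rw [← Real.log_mul (by positivity) (by positivity)]
    congr 1
    ring
  have h5 : 1 ≤ Real.log (4 * N) := by
    rw [Real.le_log_iff_exp_le (by positivity)]
    have := Real.exp_one_lt_d9
    linarith
  have h6 : Z.trace * Real.log (4 * N) ≤ 2 * K * N * Real.log (4 * N) :=
    mul_le_mul_of_nonneg_right hZ.2.1 (by linarith)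
  have h7 := hZ.1.trace_nonneg
  have h8 : 2 * K * N * 1 ≤ 2 * K * N * Real.log (4 * N) := by gcongr
  rw [relEntropy_eq_trace, h2, h3]
  rw [h4, mul_add] at h1
  linarith

end LiftSet

end PMC

/-! ### The coverage player: mirror descent on the simplex and on the cube. -/

namespace PMC

open Matrix Filter Topology

section Coverage

variable {m n T : ℕ}

theorem pair_add_left (A B C : Matrix (Fin m) (Fin n) ℝ) :
    pair (A + B) C = pair A C + pair B C := by
  simp only [pair, Matrix.add_apply, add_mul, Finset.sum_add_distrib]

theorem pair_add_right (A B C : Matrix (Fin m) (Fin n) ℝ) :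
    pair A (B + C) = pair A B + pair A C := by
  simp only [pair, Matrix.add_apply, mul_add, Finset.sum_add_distrib]

theorem pair_sub_left (A B C : Matrix (Fin m) (Fin n) ℝ) :
    pair (A - B) C = pair A C - pair B C := by
  simp only [pair, Matrix.sub_apply, sub_mul, Finset.sum_sub_distrib]

theorem pair_sub_right (A B C : Matrix (Fin m) (Fin n) ℝ) :
    pair A (B - C) = pair A B - pair A C := by
  simp only [pair, Matrix.sub_apply, mul_sub, Finset.sum_sub_distrib]

theorem pair_smul_left (c : ℝ) (A B : Matrix (Fin m) (Fin n) ℝ) :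
    pair (c • A) B = c * pair A B := by
  simp only [pair, Matrix.smul_apply, smul_eq_mul, mul_assoc, Finset.mul_sum]

theorem pair_smul_right (c : ℝ) (A B : Matrix (Fin m) (Fin n) ℝ) :
    pair A (c • B) = c * pair A B := by
  simp only [pair, Matrix.smul_apply, smul_eq_mul, Finset.mul_sum]
  refine Finset.sum_congr rfl fun i _ => Finset.sum_congr rfl fun j _ => by ring

theorem pair_neg_left (A B : Matrix (Fin m) (Fin n) ℝ) : pair (-A) B = -pair A B := by
  simp only [pair, Matrix.neg_apply, neg_mul, Finset.sum_neg_distrib]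

theorem disagreement_eq_pair (C M₁ M₂ : Matrix (Fin m) (Fin n) ℝ) :
    disagreement C M₁ M₂ = pair C (M₁ - M₂) := rfl

theorem bregman_eq (s : Setting) (P Q : Matrix (Fin m) (Fin n) ℝ) :
    bregman s P Q = regularizer s P - regularizer s Q - pair (regularizerGrad s Q) (P - Q) := rfl

theorem bregman_simplex_eq (P Q : Matrix (Fin m) (Fin n) ℝ) :
    bregman .simplex P Q = ∑ i, ∑ j, scalarRelEntropy (P i j) (Q i j) := by
  simp only [bregman, regularizer, regularizerGrad, entropy, Real.negMulLog, of_apply,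
    scalarRelEntropy, ← Finset.sum_neg_distrib, ← Finset.sum_sub_distrib]
  refine Finset.sum_congr rfl fun i _ => Finset.sum_congr rfl fun j _ => by ring

theorem bregman_cube_eq (P Q : Matrix (Fin m) (Fin n) ℝ) :
    bregman .cube P Q = 1 / 2 * ∑ i, ∑ j, (P i j - Q i j) ^ 2 := by
  simp only [bregman, regularizer, regularizerGrad, Finset.mul_sum, ← Finset.sum_sub_distrib]
  refine Finset.sum_congr rfl fun i _ => Finset.sum_congr rfl fun j _ => by ring

theorem pos_of_mem_projectionSet {C : Matrix (Fin m) (Fin n) ℝ}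
    (hC : C ∈ projectionSet m n T .simplex) (i : Fin m) (j : Fin n) : 0 < C i j :=
  (Real.exp_pos _).trans_le (hC.2 i j)

theorem projectionSet_subset (s : Setting) :
    projectionSet m n T s ⊆ confidenceSet m n s := by
  cases s with
  | simplex => exact fun C hC => hC.1
  | cube => exact subset_rfl

theorem bregman_nonneg {s : Setting} {P Q : Matrix (Fin m) (Fin n) ℝ}
    (hP : P ∈ confidenceSet m n s) (hQ : Q ∈ projectionSet m n T s) : 0 ≤ bregman s P Q := by
  cases s with
  | simplex =>
    rw [bregman_simplex_eq]
    exact Finset.sum_nonneg fun i _ => Finset.sum_nonneg fun j _ =>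
      scalarRelEntropy_nonneg (hP.1 i j) (pos_of_mem_projectionSet hQ i j)
  | cube =>
    rw [bregman_cube_eq]
    positivity

theorem convex_confidenceSet (s : Setting) : Convex ℝ (confidenceSet m n s) := by
  intro A hA B hB a b ha hb hab
  cases s with
  | simplex =>
    refine ⟨fun i j => ?_, ?_⟩
    · have h1 := hA.1 i j
      have h2 := hB.1 i j
      simp only [Matrix.add_apply, Matrix.smul_apply, smul_eq_mul]
      positivity
    · simp only [Matrix.add_apply, Matrix.smul_apply, smul_eq_mul, Finset.sum_add_distrib,
        ← Finset.mul_sum, hA.2, hB.2, mul_one, hab]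
  | cube => exact fun i j => convex_Icc _ _ (hA i j) (hB i j) ha hb hab

theorem convex_projectionSet (s : Setting) : Convex ℝ (projectionSet m n T s) := by
  cases s with
  | simplex =>
    intro A hA B hB a b ha hb hab
    exact ⟨convex_confidenceSet .simplex hA.1 hB.1 ha hb hab, fun i j =>
      convex_Ici (Real.exp (1 - truncation m n T)) (hA.2 i j) (hB.2 i j) ha hb hab⟩
  | cube => exact convex_confidenceSet .cube

theorem mem_Icc_of_mem_simplex {C : Matrix (Fin m) (Fin n) ℝ}
    (hC : C ∈ confidenceSet m n .simplex) (i : Fin m) (j : Fin n) : C i j ∈ Set.Icc (0 : ℝ) 1 := by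
  refine ⟨hC.1 i j, ?_⟩
  rw [← hC.2]
  exact (Finset.single_le_sum (f := fun j => C i j) (fun j _ => hC.1 i j) (Finset.mem_univ j)).trans
    (Finset.single_le_sum (f := fun i => ∑ j, C i j)
      (fun i _ => Finset.sum_nonneg fun j _ => hC.1 i j) (Finset.mem_univ i))

theorem isCompact_projectionSet (s : Setting) : IsCompact (projectionSet m n T s) := by
  cases s with
  | simplex =>
    refine IsCompact.of_isClosed_subset
      (isCompact_univ_pi fun _ => isCompact_univ_pi fun _ => isCompact_Icc (a := (0 : ℝ)) (b := 1))
      ?_ fun C hC i _ j _ => mem_Icc_of_mem_simplex hC.1 i j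
    have h1 : ∀ c : ℝ, IsClosed (⋂ i, ⋂ j, {C : Matrix (Fin m) (Fin n) ℝ | c ≤ C i j}) := fun c =>
      isClosed_iInter fun i => isClosed_iInter fun j =>
        isClosed_le continuous_const (continuous_id.matrix_elem i j)
    have h2 : IsClosed {C : Matrix (Fin m) (Fin n) ℝ | ∑ i, ∑ j, C i j = 1} :=
      isClosed_eq (continuous_finsetSum _ fun i _ => continuous_finsetSum _ fun j _ =>
        continuous_id.matrix_elem i j) continuous_const
    convert ((h1 0).inter h2).inter (h1 (Real.exp (1 - truncation m n T))) using 1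
    ext C
    simp [projectionSet, confidenceSet]
  | cube =>
    have h := isCompact_univ_pi (X := fun _ : Fin m => Fin n → ℝ) fun _ : Fin m =>
      isCompact_univ_pi fun _ : Fin n => isCompact_Icc (a := (0 : ℝ)) (b := cubeSide m n)
    have e : (projectionSet m n T .cube : Set (Matrix (Fin m) (Fin n) ℝ)) =
        Set.pi Set.univ fun _ => Set.pi Set.univ fun _ => Set.Icc 0 (cubeSide m n) := by
      ext C
      exact ⟨fun h i _ j _ => h i j, fun h i j => h i trivial j trivial⟩
    rw [e]
    exact h

theorem continuous_regularizer (s : Setting) :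
    Continuous (regularizer s : Matrix (Fin m) (Fin n) ℝ → ℝ) := by
  cases s with
  | simplex =>
    exact (continuous_finsetSum _ fun i _ => continuous_finsetSum _ fun j _ =>
      Real.continuous_negMulLog.comp (continuous_id.matrix_elem i j)).neg
  | cube =>
    exact continuous_const.mul (continuous_finsetSum _ fun i _ => continuous_finsetSum _ fun j _ =>
      (continuous_id.matrix_elem i j).pow 2)

theorem continuousOn_regularizerGrad (s : Setting) (i : Fin m) (j : Fin n) :
    ContinuousOn (fun C : Matrix (Fin m) (Fin n) ℝ => regularizerGrad s C i j)
      (projectionSet m n T s) := by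
  cases s with
  | simplex =>
    refine continuousOn_const.add (ContinuousOn.log ?_ fun C hC => ?_)
    · exact (continuous_id.matrix_elem i j).continuousOn
    · exact (pos_of_mem_projectionSet hC i j).ne'
  | cube => exact (continuous_id.matrix_elem i j).continuousOn

theorem continuousOn_bregman (s : Setting) (P : Matrix (Fin m) (Fin n) ℝ) :
    ContinuousOn (fun Q => bregman s P Q) (projectionSet m n T s) := by
  refine ((continuousOn_const.sub (continuous_regularizer s).continuousOn)).sub ?_
  exact continuousOn_finsetSum _ fun i _ => continuousOn_finsetSum _ fun j _ =>
    (continuousOn_regularizerGrad s i j).mul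
      (continuous_const.sub (continuous_id.matrix_elem i j)).continuousOn

/-- As for matrices, but simpler: on the truncated simplex all entries are bounded below, so the
gradient of the regularizer is continuous and no interior argument is needed. -/
theorem bregman_argmin {s : Setting} {Y X : Matrix (Fin m) (Fin n) ℝ}
    (hX : X ∈ projectionSet m n T s)
    (hmin : IsMinOn (fun C => bregman s C Y) (projectionSet m n T s) X)
    {Z : Matrix (Fin m) (Fin n) ℝ} (hZ : Z ∈ projectionSet m n T s) :
    bregman s Z X ≤ bregman s Z Y - bregman s X Y := by
  have hS : Convex ℝ (projectionSet m n T s) := convex_projectionSet s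
  let G : Matrix (Fin m) (Fin n) ℝ → Matrix (Fin m) (Fin n) ℝ →ₗ[ℝ] ℝ := fun W =>
    { toFun := pair (regularizerGrad s W)
      map_add' := pair_add_right _
      map_smul' := fun c B => pair_smul_right c _ B }
  have hGdef : ∀ W V, G W V = pair (regularizerGrad s W) V := fun _ _ => rfl
  have hR : ∀ C, regularizer s C - G Y C =
      bregman s C Y + (regularizer s Y - pair (regularizerGrad s Y) Y) := by
    intro C
    rw [bregman_eq, hGdef, pair_sub_right]
    ring
  have hmin' : IsMinOn (fun C => regularizer s C - G Y C) (projectionSet m n T s) X := by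
    refine isMinOn_iff.2 fun C hC => ?_
    rw [hR, hR]
    have := isMinOn_iff.1 hmin C hC
    linarith
  have hmem : ∀ t : ℝ, 0 ≤ t → t ≤ 1 → X + t • (Z - X) ∈ projectionSet m n T s := fun t h0 h1 =>
    hS.add_smul_sub_mem hX hZ ⟨h0, h1⟩
  have hstep : ∀ t : ℝ, 0 < t → t ≤ 1 →
      bregman s Z (X + t • (Z - X)) ≤ bregman s Z Y - bregman s X Y := by
    intro t h0 h1
    have h := bregman_segment_le hS (regularizer s) G (G Y) hX hZ hmin' h0 h1
      (bregman_nonneg (projectionSet_subset s hX) (hmem t h0.le h1))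
    rw [hR, hR, hGdef, ← bregman_eq] at h
    linarith
  have hlim : Tendsto (fun t : ℝ => bregman s Z (X + t • (Z - X))) (𝓝[Set.Icc 0 1] 0)
      (𝓝 (bregman s Z X)) := by
    have hline : Continuous fun t : ℝ => X + t • (Z - X) := by fun_prop
    have h := ((continuousOn_bregman (T := T) s Z).comp hline.continuousOn
      (s := Set.Icc (0 : ℝ) 1) fun t ht => hmem t ht.1 ht.2) 0 ⟨le_rfl, zero_le_one⟩
    have h2 := h.tendsto
    simp only [Function.comp_def, zero_smul, add_zero] at h2
    exact h2
  have hlim' : Tendsto (fun t : ℝ => bregman s Z (X + t • (Z - X))) (𝓝[>] 0)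
      (𝓝 (bregman s Z X)) := by
    refine hlim.mono_left ?_
    rw [← nhdsWithin_Ioc_eq_nhdsGT (zero_lt_one' ℝ)]
    exact nhdsWithin_mono _ Set.Ioc_subset_Icc_self
  refine le_of_tendsto hlim' ?_
  filter_upwards [Ioo_mem_nhdsGT (zero_lt_one' ℝ)] with t ht
  exact hstep t ht.1 ht.2.le

theorem argminOn_bregman_spec {s : Setting} (hne : (projectionSet m n T s).Nonempty)
    (Y : Matrix (Fin m) (Fin n) ℝ) :
    argminOn (projectionSet m n T s) (fun C => bregman s C Y) ∈ projectionSet m n T s ∧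
      ∀ Z ∈ projectionSet m n T s,
        bregman s Z (argminOn (projectionSet m n T s) fun C => bregman s C Y) ≤
          bregman s Z Y - bregman s (argminOn (projectionSet m n T s) fun C => bregman s C Y) Y := by
  have hc : Continuous fun C : Matrix (Fin m) (Fin n) ℝ => bregman s C Y := by
    refine ((continuous_regularizer s).sub continuous_const).sub ?_
    exact continuous_finsetSum _ fun i _ => continuous_finsetSum _ fun j _ =>
      continuous_const.mul ((continuous_id.matrix_elem i j).sub continuous_const)
  obtain ⟨h1, h2⟩ := argminOn_spec
    ((isCompact_projectionSet s).exists_isMinOn hne hc.continuousOn)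
  exact ⟨h1, fun Z hZ => bregman_argmin h1 h2 hZ⟩

theorem regularizerGrad_regularizerGradInv (s : Setting) (W : Matrix (Fin m) (Fin n) ℝ) :
    regularizerGrad s (regularizerGradInv s W) = W := by
  cases s with
  | simplex =>
    ext i j
    simp [regularizerGrad, regularizerGradInv]
  | cube => rfl

/-- Quadratic term in the regret of the coverage player with gradients bounded by `Γ`. -/
def coverageCurvature (m n : ℕ) (Γ : ℝ) : Setting → ℝ
  | .simplex => Γ ^ 2
  | .cube => (m : ℝ) * n * Γ ^ 2

/-- On the simplex, Cauchy-Schwarz with `sq_sub_div_le_scalarRelEntropy` plays the role of Pinsker's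
inequality. On the cube, squares are completed entry by entry. -/
theorem mul_pair_le_bregman_add {s : Setting} {P Q g : Matrix (Fin m) (Fin n) ℝ}
    (hP : P ∈ projectionSet m n T s) (hQ : Q ∈ projectionSet m n T s) {Γ : ℝ}
    (hg : ∀ i j, |g i j| ≤ Γ) (η : ℝ) :
    η * pair g (P - Q) ≤ bregman s P Q + η ^ 2 * coverageCurvature m n Γ s := by
  have hg2 : ∀ i j, g i j ^ 2 ≤ Γ ^ 2 := fun i j => by
    rw [← sq_abs]
    exact pow_le_pow_left₀ (abs_nonneg _) (hg i j) 2
  cases s with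
  | simplex =>
    have hB := bregman_nonneg (projectionSet_subset _ hP) hQ
    rw [bregman_simplex_eq] at hB ⊢
    have h1 : pair g (P - Q) ^ 2 ≤ (∑ i, ∑ j, scalarRelEntropy (P i j) (Q i j)) *
        ∑ i, ∑ j, 2 * (P i j + Q i j) * g i j ^ 2 := by
      simp only [pair, Matrix.sub_apply, ← Finset.sum_product', Finset.univ_product_univ]
      refine Finset.sum_sq_le_sum_mul_sum_of_sq_le_mul _ (fun x _ => ?_) (fun x _ => ?_)
        (fun x _ => ?_)
      · exact scalarRelEntropy_nonneg (hP.1.1 _ _) (pos_of_mem_projectionSet hQ _ _)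
      · have h1 := hP.1.1 x.1 x.2
        have h2 := hQ.1.1 x.1 x.2
        positivity
      · have h := sq_sub_div_le_scalarRelEntropy (hP.1.1 x.1 x.2)
          (pos_of_mem_projectionSet hQ x.1 x.2)
        nlinarith [mul_le_mul_of_nonneg_right h (sq_nonneg (g x.1 x.2))]
    have h2 : ∑ i, ∑ j, 2 * (P i j + Q i j) * g i j ^ 2 ≤ 4 * Γ ^ 2 := by
      calc ∑ i, ∑ j, 2 * (P i j + Q i j) * g i j ^ 2
          ≤ ∑ i, ∑ j, 2 * (P i j + Q i j) * Γ ^ 2 := by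
            refine Finset.sum_le_sum fun i _ => Finset.sum_le_sum fun j _ => ?_
            have h1 := hP.1.1 i j
            have h2 := hQ.1.1 i j
            have := hg2 i j
            gcongr
        _ = 2 * ((∑ i, ∑ j, P i j) + ∑ i, ∑ j, Q i j) * Γ ^ 2 := by
            simp only [← Finset.sum_mul, ← Finset.mul_sum, Finset.sum_add_distrib]
        _ = 4 * Γ ^ 2 := by rw [hP.1.2, hQ.1.2]; ring
    set D := ∑ i, ∑ j, scalarRelEntropy (P i j) (Q i j)
    have h3 : pair g (P - Q) ^ 2 ≤ D * (4 * Γ ^ 2) :=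
      h1.trans (mul_le_mul_of_nonneg_left h2 hB)
    simp only [coverageCurvature]
    refine (le_abs_self _).trans (abs_le_of_sq_le_sq ?_ (by positivity))
    nlinarith [mul_le_mul_of_nonneg_left h3 (sq_nonneg η), sq_nonneg (D - η ^ 2 * Γ ^ 2)]
  | cube =>
    rw [bregman_cube_eq]
    have h1 : η * pair g (P - Q) ≤ ∑ i, ∑ j, (1 / 2 * (P i j - Q i j) ^ 2 + η ^ 2 * Γ ^ 2) := by
      simp only [pair, Matrix.sub_apply, Finset.mul_sum]
      refine Finset.sum_le_sum fun i _ => Finset.sum_le_sum fun j _ => ?_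
      have := mul_le_mul_of_nonneg_left (hg2 i j) (sq_nonneg η)
      nlinarith [sq_nonneg (P i j - Q i j - η * g i j), sq_nonneg (η * Γ)]
    refine h1.trans (le_of_eq ?_)
    simp only [Finset.sum_add_distrib, ← Finset.mul_sum, coverageCurvature,
      Finset.sum_const, Finset.card_univ, Fintype.card_fin, nsmul_eq_mul]
    ring

theorem coverageUpdate_spec {s : Setting} {α : ℝ} {C M₁ M₂ : Matrix (Fin m) (Fin n) ℝ}
    (hC : C ∈ projectionSet m n T s) {Γ : ℝ} (hg : ∀ i j, |rewardGrad s α C M₁ M₂ i j| ≤ Γ) :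
    coverageUpdate T s α C M₁ M₂ ∈ projectionSet m n T s ∧
      ∀ Z ∈ projectionSet m n T s,
        coverageStep m n T α s * pair (rewardGrad s α C M₁ M₂) (Z - C) ≤
          bregman s Z C - bregman s Z (coverageUpdate T s α C M₁ M₂) +
            coverageStep m n T α s ^ 2 * coverageCurvature m n Γ s := by
  obtain ⟨h1, h2⟩ := argminOn_bregman_spec ⟨C, hC⟩ (regularizerGradInv s
      (regularizerGrad s C + coverageStep m n T α s • rewardGrad s α C M₁ M₂))
  refine ⟨h1, fun Z hZ => ?_⟩
  have h3 := h2 Z hZ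
  change bregman s Z (coverageUpdate T s α C M₁ M₂) ≤ _ -
    bregman s (coverageUpdate T s α C M₁ M₂) _ at h3
  change coverageUpdate T s α C M₁ M₂ ∈ _ at h1
  have h4 := mul_pair_le_bregman_add h1 hC hg (coverageStep m n T α s)
  generalize coverageUpdate T s α C M₁ M₂ = C' at *
  set g := rewardGrad s α C M₁ M₂
  set η := coverageStep m n T α s
  have h5 : bregman s Z (regularizerGradInv s (regularizerGrad s C + η • g)) -
      bregman s C' (regularizerGradInv s (regularizerGrad s C + η • g)) =
      bregman s Z C - bregman s C' C - η * pair g (Z - C') := by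
    simp only [bregman_eq, regularizerGrad_regularizerGradInv, pair_add_left, pair_smul_left,
      pair_sub_right]
    ring
  have h6 : pair g (Z - C) = pair g (Z - C') + pair g (C' - C) := by
    simp only [pair_sub_right]
    ring
  rw [h6, mul_add]
  linarith

theorem entropy_nonneg {C : Matrix (Fin m) (Fin n) ℝ} (hC : C ∈ confidenceSet m n .simplex) :
    0 ≤ entropy C :=
  Finset.sum_nonneg fun i _ => Finset.sum_nonneg fun j _ =>
    Real.negMulLog_nonneg (mem_Icc_of_mem_simplex hC i j).1 (mem_Icc_of_mem_simplex hC i j).2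

/-- The relative entropy with respect to the uniform matrix is nonnegative. -/
theorem entropy_le_log (hm : 1 ≤ m) (hn : 1 ≤ n) {C : Matrix (Fin m) (Fin n) ℝ}
    (hC : C ∈ confidenceSet m n .simplex) : entropy C ≤ Real.log ((m : ℝ) * n) := by
  have hm' : (0 : ℝ) < m := by exact_mod_cast hm
  have hn' : (0 : ℝ) < n := by exact_mod_cast hn
  have h : 0 ≤ ∑ i, ∑ j, scalarRelEntropy (C i j) (((m : ℝ) * n)⁻¹) :=
    Finset.sum_nonneg fun i _ => Finset.sum_nonneg fun j _ =>
      scalarRelEntropy_nonneg (hC.1 i j) (by positivity)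
  have h2 : ∑ i, ∑ j, scalarRelEntropy (C i j) (((m : ℝ) * n)⁻¹) =
      -entropy C + (∑ i, ∑ j, C i j) * Real.log ((m : ℝ) * n) - (∑ i, ∑ j, C i j) + 1 := by
    have : ∑ _i : Fin m, ∑ _j : Fin n, ((m : ℝ) * n)⁻¹ = 1 := by
      simp
      field_simp
    rw [← this, entropy]
    simp only [scalarRelEntropy, Real.log_inv, Real.negMulLog, Finset.sum_mul,
      ← Finset.sum_neg_distrib, ← Finset.sum_add_distrib, ← Finset.sum_sub_distrib]
    refine Finset.sum_congr rfl fun i _ => Finset.sum_congr rfl fun j _ => by ring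
  rw [h2, hC.2] at h
  linarith

theorem exp_one_sub_truncation (hm : 1 ≤ m) (hn : 1 ≤ n) (hT : 1 ≤ T) :
    Real.exp (1 - truncation m n T) = (((m : ℝ) * n * T) ^ 2)⁻¹ := by
  have hm' : (0 : ℝ) < m := by exact_mod_cast hm
  have hn' : (0 : ℝ) < n := by exact_mod_cast hn
  have hT' : (0 : ℝ) < T := by exact_mod_cast hT
  rw [truncation, show 1 - (1 + 2 * Real.log ((m : ℝ) * n * T)) =
    -(Real.log (((m : ℝ) * n * T) ^ 2)) by rw [Real.log_pow]; push_cast; ring,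
    Real.exp_neg, Real.exp_log (by positivity)]

/-- The comparator of the simplex player: mix a confidence matrix with the uniform one. -/
theorem exists_mixture_mem_projectionSet (hm : 1 ≤ m) (hn : 1 ≤ n) (hT : 1 ≤ T)
    {C : Matrix (Fin m) (Fin n) ℝ} (hC : C ∈ confidenceSet m n .simplex) :
    ∃ Z ∈ projectionSet m n T .simplex, entropy C ≤ entropy Z ∧ l1Norm (Z - C) ≤ 2 / T ^ 2 := by
  have hm' : (1 : ℝ) ≤ m := by exact_mod_cast hm
  have hn' : (1 : ℝ) ≤ n := by exact_mod_cast hn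
  have hT' : (1 : ℝ) ≤ T := by exact_mod_cast hT
  have hmn : (1 : ℝ) ≤ (m : ℝ) * n := by nlinarith
  -- With this weight the uniform part alone contributes `(mnT)⁻²` per entry, exactly the truncation
  -- level.
  set ε : ℝ := ((m : ℝ) * n * T ^ 2)⁻¹ with hε
  have hε0 : 0 < ε := by positivity
  have hε1 : ε ≤ 1 := by
    rw [hε]
    exact inv_le_one_of_one_le₀ (one_le_mul_of_one_le_of_one_le hmn (one_le_pow₀ hT'))
  set u : Matrix (Fin m) (Fin n) ℝ := Matrix.of fun _ _ => ((m : ℝ) * n)⁻¹ with hu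
  have hu1 : ∑ i, ∑ j, u i j = 1 := by
    simp [hu]
    field_simp
  have huS : u ∈ confidenceSet m n .simplex := ⟨fun i j => by simp [hu]; positivity, hu1⟩
  have huH : entropy u = Real.log ((m : ℝ) * n) := by
    simp [entropy, hu, Real.negMulLog]
    field_simp
    rw [one_div, Real.log_inv, neg_neg]
  have hconc := Real.concaveOn_negMulLog
  refine ⟨(1 - ε) • C + ε • u, ⟨convex_confidenceSet .simplex hC huS (by linarith) hε0.le (by ring),
    fun i j => ?_⟩, ?_, ?_⟩
  · rw [exp_one_sub_truncation hm hn hT]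
    have h1 := mul_nonneg (sub_nonneg.2 hε1) (hC.1 i j)
    have h2 : (((m : ℝ) * n * T) ^ 2)⁻¹ = ε * u i j := by
      simp only [hε, hu, of_apply]
      rw [← mul_inv]
      congr 1
      ring
    simp only [Matrix.add_apply, Matrix.smul_apply, smul_eq_mul]
    linarith
  -- Mixing costs no coverage: entropy is concave and largest at the uniform matrix.
  · have h1 : (1 - ε) * entropy C + ε * entropy u ≤ entropy ((1 - ε) • C + ε • u) := by
      simp only [entropy, Finset.mul_sum, ← Finset.sum_add_distrib]
      refine Finset.sum_le_sum fun i _ => Finset.sum_le_sum fun j _ => ?_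
      exact hconc.2 (hC.1 i j) (huS.1 i j) (sub_nonneg.2 hε1) hε0.le (by ring)
    have h2 := entropy_le_log hm hn hC
    rw [huH] at h1
    nlinarith
  · have h1 : l1Norm ((1 - ε) • C + ε • u - C) ≤ ∑ i, ∑ j, (ε * u i j + ε * C i j) := by
      refine Finset.sum_le_sum fun i _ => Finset.sum_le_sum fun j _ => ?_
      have e : ((1 - ε) • C + ε • u - C) i j = ε * u i j - ε * C i j := by
        simp only [Matrix.sub_apply, Matrix.add_apply, Matrix.smul_apply, smul_eq_mul]
        ring
      rw [e]
      have h2 := mul_nonneg hε0.le (huS.1 i j)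
      have h3 := mul_nonneg hε0.le (hC.1 i j)
      rw [abs_le]
      constructor <;> linarith
    have h2 : ∑ i, ∑ j, (ε * u i j + ε * C i j) = 2 * ε := by
      simp only [Finset.sum_add_distrib, ← Finset.mul_sum, hu1, hC.2]
      ring
    rw [h2] at h1
    refine h1.trans ?_
    rw [hε, div_eq_mul_inv, mul_inv]
    have : ((m : ℝ) * n)⁻¹ ≤ 1 := inv_le_one_of_one_le₀ hmn
    have h3 : 0 ≤ ((T : ℝ) ^ 2)⁻¹ := by positivity
    nlinarith

theorem nonempty_projectionSet (hm : 1 ≤ m) (hn : 1 ≤ n) (hT : 1 ≤ T) (s : Setting) :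
    (projectionSet m n T s).Nonempty := by
  cases s with
  | simplex =>
    have hm' : (0 : ℝ) < m := by exact_mod_cast hm
    have hn' : (0 : ℝ) < n := by exact_mod_cast hn
    obtain ⟨Z, hZ, -⟩ := exists_mixture_mem_projectionSet hm hn hT
      (C := Matrix.of fun _ _ => ((m : ℝ) * n)⁻¹)
      ⟨fun i j => by simp; positivity, by simp; field_simp⟩
    exact ⟨Z, hZ⟩
  | cube => exact ⟨0, fun i j => ⟨le_rfl, Real.rpow_nonneg (by positivity) _⟩⟩

/-- Bound on the initial Bregman divergence of the coverage player. -/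
noncomputable def coverageDiameter (m n : ℕ) : Setting → ℝ
  | .simplex => Real.log ((m : ℝ) * n)
  | .cube => 1 / 2 * ((m : ℝ) * n * cubeSide m n ^ 2)

theorem coverageInit_spec (hm : 1 ≤ m) (hn : 1 ≤ n) (hT : 1 ≤ T) (s : Setting) :
    coverageInit m n T s ∈ projectionSet m n T s ∧ ∀ Z ∈ projectionSet m n T s,
      bregman s Z (coverageInit m n T s) ≤ coverageDiameter m n s := by
  obtain ⟨h1, h2⟩ := argminOn_bregman_spec (nonempty_projectionSet hm hn hT s)
    (match s with
      | .simplex => Matrix.of fun _ _ => Real.exp (-1)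
      | .cube => 0)
  refine ⟨h1, fun Z hZ => (h2 Z hZ).trans ?_⟩
  cases s with
  | simplex =>
    -- The negative entropy is stationary at `e⁻¹`, so the difference of divergences from that point
    -- is a difference of entropies, at most `log (mn)`.
    have hgrad : regularizerGrad .simplex (Matrix.of fun _ _ => Real.exp (-1) :
        Matrix (Fin m) (Fin n) ℝ) = 0 := by
      ext i j
      simp [regularizerGrad]
    have h0 : ∀ P : Matrix (Fin m) (Fin n) ℝ, pair 0 P = 0 := fun P => by simp [pair]
    rw [bregman_eq, bregman_eq, hgrad, h0, h0]
    have h3 := entropy_nonneg hZ.1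
    have h4 := entropy_le_log hm hn h1.1
    simp only [regularizer, coverageDiameter] at *
    linarith
  | cube =>
    rw [bregman_cube_eq, bregman_cube_eq]
    have h3 : ∑ i, ∑ j, (Z i j - (0 : Matrix (Fin m) (Fin n) ℝ) i j) ^ 2 ≤
        ∑ _i : Fin m, ∑ _j : Fin n, cubeSide m n ^ 2 := by
      refine Finset.sum_le_sum fun i _ => Finset.sum_le_sum fun j _ => ?_
      rw [Matrix.zero_apply, sub_zero]
      exact pow_le_pow_left₀ (hZ i j).1 (hZ i j).2 2
    have h4 : ∑ _i : Fin m, ∑ _j : Fin n, cubeSide m n ^ 2 = (m : ℝ) * n * cubeSide m n ^ 2 := by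
      simp
      ring
    rw [h4] at h3
    simp only [coverageDiameter]
    have h5 : ∀ P : Matrix (Fin m) (Fin n) ℝ,
        0 ≤ 1 / 2 * ∑ i, ∑ j, (P i j - (0 : Matrix (Fin m) (Fin n) ℝ) i j) ^ 2 := fun P => by
      positivity
    have h6 := h5 (argminOn (projectionSet m n T .cube) fun C => bregman .cube C
      (0 : Matrix (Fin m) (Fin n) ℝ))
    linarith

/-- The reward is concave in the confidence matrix. -/
theorem reward_sub_le {s : Setting} {α : ℝ} {Z C M₁ M₂ : Matrix (Fin m) (Fin n) ℝ}
    (hZ : Z ∈ projectionSet m n T s) (hC : C ∈ projectionSet m n T s) :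
    (coverage s Z - α * disagreement Z M₁ M₂) - (coverage s C - α * disagreement C M₁ M₂) ≤
      pair (rewardGrad s α C M₁ M₂) (Z - C) := by
  cases s with
  | simplex =>
    have h := bregman_nonneg (projectionSet_subset _ hZ) hC
    have e : pair (rewardGrad .simplex α C M₁ M₂) (Z - C) =
        -pair (regularizerGrad .simplex C) (Z - C) -
          α * (disagreement Z M₁ M₂ - disagreement C M₁ M₂) := by
      simp only [pair, rewardGrad, regularizerGrad, disagreement, of_apply, Matrix.sub_apply,
        Finset.mul_sum, ← Finset.sum_sub_distrib, ← Finset.sum_neg_distrib]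
      refine Finset.sum_congr rfl fun i _ => Finset.sum_congr rfl fun j _ => by ring
    rw [bregman_eq] at h
    rw [e]
    simp only [regularizer, coverage] at h ⊢
    linarith
  | cube =>
    have h1 : ∀ P ∈ projectionSet m n T .cube, l1Norm P = ∑ i, ∑ j, P i j := fun P hP =>
      Finset.sum_congr rfl fun i _ => Finset.sum_congr rfl fun j _ => abs_of_nonneg (hP i j).1
    simp only [coverage]
    rw [h1 Z hZ, h1 C hC]
    apply le_of_eq
    simp only [pair, rewardGrad, disagreement, of_apply, Matrix.sub_apply,
        Finset.mul_sum, ← Finset.sum_sub_distrib]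
    refine Finset.sum_congr rfl fun i _ => Finset.sum_congr rfl fun j _ => by ring

/-- Bound on the entries of the reward gradient. -/
noncomputable def gradientBound (m n T : ℕ) (α : ℝ) : Setting → ℝ
  | .simplex => truncation m n T + 2 * α
  | .cube => 1 + 2 * α

theorem one_le_truncation (hm : 1 ≤ m) (hn : 1 ≤ n) (hT : 1 ≤ T) : 1 ≤ truncation m n T := by
  have hm' : (1 : ℝ) ≤ m := by exact_mod_cast hm
  have hn' : (1 : ℝ) ≤ n := by exact_mod_cast hn
  have hT' : (1 : ℝ) ≤ T := by exact_mod_cast hT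
  have := Real.log_nonneg (one_le_mul_of_one_le_of_one_le
    (one_le_mul_of_one_le_of_one_le hm' hn') hT')
  rw [truncation]
  linarith

theorem abs_rewardGrad_le (hm : 1 ≤ m) (hn : 1 ≤ n) (hT : 1 ≤ T) {s : Setting} {α : ℝ}
    (hα : 0 ≤ α) {C M₁ M₂ : Matrix (Fin m) (Fin n) ℝ} (hC : C ∈ projectionSet m n T s)
    (h₁ : ∀ i j, |M₁ i j| ≤ 1) (h₂ : ∀ i j, |M₂ i j| ≤ 1) (i : Fin m) (j : Fin n) :
    |rewardGrad s α C M₁ M₂ i j| ≤ gradientBound m n T α s := by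
  have h3 := abs_le.1 (h₁ i j)
  have h4 := abs_le.1 (h₂ i j)
  have h5 : α * (M₁ i j - M₂ i j) ≤ α * 2 := mul_le_mul_of_nonneg_left (by linarith) hα
  have h6 : α * (-2) ≤ α * (M₁ i j - M₂ i j) := mul_le_mul_of_nonneg_left (by linarith) hα
  have h7 := one_le_truncation hm hn hT
  cases s with
  | simplex =>
    have h8 : Real.log (C i j) ≤ 0 :=
      Real.log_nonpos (hC.1.1 i j) (mem_Icc_of_mem_simplex hC.1 i j).2
    have h9 : 1 - truncation m n T ≤ Real.log (C i j) :=
      (Real.le_log_iff_exp_le (pos_of_mem_projectionSet hC i j)).2 (hC.2 i j)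
    simp only [rewardGrad, of_apply, gradientBound]
    rw [abs_le]
    constructor <;> linarith
  | cube =>
    simp only [rewardGrad, of_apply, gradientBound]
    rw [abs_le]
    constructor <;> linarith

end Coverage

end PMC

/-! ### Regret of the two players along a fixed realization. -/

namespace PMC

open Matrix

section Game

variable {m n : ℕ}

/-- Squared deviation of a completion from `Mstar` at one entry. -/
def sqLoss (Mstar M : Matrix (Fin m) (Fin n) ℝ) (x : Fin m × Fin n) : ℝ :=
  (M x.1 x.2 - Mstar x.1 x.2) ^ 2

theorem pair_single (x : Fin m × Fin n) (c : ℝ) (M : Matrix (Fin m) (Fin n) ℝ) :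
    pair (Matrix.single x.1 x.2 c) M = c * M x.1 x.2 := by
  rw [pair, Finset.sum_eq_single x.1, Finset.sum_eq_single x.2]
  · simp
  · intro j _ hj
    simp [Matrix.single_apply_of_col_ne _ _ hj.symm]
  · simp
  · intro i _ hi
    exact Finset.sum_eq_zero fun j _ => by simp [Matrix.single_apply_of_row_ne hi.symm]
  · simp

theorem l1Norm_single (x : Fin m × Fin n) (c : ℝ) :
    l1Norm (Matrix.single x.1 x.2 c) = |c| := by
  rw [l1Norm, Finset.sum_eq_single x.1, Finset.sum_eq_single x.2]
  · simp
  · intro j _ hj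
    simp [Matrix.single_apply_of_col_ne _ _ hj.symm]
  · simp
  · intro i _ hi
    exact Finset.sum_eq_zero fun j _ => by simp [Matrix.single_apply_of_row_ne hi.symm]
  · simp

theorem l1Norm_sub_le (A B : Matrix (Fin m) (Fin n) ℝ) :
    l1Norm (A - B) ≤ l1Norm A + l1Norm B := by
  simp only [l1Norm, ← Finset.sum_add_distrib]
  exact Finset.sum_le_sum fun i _ => Finset.sum_le_sum fun j _ => abs_sub _ _

theorem l1Norm_neg (A : Matrix (Fin m) (Fin n) ℝ) : l1Norm (-A) = l1Norm A := by
  simp [l1Norm]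

theorem abs_pair_le {A B : Matrix (Fin m) (Fin n) ℝ} {b : ℝ} (hB : ∀ i j, |B i j| ≤ b) :
    |pair A B| ≤ l1Norm A * b := by
  rw [pair, l1Norm, Finset.sum_mul]
  refine (Finset.abs_sum_le_sum_abs _ _).trans (Finset.sum_le_sum fun i _ => ?_)
  rw [Finset.sum_mul]
  refine (Finset.abs_sum_le_sum_abs _ _).trans (Finset.sum_le_sum fun j _ => ?_)
  rw [abs_mul]
  exact mul_le_mul_of_nonneg_left (hB i j) (abs_nonneg _)

theorem l1Norm_eq_sum {C : Matrix (Fin m) (Fin n) ℝ} (hC : ∀ i j, 0 ≤ C i j) :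
    l1Norm C = ∑ i, ∑ j, C i j :=
  Finset.sum_congr rfl fun i _ => Finset.sum_congr rfl fun j _ => abs_of_nonneg (hC i j)

theorem cubeSide_nonneg : 0 ≤ cubeSide m n := Real.rpow_nonneg (by positivity) _

/-- The side length satisfies `cubeSide · (m + n)² = √(m + n)`, and `mn ≤ (m + n)² / 4`. This fixes
the scale `√(m + n)` of all bounds on the cube. -/
theorem mul_cubeSide_le (hm : 1 ≤ m) (hn : 1 ≤ n) :
    (m : ℝ) * n * cubeSide m n ≤ √((m : ℝ) + n) / 4 := by
  have hm' : (1 : ℝ) ≤ m := by exact_mod_cast hm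
  have hn' : (1 : ℝ) ≤ n := by exact_mod_cast hn
  have hN : (0 : ℝ) < (m : ℝ) + n := by linarith
  have h1 : cubeSide m n * ((m : ℝ) + n) ^ 2 = √((m : ℝ) + n) := by
    rw [cubeSide, ← Real.rpow_natCast, ← Real.rpow_add hN, Real.sqrt_eq_rpow]
    norm_num
  have h2 : (m : ℝ) * n ≤ ((m : ℝ) + n) ^ 2 / 4 := by nlinarith [sq_nonneg ((m : ℝ) - n)]
  rw [← h1]
  nlinarith [mul_le_mul_of_nonneg_right h2 (cubeSide_nonneg (m := m) (n := n))]

/-- Bound on the entrywise `ℓ₁` norm of admissible confidence matrices. -/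
noncomputable def massBound (m n : ℕ) : Setting → ℝ
  | .simplex => 1
  | .cube => √((m : ℝ) + n)

theorem massBound_pos (hm : 1 ≤ m) (s : Setting) : 0 < massBound m n s := by
  have hm' : (1 : ℝ) ≤ m := by exact_mod_cast hm
  cases s with
  | simplex => exact one_pos
  | cube => exact Real.sqrt_pos.2 (by positivity)

theorem l1Norm_le_sqrt_of_mem_cube (hm : 1 ≤ m) (hn : 1 ≤ n) {C : Matrix (Fin m) (Fin n) ℝ}
    (hC : C ∈ confidenceSet m n .cube) : l1Norm C ≤ √((m : ℝ) + n) / 4 := by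
  refine le_trans ?_ (mul_cubeSide_le hm hn)
  calc l1Norm C ≤ ∑ _i : Fin m, ∑ _j : Fin n, cubeSide m n := by
        rw [l1Norm_eq_sum fun i j => (hC i j).1]
        exact Finset.sum_le_sum fun i _ => Finset.sum_le_sum fun j _ => (hC i j).2
    _ = _ := by simp; ring

theorem l1Norm_le_massBound (hm : 1 ≤ m) (hn : 1 ≤ n) {s : Setting}
    {C : Matrix (Fin m) (Fin n) ℝ} (hC : C ∈ confidenceSet m n s) :
    l1Norm C ≤ massBound m n s := by
  cases s with
  | simplex => rw [l1Norm_eq_sum hC.1, hC.2]; exact le_rfl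
  | cube =>
    have := Real.sqrt_nonneg ((m : ℝ) + n)
    have := l1Norm_le_sqrt_of_mem_cube hm hn hC
    simp only [massBound]
    linarith

theorem descentMatrix_eq (θ : ℝ) (C M₁ M₂ : Matrix (Fin m) (Fin n) ℝ) (x : Fin m × Fin n)
    (o : ℝ) : descentMatrix θ C M₁ M₂ x o =
      liftFunctional (C - Matrix.single x.1 x.2 (2 * θ * (M₁ x.1 x.2 - o)))
        (-C - Matrix.single x.1 x.2 (2 * θ * (M₂ x.1 x.2 - o))) := rfl

theorem sum_abs_descentMatrix_le {θ ρ : ℝ} (hθ : 0 ≤ θ) {C M₁ M₂ : Matrix (Fin m) (Fin n) ℝ}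
    (hC : l1Norm C ≤ ρ) (h₁ : ∀ i j, |M₁ i j| ≤ 1) (h₂ : ∀ i j, |M₂ i j| ≤ 1)
    (x : Fin m × Fin n) {o : ℝ} (ho : |o| ≤ 1) :
    ∑ a, ∑ b, |descentMatrix θ C M₁ M₂ x o a b| ≤ 8 * (ρ + 4 * θ) := by
  have key : ∀ (A M : Matrix (Fin m) (Fin n) ℝ), l1Norm A ≤ ρ → (∀ i j, |M i j| ≤ 1) →
      l1Norm (A - Matrix.single x.1 x.2 (2 * θ * (M x.1 x.2 - o))) ≤ ρ + 4 * θ := by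
    intro A M hA hM
    refine (l1Norm_sub_le _ _).trans ?_
    rw [l1Norm_single, abs_mul, abs_of_nonneg (by positivity : 0 ≤ 2 * θ)]
    have h3 : |M x.1 x.2 - o| ≤ 2 := (abs_sub _ _).trans (by linarith [hM x.1 x.2])
    nlinarith [mul_le_mul_of_nonneg_left h3 hθ]
  rw [descentMatrix_eq, sum_abs_liftFunctional]
  have h3 := key C M₁ hC h₁
  have h4 := key (-C) M₂ (by rwa [l1Norm_neg]) h₂
  linarith

/-- Reward of the completion player in one round. -/
def completionReward (θ : ℝ) (Mstar C : Matrix (Fin m) (Fin n) ℝ) (x : Fin m × Fin n)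
    (M₁ M₂ : Matrix (Fin m) (Fin n) ℝ) : ℝ :=
  disagreement C M₁ M₂ - θ * (sqLoss Mstar M₁ x + sqLoss Mstar M₂ x)

/-- The reward is concave and the descent matrix is its gradient at `X`; the discarded terms are `θ`
times squared differences at the drawn entry. -/
theorem completionReward_sub_le {θ : ℝ} (hθ : 0 ≤ θ) (Mstar C : Matrix (Fin m) (Fin n) ℝ)
    (x : Fin m × Fin n) {X Z : LiftMat m n} (hX : X.IsHermitian) (hZ : Z.IsHermitian) :
    2 * (completionReward θ Mstar C x (fst Z) (snd Z) -
        completionReward θ Mstar C x (fst X) (snd X)) ≤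
      ((Z - X) * descentMatrix θ C (fst X) (snd X) x (Mstar x.1 x.2)).trace := by
  rw [Matrix.sub_mul, trace_sub, descentMatrix_eq, trace_mul_liftFunctional hX,
    trace_mul_liftFunctional hZ]
  simp only [pair_sub_left, pair_neg_left, pair_single, completionReward, disagreement_eq_pair,
    pair_sub_right, sqLoss]
  nlinarith [mul_nonneg hθ (sq_nonneg (fst Z x.1 x.2 - fst X x.1 x.2)),
    mul_nonneg hθ (sq_nonneg (snd Z x.1 x.2 - snd X x.1 x.2))]

variable {K : ℝ} {s : Setting} {q : Params} {Mstar : Matrix (Fin m) (Fin n) ℝ}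
  {x : ℕ → Fin m × Fin n}

theorem abs_le_one_of_mem_maxClass {M : Matrix (Fin m) (Fin n) ℝ} (hM : M ∈ maxClass m n K)
    (i : Fin m) (j : Fin n) : |M i j| ≤ 1 := abs_le.2 (hM.2 i j)

theorem oddState_spec (hm : 1 ≤ m) (hn : 1 ≤ n) (hT : 1 ≤ q.T) (hK : 0 < q.K) (hα : 0 ≤ q.α)
    (t : ℕ) :
    (oddState s q Mstar x t).1 ∈ projectionSet m n q.T s ∧
      (oddState s q Mstar x t).2 ∈ liftSet m n q.K ∧ (oddState s q Mstar x t).2.PosDef := by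
  induction t with
  | zero =>
    exact ⟨(coverageInit_spec hm hn hT s).1, half_smul_one_mem_liftSet hK,
      PosDef.one.smul (half_pos hK)⟩
  | succ t ih =>
    obtain ⟨h1, h2, h3⟩ := ih
    refine ⟨(coverageUpdate_spec h1
      (abs_rewardGrad_le hm hn hT hα h1 (abs_fst_le h2) (abs_snd_le h2))).1, ?_⟩
    have h4 := mwUpdate_spec hK (η := completionStep m n q.T q.θ)
      (by rw [descentMatrix_eq]; exact liftFunctional_transpose _ _ :
        (descentMatrix q.θ (oddState s q Mstar x t).1 (fst (oddState s q Mstar x t).2)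
        (snd (oddState s q Mstar x t).2) (x t) (Mstar (x t).1 (x t).2))ᵀ = _) h2 h3 le_rfl
    exact ⟨h4.1, h4.2.1⟩

theorem coverage_regret_step (hm : 1 ≤ m) (hn : 1 ≤ n) (hT : 1 ≤ q.T) (hK : 0 < q.K)
    (hα : 0 ≤ q.α) {Z : Matrix (Fin m) (Fin n) ℝ} (hZ : Z ∈ projectionSet m n q.T s) :
    coverageStep m n q.T q.α s * ∑ t ∈ Finset.range q.T,
      ((coverage s Z - q.α * disagreement Z (fst (oddState s q Mstar x t).2)
          (snd (oddState s q Mstar x t).2)) -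
        (coverage s (oddState s q Mstar x t).1 - q.α * disagreement (oddState s q Mstar x t).1
          (fst (oddState s q Mstar x t).2) (snd (oddState s q Mstar x t).2))) ≤
      coverageDiameter m n s + q.T * (coverageStep m n q.T q.α s ^ 2 *
        coverageCurvature m n (gradientBound m n q.T q.α s) s) := by
  set η := coverageStep m n q.T q.α s with hη
  set Γ := gradientBound m n q.T q.α s
  have hη0 : 0 ≤ η := by
    have h7 := one_le_truncation hm hn hT
    rw [hη]
    cases s with
    | simplex => exact div_nonneg (Real.sqrt_nonneg _) (by positivity)
    | cube => exact div_nonneg (Real.sqrt_nonneg _) (by positivity)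
  have hstep : ∀ t, η * ((coverage s Z - q.α * disagreement Z (fst (oddState s q Mstar x t).2)
          (snd (oddState s q Mstar x t).2)) -
        (coverage s (oddState s q Mstar x t).1 - q.α * disagreement (oddState s q Mstar x t).1
          (fst (oddState s q Mstar x t).2) (snd (oddState s q Mstar x t).2))) ≤
      bregman s Z (oddState s q Mstar x t).1 - bregman s Z (oddState s q Mstar x (t + 1)).1 +
        η ^ 2 * coverageCurvature m n Γ s := by
    intro t
    obtain ⟨h1, h2, -⟩ := oddState_spec (s := s) (Mstar := Mstar) (x := x) hm hn hT hK hα t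
    have h3 := (coverageUpdate_spec h1
      (abs_rewardGrad_le hm hn hT hα h1 (abs_fst_le h2) (abs_snd_le h2))).2 Z hZ
    exact (mul_le_mul_of_nonneg_left (reward_sub_le hZ h1) hη0).trans h3
  rw [Finset.mul_sum]
  refine (Finset.sum_le_sum fun t _ => hstep t).trans ?_
  rw [Finset.sum_add_distrib, Finset.sum_range_sub']
  have h0 := (coverageInit_spec hm hn hT s).2 Z hZ
  have h1 := bregman_nonneg (projectionSet_subset s hZ)
    (oddState_spec (s := s) (Mstar := Mstar) (x := x) hm hn hT hK hα q.T).1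
  simp only [Finset.sum_const, Finset.card_range, nsmul_eq_mul]
  have h2 : bregman s Z (oddState s q Mstar x 0).1 ≤ coverageDiameter m n s := h0
  linarith

/-- Regret bound of the coverage player over the whole run. -/
noncomputable def coverageRegret (m n T : ℕ) (α : ℝ) : Setting → ℝ
  | .simplex => 2 * (truncation m n T + 2 * α) * √(T * Real.log ((m : ℝ) * n))
  | .cube => (1 + 2 * α) * √((m : ℝ) + n) * √T

/-- The step size makes the initial divergence and the accumulated curvature equal, and one divides
by it. On the simplex this requires `log (mn) > 0`: for a single entry the step is `0`. -/
theorem coverage_regret (hm : 1 ≤ m) (hn : 1 ≤ n) (hmn : s = .simplex → 2 ≤ m * n) (hT : 1 ≤ q.T)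
    (hK : 0 < q.K) (hα : 0 ≤ q.α) {Z : Matrix (Fin m) (Fin n) ℝ}
    (hZ : Z ∈ projectionSet m n q.T s) :
    ∑ t ∈ Finset.range q.T,
      ((coverage s Z - q.α * disagreement Z (fst (oddState s q Mstar x t).2)
          (snd (oddState s q Mstar x t).2)) -
        (coverage s (oddState s q Mstar x t).1 - q.α * disagreement (oddState s q Mstar x t).1
          (fst (oddState s q Mstar x t).2) (snd (oddState s q Mstar x t).2))) ≤
      coverageRegret m n q.T q.α s := by
  have h := coverage_regret_step (Mstar := Mstar) (x := x) hm hn hT hK hα hZ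
  have hm' : (1 : ℝ) ≤ m := by exact_mod_cast hm
  have hn' : (1 : ℝ) ≤ n := by exact_mod_cast hn
  have hT' : (0 : ℝ) < q.T := by exact_mod_cast hT
  have hb := one_le_truncation hm hn hT
  set Rg := ∑ t ∈ Finset.range q.T,
      ((coverage s Z - q.α * disagreement Z (fst (oddState s q Mstar x t).2)
          (snd (oddState s q Mstar x t).2)) -
        (coverage s (oddState s q Mstar x t).1 - q.α * disagreement (oddState s q Mstar x t).1
          (fst (oddState s q Mstar x t).2) (snd (oddState s q Mstar x t).2))) with hS
  have hsT : 0 < √(q.T : ℝ) := Real.sqrt_pos.2 hT'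
  have hsT2 : √(q.T : ℝ) ^ 2 = q.T := Real.sq_sqrt hT'.le
  cases s with
  | simplex =>
    have hlog : 0 < Real.log ((m : ℝ) * n) := Real.log_pos (by exact_mod_cast hmn rfl)
    have hsl : 0 < √(Real.log ((m : ℝ) * n)) := Real.sqrt_pos.2 hlog
    have hsl2 : √(Real.log ((m : ℝ) * n)) ^ 2 = Real.log ((m : ℝ) * n) := Real.sq_sqrt hlog.le
    simp only [coverageStep, coverageDiameter, coverageCurvature, gradientBound] at h
    simp only [coverageRegret]
    rw [Real.sqrt_mul hT'.le]
    set Γ := truncation m n q.T + 2 * q.α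
    have hΓ : 0 < Γ := by positivity
    set u := √(Real.log ((m : ℝ) * n))
    set v := √(q.T : ℝ)
    rw [← hsl2, ← hsT2] at h
    have h2 : u ^ 2 + v ^ 2 * ((u / (Γ * v)) ^ 2 * Γ ^ 2) = 2 * u ^ 2 := by
      field_simp; ring
    rw [h2, div_mul_eq_mul_div, div_le_iff₀ (by positivity)] at h
    have h3 : u * Rg ≤ u * (2 * Γ * (v * u)) := by linarith
    exact le_of_mul_le_mul_left h3 hsl
  | cube =>
    have hside : 0 < cubeSide m n := Real.rpow_pos_of_pos (by positivity) _
    simp only [coverageStep, coverageDiameter, coverageCurvature, gradientBound] at h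
    simp only [coverageRegret]
    set Γ := 1 + 2 * q.α
    have hΓ : 0 < Γ := by positivity
    have hd : 0 < 1 / 2 * ((m : ℝ) * n * cubeSide m n ^ 2) := by positivity
    set u := √(1 / 2 * ((m : ℝ) * n * cubeSide m n ^ 2)) with hu
    have hu2 : u ^ 2 = 1 / 2 * ((m : ℝ) * n * cubeSide m n ^ 2) := Real.sq_sqrt hd.le
    have hu0 : 0 < u := Real.sqrt_pos.2 hd
    set v := √(q.T : ℝ)
    set w := √((m : ℝ) * n)
    have hmn0 : (0 : ℝ) < (m : ℝ) * n := by positivity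
    have hw0 : 0 < w := Real.sqrt_pos.2 hmn0
    have hw2 : w ^ 2 = (m : ℝ) * n := Real.sq_sqrt hmn0.le
    rw [← hu2, ← hsT2, ← hw2] at h
    have h2 : u ^ 2 + v ^ 2 * ((u / (Γ * w * v)) ^ 2 * (w ^ 2 * Γ ^ 2)) = 2 * u ^ 2 := by
      field_simp; ring
    rw [h2, div_mul_eq_mul_div, div_le_iff₀ (by positivity)] at h
    have h3 : u * Rg ≤ u * (2 * u * (Γ * w * v)) := by linarith
    have h4 := le_of_mul_le_mul_left h3 hu0
    -- The square of the left side is half the square of the right side.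
    have h5 : u * w ≤ (m : ℝ) * n * cubeSide m n := by
      refine (le_abs_self _).trans (abs_le_of_sq_le_sq ?_ (by positivity))
      rw [mul_pow, hu2, hw2]
      have : 0 ≤ ((m : ℝ) * n * cubeSide m n) ^ 2 := by positivity
      nlinarith
    have h6 := h5.trans (mul_cubeSide_le hm hn)
    have h7 : u * w * (2 * Γ * v) ≤ √((m : ℝ) + n) / 4 * (2 * Γ * v) := by gcongr
    have h8 : 0 ≤ Γ * √((m : ℝ) + n) * v := by positivity
    linarith

theorem completion_regret (hm : 1 ≤ m) (hn : 1 ≤ n) (hT : 1 ≤ q.T) (hK : 0 < q.K)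
    (hα : 0 ≤ q.α) (hθ : 0 ≤ q.θ) (hρ : massBound m n s ≤ 1 + 4 * q.θ)
    (hMstar : Mstar ∈ maxClass m n q.K)
    {M₁ M₂ : Matrix (Fin m) (Fin n) ℝ} (h₁ : M₁ ∈ maxClass m n q.K) (h₂ : M₂ ∈ maxClass m n q.K) :
    ∑ t ∈ Finset.range q.T,
      (completionReward q.θ Mstar (oddState s q Mstar x t).1 (x t) M₁ M₂ -
        completionReward q.θ Mstar (oddState s q Mstar x t).1 (x t)
          (fst (oddState s q Mstar x t).2) (snd (oddState s q Mstar x t).2)) ≤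
      20 * q.K * (1 + 8 * q.θ) * √(((m : ℝ) + n) * Real.log (4 * ((m : ℝ) + n)) * q.T) := by
  have hm' : (1 : ℝ) ≤ m := by exact_mod_cast hm
  have hn' : (1 : ℝ) ≤ n := by exact_mod_cast hn
  have hT' : (0 : ℝ) < q.T := by exact_mod_cast hT
  obtain ⟨Z, hZ, rfl, rfl⟩ := exists_lift hK h₁ h₂
  set N : ℝ := (m : ℝ) + n with hN
  have hlog : 0 < Real.log (4 * N) := Real.log_pos (by linarith)
  set η := completionStep m n q.T q.θ with hη
  have hη0 : 0 ≤ η := by rw [hη, completionStep]; positivity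
  set ℓ := 8 * (1 + 8 * q.θ) with hℓ
  have hstep : ∀ t, η * (2 * (completionReward q.θ Mstar (oddState s q Mstar x t).1 (x t)
        (fst Z) (snd Z) - completionReward q.θ Mstar (oddState s q Mstar x t).1 (x t)
          (fst (oddState s q Mstar x t).2) (snd (oddState s q Mstar x t).2))) ≤
      relEntropy Z (oddState s q Mstar x t).2 - relEntropy Z (oddState s q Mstar x (t + 1)).2 +
        η ^ 2 * q.K * ℓ ^ 2 := by
    intro t
    obtain ⟨g1, g2, g3⟩ := oddState_spec (s := s) (Mstar := Mstar) (x := x) hm hn hT hK hα t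
    have g4 := completionReward_sub_le hθ Mstar (oddState s q Mstar x t).1 (x t)
      g2.1.isHermitian hZ.1.isHermitian
    have g5 := sum_abs_descentMatrix_le hθ
      (l1Norm_le_massBound hm hn (projectionSet_subset s g1)) (abs_fst_le g2) (abs_snd_le g2)
      (x t) (abs_le_one_of_mem_maxClass hMstar (x t).1 (x t).2)
    have g6 := (mwUpdate_spec hK (η := η) (liftFunctional_transpose _ _) g2 g3
      (g5.trans (by rw [hℓ]; linarith : _ ≤ ℓ))).2.2 Z hZ
    exact (mul_le_mul_of_nonneg_left g4 hη0).trans g6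
  have hsum := Finset.sum_le_sum fun t (_ : t ∈ Finset.range q.T) => hstep t
  rw [Finset.sum_add_distrib, Finset.sum_range_sub', ← Finset.mul_sum, ← Finset.mul_sum] at hsum
  simp only [Finset.sum_const, Finset.card_range, nsmul_eq_mul] at hsum
  set R := ∑ t ∈ Finset.range q.T,
      (completionReward q.θ Mstar (oddState s q Mstar x t).1 (x t) (fst Z) (snd Z) -
        completionReward q.θ Mstar (oddState s q Mstar x t).1 (x t)
          (fst (oddState s q Mstar x t).2) (snd (oddState s q Mstar x t).2))
  have g1 : relEntropy Z (oddState s q Mstar x 0).2 ≤ 4 * q.K * N * Real.log (4 * N) :=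
    relEntropy_init_le hK hm hn hZ
  have g2 : 0 ≤ relEntropy Z (oddState s q Mstar x q.T).2 := relEntropy_nonneg hZ.1
    (oddState_spec (s := s) (Mstar := Mstar) (x := x) hm hn hT hK hα q.T).2.2
  have hNl : 0 < N * Real.log (4 * N) := by positivity
  set u := √(N * Real.log (4 * N)) with hu
  have hu0 : 0 < u := Real.sqrt_pos.2 hNl
  have hu2 : u ^ 2 = N * Real.log (4 * N) := Real.sq_sqrt hNl.le
  set v := √(q.T : ℝ) with hv
  have hv0 : 0 < v := Real.sqrt_pos.2 hT'
  have hv2 : v ^ 2 = q.T := Real.sq_sqrt hT'.le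
  have hη1 : η = u / (2 * (1 + 8 * q.θ) * v) := by
    rw [hη, completionStep, Real.sqrt_div hNl.le, ← hu, ← hv]
    field_simp
  -- Together with the initial divergence `4 K u²` this gives the constant `20`.
  have g3 : (q.T : ℝ) * (η ^ 2 * q.K * ℓ ^ 2) = 16 * q.K * u ^ 2 := by
    rw [hη1, hℓ, ← hv2]
    field_simp
    ring
  have g4 : η * (2 * R) ≤ 20 * q.K * u ^ 2 := by
    rw [hu2] at g3 ⊢
    linarith
  rw [hη1, div_mul_eq_mul_div, div_le_iff₀ (by positivity)] at g4
  rw [Real.sqrt_mul hNl.le]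
  have g5 : (2 * u) * R ≤ (2 * u) * (20 * q.K * (1 + 8 * q.θ) * (u * v)) := by linarith
  exact le_of_mul_le_mul_left g5 (by positivity)

end Game

end PMC

/-! ### Independent draws from a finite space. -/

namespace PMC

open Matrix
open scoped ENNReal

section IID

variable {𝒳 : Type*} [Fintype 𝒳] [MeasurableSpace 𝒳]
  {Ω : Type*} [MeasurableSpace Ω] {P : Measure Ω}
  {μ : Measure 𝒳} {x : ℕ → Ω → 𝒳}

/-- `g` depends only on the first `t` terms of a sequence. -/
def DependsOnPrefix {𝒳 β : Type*} (t : ℕ) (g : (ℕ → 𝒳) → β) : Prop :=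
  ∀ a b : ℕ → 𝒳, (∀ s < t, a s = b s) → g a = g b

theorem DependsOnPrefix.exists_factor {𝒳 β : Type*} [Nonempty 𝒳] {t : ℕ} {g : (ℕ → 𝒳) → β}
    (hg : DependsOnPrefix t g) :
    ∃ G : (Finset.range t → 𝒳) → β, ∀ a, g a = G fun s => a s := by
  classical
  refine ⟨fun h => g fun s => if hs : s ∈ Finset.range t then h ⟨s, hs⟩ else Classical.arbitrary 𝒳,
    fun a => hg _ _ fun s hs => ?_⟩
  rw [dif_pos (Finset.mem_range.2 hs)]

/-- A function of finitely many draws from a finite space is measurable for trivial reasons. This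
settles measurability for the algorithm, whose argmins are arbitrary choices, and for suprema over
uncountable classes. -/
theorem DependsOnPrefix.measurable [MeasurableSingletonClass 𝒳] [Nonempty 𝒳] {β : Type*}
    [MeasurableSpace β] {t : ℕ}
    {g : (ℕ → 𝒳) → β} (hg : DependsOnPrefix t g) (hx : ∀ t, Measurable (x t)) :
    Measurable fun ω => g fun s => x s ω := by
  obtain ⟨G, hG⟩ := hg.exists_factor
  simp only [hG]
  exact (Measurable.of_discrete (f := G)).comp (measurable_pi_lambda _ fun s => hx s)

/-- Conditional expectation of a function of the past and the next draw. -/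
theorem lintegral_next [MeasurableSingletonClass 𝒳] [Nonempty 𝒳] (hx : ∀ t, Measurable (x t))
    (hind : iIndepFun x P)
    (hμ : ∀ t, P.map (x t) = μ) {t : ℕ} {g : (ℕ → 𝒳) → 𝒳 → ℝ≥0∞} (hg : DependsOnPrefix t g) :
    ∫⁻ ω, g (fun s => x s ω) (x t ω) ∂P =
      ∫⁻ ω, ∑ y, μ {y} * g (fun s => x s ω) y ∂P := by
  classical
  have hgy : ∀ y, DependsOnPrefix t fun a => g a y := fun y a b h => congrFun (hg a b h) y
  have hmeas : ∀ y, Measurable fun ω => g (fun s => x s ω) y := fun y => (hgy y).measurable hx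
  have hind' : ∀ y, IndepFun (fun ω => Set.indicator {y} (1 : 𝒳 → ℝ≥0∞) (x t ω))
      (fun ω => g (fun s => x s ω) y) P := by
    intro y
    obtain ⟨G, hG⟩ := (hgy y).exists_factor
    simp only [hG]
    have h := hind.indepFun_finset {t} (Finset.range t) (by simp) hx
    exact h.comp (φ := fun h : ({t} : Finset ℕ) → 𝒳 =>
        Set.indicator {y} (1 : 𝒳 → ℝ≥0∞) (h ⟨t, Finset.mem_singleton_self t⟩)) (ψ := G)
      Measurable.of_discrete Measurable.of_discrete
  -- Splitting over the value of the next draw reduces the claim to products of an indicator and an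
  -- independent function of the past.
  have hsplit : ∀ ω, g (fun s => x s ω) (x t ω) =
      ∑ y, Set.indicator {y} (1 : 𝒳 → ℝ≥0∞) (x t ω) * g (fun s => x s ω) y := by
    intro ω
    rw [Finset.sum_eq_single (x t ω)]
    · simp
    · intro y _ hy
      simp [Set.indicator, hy.symm]
    · simp
  have hind1 : ∀ y, Measurable fun ω => Set.indicator {y} (1 : 𝒳 → ℝ≥0∞) (x t ω) := fun y =>
    (Measurable.of_discrete (f := Set.indicator {y} (1 : 𝒳 → ℝ≥0∞))).comp (hx t)
  simp only [hsplit]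
  have hprod : ∀ y, Measurable fun ω =>
      Set.indicator {y} (1 : 𝒳 → ℝ≥0∞) (x t ω) * g (fun s => x s ω) y := fun y =>
    (hind1 y).mul (hmeas y)
  rw [lintegral_finsetSum _ fun y _ => hprod y,
    lintegral_finsetSum _ fun y _ => (hmeas y).const_mul _]
  refine Finset.sum_congr rfl fun y _ => ?_
  have h1 := lintegral_mul_eq_lintegral_mul_lintegral_of_indepFun (hind1 y) (hmeas y) (hind' y)
  simp only [Pi.mul_apply] at h1
  rw [h1, lintegral_const_mul _ (hmeas y)]
  congr 1
  rw [← hμ t, Measure.map_apply (hx t) (measurableSet_singleton y),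
    ← lintegral_indicator_one ((hx t) (measurableSet_singleton y))]
  rfl

theorem sum_measure_singleton_univ [MeasurableSingletonClass 𝒳] (μ : Measure 𝒳)
    [IsProbabilityMeasure μ] :
    ∑ y, μ {y} = 1 := by
  rw [sum_measure_singleton, Finset.coe_univ, measure_univ]

theorem sum_measureReal_singleton_univ [MeasurableSingletonClass 𝒳] (μ : Measure 𝒳)
    [IsProbabilityMeasure μ] :
    ∑ y, μ.real {y} = 1 := by
  simp only [measureReal_def]
  rw [← ENNReal.toReal_sum fun y _ => measure_ne_top μ _, sum_measure_singleton_univ,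
    ENNReal.toReal_one]

theorem sum_measure_mul_ofReal (μ : Measure 𝒳) [IsProbabilityMeasure μ] {f : 𝒳 → ℝ}
    (hf : ∀ y, 0 ≤ f y) :
    ∑ y, μ {y} * ENNReal.ofReal (f y) = ENNReal.ofReal (∑ y, μ.real {y} * f y) := by
  rw [ENNReal.ofReal_sum_of_nonneg fun y _ => mul_nonneg measureReal_nonneg (hf y)]
  refine Finset.sum_congr rfl fun y _ => ?_
  rw [ENNReal.ofReal_mul measureReal_nonneg, ofReal_measureReal]

theorem measure_le_ofReal_exp {f : Ω → ℝ≥0∞} (hf : Measurable f) {u v : ℝ}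
    (hu : ∫⁻ ω, f ω ∂P ≤ ENNReal.ofReal (Real.exp u)) {E : Set Ω}
    (hE : ∀ ω ∈ E, ENNReal.ofReal (Real.exp v) ≤ f ω) :
    P E ≤ ENNReal.ofReal (Real.exp (u - v)) := by
  have h1 : ENNReal.ofReal (Real.exp v) * P E ≤ ENNReal.ofReal (Real.exp u) :=
    (mul_le_mul_right (measure_mono hE) _).trans ((mul_meas_ge_le_lintegral hf _).trans hu)
  rw [Real.exp_sub, ENNReal.ofReal_div_of_pos (Real.exp_pos v),
    ENNReal.le_div_iff_mul_le (Or.inl (by simp [Real.exp_pos])) (Or.inl ENNReal.ofReal_ne_top),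
    mul_comm]
  exact h1

/-- Exponential moments of a bounded martingale. -/
theorem lintegral_exp_martingale_le [MeasurableSingletonClass 𝒳] [IsProbabilityMeasure P]
    [Nonempty 𝒳] [IsProbabilityMeasure μ]
    (hx : ∀ t, Measurable (x t)) (hind : iIndepFun x P) (hμ : ∀ t, P.map (x t) = μ)
    {d : (ℕ → 𝒳) → ℕ → 𝒳 → ℝ} (hd : ∀ t, DependsOnPrefix t fun a => d a t)
    (hmean : ∀ a t, ∑ y, μ.real {y} * d a t y = 0) {b r : ℝ} (hb : ∀ a t y, |d a t y| ≤ b)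
    (hr : 0 ≤ r) (hrb : r * b ≤ 1) (T : ℕ) :
    ∫⁻ ω, ENNReal.ofReal (Real.exp
        (r * ∑ t ∈ Finset.range T, d (fun s => x s ω) t (x t ω))) ∂P ≤
      ENNReal.ofReal (Real.exp (T * (r * b) ^ 2)) := by
  induction T with
  | zero => simp
  | succ T ih =>
    have hpre : DependsOnPrefix T fun a : ℕ → 𝒳 => fun y : 𝒳 =>
        ENNReal.ofReal (Real.exp (r * ∑ t ∈ Finset.range T, d a t (a t))) *
          ENNReal.ofReal (Real.exp (r * d a T y)) := by
      intro a a' h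
      have h1 : ∑ t ∈ Finset.range T, d a t (a t) = ∑ t ∈ Finset.range T, d a' t (a' t) := by
        refine Finset.sum_congr rfl fun t ht => ?_
        have htT := Finset.mem_range.1 ht
        rw [h t htT]
        exact congrFun (hd t a a' fun s hs => h s (hs.trans htT)) _
      have h2 : d a T = d a' T := hd T a a' h
      simp only [h1, h2]
    have hone : ∀ a, ∑ y, μ {y} * ENNReal.ofReal (Real.exp (r * d a T y)) ≤
        ENNReal.ofReal (Real.exp ((r * b) ^ 2)) := by
      intro a
      rw [sum_measure_mul_ofReal μ fun y => (Real.exp_pos _).le]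
      refine ENNReal.ofReal_le_ofReal ?_
      -- Valid because the exponent has modulus at most `r b ≤ 1`; the linear term averages to zero.
      have h1 : ∀ y, Real.exp (r * d a T y) ≤ 1 + r * d a T y + (r * b) ^ 2 := by
        intro y
        have h2 : |r * d a T y| ≤ r * b := by
          rw [abs_mul, abs_of_nonneg hr]
          exact mul_le_mul_of_nonneg_left (hb a T y) hr
        have h3 := (abs_le.1 (Real.abs_exp_sub_one_sub_id_le (h2.trans hrb))).2
        have h4 : (r * d a T y) ^ 2 ≤ (r * b) ^ 2 := by
          rw [← sq_abs]
          exact pow_le_pow_left₀ (abs_nonneg _) h2 2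
        linarith
      calc ∑ y, μ.real {y} * Real.exp (r * d a T y)
          ≤ ∑ y, μ.real {y} * (1 + r * d a T y + (r * b) ^ 2) :=
            Finset.sum_le_sum fun y _ => mul_le_mul_of_nonneg_left (h1 y) measureReal_nonneg
        _ = (∑ y, μ.real {y}) * (1 + (r * b) ^ 2) + r * ∑ y, μ.real {y} * d a T y := by
            rw [Finset.sum_mul, Finset.mul_sum, ← Finset.sum_add_distrib]
            exact Finset.sum_congr rfl fun y _ => by ring
        _ = (r * b) ^ 2 + 1 := by rw [hmean, sum_measureReal_singleton_univ]; ring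
        _ ≤ _ := Real.add_one_le_exp _
    calc ∫⁻ ω, ENNReal.ofReal (Real.exp
            (r * ∑ t ∈ Finset.range (T + 1), d (fun s => x s ω) t (x t ω))) ∂P
        = ∫⁻ ω, ENNReal.ofReal (Real.exp
              (r * ∑ t ∈ Finset.range T, d (fun s => x s ω) t (x t ω))) *
            ENNReal.ofReal (Real.exp (r * d (fun s => x s ω) T (x T ω))) ∂P := by
          simp only [Finset.sum_range_succ, mul_add, Real.exp_add,
            ENNReal.ofReal_mul (Real.exp_pos _).le]
      _ = ∫⁻ ω, ∑ y, μ {y} * (ENNReal.ofReal (Real.exp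
              (r * ∑ t ∈ Finset.range T, d (fun s => x s ω) t (x t ω))) *
            ENNReal.ofReal (Real.exp (r * d (fun s => x s ω) T y))) ∂P :=
          lintegral_next hx hind hμ hpre
      _ ≤ ∫⁻ ω, ENNReal.ofReal (Real.exp ((r * b) ^ 2)) * ENNReal.ofReal (Real.exp
              (r * ∑ t ∈ Finset.range T, d (fun s => x s ω) t (x t ω))) ∂P := by
          refine lintegral_mono fun ω => ?_
          have := hone fun s => x s ω
          simp only [mul_left_comm (μ _)]
          rw [← Finset.mul_sum, mul_comm]
          gcongr
      _ ≤ ENNReal.ofReal (Real.exp ((r * b) ^ 2)) *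
            ENNReal.ofReal (Real.exp (T * (r * b) ^ 2)) := by
          rw [lintegral_const_mul' _ _ ENNReal.ofReal_ne_top]
          gcongr
      _ = _ := by
          rw [← ENNReal.ofReal_mul (Real.exp_pos _).le, ← Real.exp_add]
          congr 2
          push_cast
          ring

/-- Iterated averages over independent draws. -/
theorem lintegral_iterate [MeasurableSingletonClass 𝒳] [IsProbabilityMeasure P] [Nonempty 𝒳]
    (hx : ∀ t, Measurable (x t)) (hind : iIndepFun x P)
    (hμ : ∀ t, P.map (x t) = μ) {E : Type*} [AddCommMonoid E] (φ : 𝒳 → E) (T : ℕ) :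
    ∀ (Φ : E → ℝ≥0∞) (a : E), ∫⁻ ω, Φ (a + ∑ t ∈ Finset.range T, φ (x t ω)) ∂P =
      (fun (Ψ : E → ℝ≥0∞) b => ∑ y, μ {y} * Ψ (b + φ y))^[T] Φ a := by
  induction T with
  | zero => intro Φ a; simp
  | succ T ih =>
    intro Φ a
    -- The innermost average belongs to the last draw, so that draw is integrated out first.
    rw [Function.iterate_succ_apply, ← ih]
    have hpre : DependsOnPrefix T fun z : ℕ → 𝒳 => fun y : 𝒳 =>
        Φ (a + ∑ t ∈ Finset.range T, φ (z t) + φ y) := by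
      intro z z' h
      have h1 : ∑ t ∈ Finset.range T, φ (z t) = ∑ t ∈ Finset.range T, φ (z' t) :=
        Finset.sum_congr rfl fun t ht => by rw [h t (Finset.mem_range.1 ht)]
      simp only [h1]
    rw [← lintegral_next hx hind hμ hpre]
    simp only [Finset.sum_range_succ, add_assoc]

end IID

end PMC

/-! ### A contraction principle for exponential moments. -/

namespace PMC

open Matrix
open scoped ENNReal

section Contraction

/-- Convexity: the increment from `v` to `q` starts lower and is no longer than the one from `p` to
`u`. -/
theorem exp_add_exp_le_of_majorized {p q u v : ℝ} (hqv : v ≤ q) (hvp : v ≤ p)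
    (h : q - v ≤ u - p) : Real.exp p + Real.exp q ≤ Real.exp u + Real.exp v := by
  have h1 : Real.exp q - Real.exp v = Real.exp v * (Real.exp (q - v) - 1) := by
    rw [mul_sub, ← Real.exp_add, mul_one]
    congr 2
    ring
  have h2 : Real.exp u - Real.exp p = Real.exp p * (Real.exp (u - p) - 1) := by
    rw [mul_sub, ← Real.exp_add, mul_one]
    congr 2
    ring
  have h3 : Real.exp v * (Real.exp (q - v) - 1) ≤ Real.exp p * (Real.exp (u - p) - 1) := by
    have h4 : 0 ≤ Real.exp (q - v) - 1 := sub_nonneg.2 (Real.one_le_exp (by linarith))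
    have h5 := Real.exp_le_exp.2 hvp
    have h6 := Real.exp_le_exp.2 h
    have h7 := Real.exp_pos p
    gcongr
  linarith

/-- Two-point contraction for the square on `[-2, 2]`, when both points are optimal. -/
theorem exp_sq_contraction_aux {κ a b u v : ℝ} (hκ : 0 ≤ κ) (hu : |u| ≤ 2) (hv : |v| ≤ 2)
    (h₁ : b + κ * v ^ 2 ≤ a + κ * u ^ 2) (h₂ : a - κ * u ^ 2 ≤ b - κ * v ^ 2) :
    Real.exp (a + κ * u ^ 2) + Real.exp (b - κ * v ^ 2) ≤
        Real.exp (a + 4 * κ * u) + Real.exp (b - 4 * κ * v) ∨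
      Real.exp (a + κ * u ^ 2) + Real.exp (b - κ * v ^ 2) ≤
        Real.exp (b + 4 * κ * v) + Real.exp (a - 4 * κ * u) := by
  rw [abs_le] at hu hv
  have hpos : ∀ w, -2 ≤ w → w ≤ 2 → 0 ≤ w → κ * w ^ 2 ≤ 4 * κ * w := by
    intro w _ h2 h0
    nlinarith [mul_nonneg hκ h0, mul_nonneg (mul_nonneg hκ h0) (sub_nonneg.2 h2)]
  have hneg : ∀ w, -2 ≤ w → w ≤ 2 → w ≤ 0 → κ * w ^ 2 ≤ -(4 * κ * w) := by
    intro w h1 h2 h0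
    have := hpos (-w) (by linarith) (by linarith) (by linarith)
    nlinarith
  have hsq : ∀ w, 0 ≤ κ * w ^ 2 := fun w => by positivity
  -- This says that `w²` grows at most four times as fast as `w` on `[0, 2]`, which is where the
  -- factor `4` of the contraction comes from.
  have hmono : ∀ w z, 0 ≤ z → z ≤ w → w ≤ 2 →
      4 * κ * z - κ * z ^ 2 ≤ 4 * κ * w - κ * w ^ 2 := by
    intro w z h0 h1 h2
    nlinarith [mul_nonneg hκ (mul_nonneg (sub_nonneg.2 h1) (by linarith : 0 ≤ 4 - w - z))]
  have hu0 := hsq u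
  have hv0 := hsq v
  rcases le_total 0 u with hu' | hu' <;> rcases le_total 0 v with hv' | hv'
  · have e1 := hpos u hu.1 hu.2 hu'
    have e2 := hpos v hv.1 hv.2 hv'
    rcases le_total v u with huv | huv
    · left
      have := hmono u v hv' huv hu.2
      exact exp_add_exp_le_of_majorized (by linarith) (by linarith) (by linarith)
    · right
      have : κ * u ^ 2 ≤ κ * v ^ 2 := mul_le_mul_of_nonneg_left (pow_le_pow_left₀ hu' huv 2) hκ
      have := mul_le_mul_of_nonneg_left huv hκ
      rw [add_comm (Real.exp (a + κ * u ^ 2))]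
      exact exp_add_exp_le_of_majorized (by linarith) (by linarith) (by linarith)
  · left
    have e1 := hpos u hu.1 hu.2 hu'
    have e2 := hneg v hv.1 hv.2 hv'
    exact add_le_add (Real.exp_le_exp.2 (by linarith)) (Real.exp_le_exp.2 (by linarith))
  · right
    have e1 := hneg u hu.1 hu.2 hu'
    have e2 := hpos v hv.1 hv.2 hv'
    rw [add_comm (Real.exp (b + 4 * κ * v))]
    exact add_le_add (Real.exp_le_exp.2 (by linarith)) (Real.exp_le_exp.2 (by linarith))
  · have e1 := hneg u hu.1 hu.2 hu'
    have e2 := hneg v hv.1 hv.2 hv'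
    rcases le_total u v with huv | huv
    · right
      have := hmono (-u) (-v) (by linarith) (by linarith) (by linarith)
      rw [add_comm (Real.exp (b + 4 * κ * v))]
      exact exp_add_exp_le_of_majorized (by linarith) (by linarith) (by nlinarith)
    · left
      have := hmono (-v) (-u) (by linarith) (by linarith) (by linarith)
      rw [add_comm (Real.exp (a + κ * u ^ 2)), add_comm (Real.exp (a + 4 * κ * u))]
      exact exp_add_exp_le_of_majorized (by linarith) (by linarith) (by nlinarith)

/-- Supremum of the exponential of a function over a class. -/
noncomputable def supExp {𝓜 : Type*} (𝒞 : Set 𝓜) (A : 𝓜 → ℝ) : ℝ≥0∞ :=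
  ⨆ M ∈ 𝒞, ENNReal.ofReal (Real.exp (A M))

theorem le_supExp {𝓜 : Type*} {𝒞 : Set 𝓜} (A : 𝓜 → ℝ) {M : 𝓜} (hM : M ∈ 𝒞) :
    ENNReal.ofReal (Real.exp (A M)) ≤ supExp 𝒞 A :=
  le_iSup₂ (f := fun M (_ : M ∈ 𝒞) => ENNReal.ofReal (Real.exp (A M))) M hM

theorem supExp_le {𝓜 : Type*} {𝒞 : Set 𝓜} {A : 𝓜 → ℝ} {c : ℝ≥0∞}
    (h : ∀ M ∈ 𝒞, ENNReal.ofReal (Real.exp (A M)) ≤ c) : supExp 𝒞 A ≤ c :=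
  iSup₂_le h

/-- Contraction: squares of functions bounded by `2` may be replaced by the functions. -/
theorem supExp_sq_contraction {𝓜 : Type*} {𝒞 : Set 𝓜} {κ : ℝ} (hκ : 0 ≤ κ) (A w : 𝓜 → ℝ)
    (hw : ∀ M ∈ 𝒞, |w M| ≤ 2) :
    supExp 𝒞 (fun M => A M + κ * w M ^ 2) + supExp 𝒞 (fun M => A M - κ * w M ^ 2) ≤
      supExp 𝒞 (fun M => A M + 4 * κ * w M) + supExp 𝒞 (fun M => A M - 4 * κ * w M) := by
  set R := supExp 𝒞 (fun M => A M + 4 * κ * w M) + supExp 𝒞 (fun M => A M - 4 * κ * w M)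
  have hR : ∀ a ∈ 𝒞, ∀ b ∈ 𝒞,
      ENNReal.ofReal (Real.exp (A a + 4 * κ * w a) + Real.exp (A b - 4 * κ * w b)) ≤ R := by
    intro a ha b hb
    rw [ENNReal.ofReal_add (Real.exp_pos _).le (Real.exp_pos _).le]
    exact add_le_add (le_supExp (fun M => A M + 4 * κ * w M) ha)
      (le_supExp (fun M => A M - 4 * κ * w M) hb)
  have key : ∀ a ∈ 𝒞, ∀ b ∈ 𝒞, A b + κ * w b ^ 2 ≤ A a + κ * w a ^ 2 →
      A a - κ * w a ^ 2 ≤ A b - κ * w b ^ 2 →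
      ENNReal.ofReal (Real.exp (A a + κ * w a ^ 2) + Real.exp (A b - κ * w b ^ 2)) ≤ R := by
    intro a ha b hb h1 h2
    rcases exp_sq_contraction_aux hκ (hw a ha) (hw b hb) h1 h2 with h | h
    · exact (ENNReal.ofReal_le_ofReal h).trans (hR a ha b hb)
    · exact (ENNReal.ofReal_le_ofReal h).trans (hR b hb a ha)
  have hall : ∀ a ∈ 𝒞, ∀ b ∈ 𝒞,
      ENNReal.ofReal (Real.exp (A a + κ * w a ^ 2)) +
        ENNReal.ofReal (Real.exp (A b - κ * w b ^ 2)) ≤ R := by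
    intro a ha b hb
    rw [← ENNReal.ofReal_add (Real.exp_pos _).le (Real.exp_pos _).le]
    -- The auxiliary inequality needs each point to be best for its own sign. If one point is best
    -- for both signs it is used twice; if the roles are reversed the points are exchanged.
    rcases le_total (A b + κ * w b ^ 2) (A a + κ * w a ^ 2) with h1 | h1 <;>
      rcases le_total (A a - κ * w a ^ 2) (A b - κ * w b ^ 2) with h2 | h2
    · exact key a ha b hb h1 h2
    · refine le_trans (ENNReal.ofReal_le_ofReal ?_) (key a ha a ha le_rfl le_rfl)
      gcongr
    · refine le_trans (ENNReal.ofReal_le_ofReal ?_) (key b hb b hb le_rfl le_rfl)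
      gcongr
    · refine le_trans (ENNReal.ofReal_le_ofReal ?_) (key b hb a ha h1 h2)
      gcongr
  rcases 𝒞.eq_empty_or_nonempty with rfl | ⟨M₀, hM₀⟩
  · simp [supExp]
  · have h1 : ∀ b ∈ 𝒞, supExp 𝒞 (fun M => A M + κ * w M ^ 2) +
        ENNReal.ofReal (Real.exp (A b - κ * w b ^ 2)) ≤ R := by
      intro b hb
      -- The pairwise bound passes to a sum of suprema one argument at a time, moving the finite
      -- term across by truncated subtraction. An infinite first supremum is treated separately
      -- below.
      refine ENNReal.le_sub_iff_add_le_right ENNReal.ofReal_ne_top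
        (le_trans le_add_self (hall M₀ hM₀ b hb)) |>.1 (supExp_le fun a ha => ?_)
      exact ENNReal.le_sub_of_add_le_right ENNReal.ofReal_ne_top (hall a ha b hb)
    by_cases htop : supExp 𝒞 (fun M => A M + κ * w M ^ 2) = ∞
    · have := h1 M₀ hM₀
      rw [htop, top_add, top_le_iff] at this
      rw [this]
      exact le_top
    · rw [add_comm]
      refine ENNReal.le_sub_iff_add_le_right htop
        (le_trans le_self_add (h1 M₀ hM₀)) |>.1 (supExp_le fun b hb => ?_)
      refine ENNReal.le_sub_of_add_le_right htop ?_
      rw [add_comm]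
      exact h1 b hb

end Contraction

/-! ### Symmetrization by commuting averaging operators. -/

section Symmetrization

variable {𝒳 : Type*} [Fintype 𝒳] [MeasurableSpace 𝒳] (μ : Measure 𝒳) {𝓜 : Type*}

/-- Average over a draw `y` of the translates by `φ y`. -/
noncomputable def drawAvg (φ : 𝒳 → 𝓜 → ℝ) (Φ : (𝓜 → ℝ) → ℝ≥0∞) (A : 𝓜 → ℝ) : ℝ≥0∞ :=
  ∑ y, μ {y} * Φ (A + φ y)

/-- Average over a draw `y` and a random sign of the translates by `± ψ y`. -/
noncomputable def signAvg (ψ : 𝒳 → 𝓜 → ℝ) (Φ : (𝓜 → ℝ) → ℝ≥0∞) (A : 𝓜 → ℝ) : ℝ≥0∞ :=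
  ∑ y, μ {y} * (2⁻¹ * (Φ (A + ψ y) + Φ (A - ψ y)))

variable {μ}

theorem drawAvg_mono {φ : 𝒳 → 𝓜 → ℝ} {Φ Ψ : (𝓜 → ℝ) → ℝ≥0∞} (h : Φ ≤ Ψ) :
    drawAvg μ φ Φ ≤ drawAvg μ φ Ψ := fun A => by
  unfold drawAvg
  gcongr
  exact h _

theorem signAvg_mono {ψ : 𝒳 → 𝓜 → ℝ} {Φ Ψ : (𝓜 → ℝ) → ℝ≥0∞} (h : Φ ≤ Ψ) :
    signAvg μ ψ Φ ≤ signAvg μ ψ Ψ := fun A => by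
  unfold signAvg
  gcongr <;> exact h _

theorem drawAvg_signAvg (φ ψ : 𝒳 → 𝓜 → ℝ) (Φ : (𝓜 → ℝ) → ℝ≥0∞) :
    drawAvg μ φ (signAvg μ ψ Φ) = signAvg μ ψ (drawAvg μ φ Φ) := by
  funext A
  simp only [drawAvg, signAvg, Finset.mul_sum, ← Finset.sum_add_distrib]
  rw [Finset.sum_comm]
  refine Finset.sum_congr rfl fun y _ => Finset.sum_congr rfl fun z _ => ?_
  rw [add_right_comm, show A + φ z - ψ y = A - ψ y + φ z by abel]
  ring

/-- One-step domination is assumed only at `Φ`, not at its iterates. Since both operators are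
averages of translations they commute, so every draw average can be brought next to `Φ` before it is
replaced. -/
theorem drawAvg_iterate_le {φ ψ : 𝒳 → 𝓜 → ℝ} {Φ : (𝓜 → ℝ) → ℝ≥0∞}
    (h : drawAvg μ φ Φ ≤ signAvg μ ψ Φ) (T : ℕ) :
    (drawAvg μ φ)^[T] Φ ≤ (signAvg μ ψ)^[T] Φ := by
  have hcomm : Function.Commute (drawAvg μ φ) (signAvg μ ψ) := fun Φ => drawAvg_signAvg φ ψ Φ
  have hmono : Monotone (signAvg μ ψ) := fun Φ Ψ h => signAvg_mono h
  induction T with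
  | zero => exact le_rfl
  | succ T ih =>
    rw [Function.iterate_succ_apply', Function.iterate_succ_apply]
    refine (drawAvg_mono ih).trans ?_
    rw [(hcomm.iterate_right T).eq]
    exact hmono.iterate T h

/-- One step of symmetrization and contraction for centred squares. -/
theorem drawAvg_supExp_le [MeasurableSingletonClass 𝒳] [IsProbabilityMeasure μ] {𝒞 : Set 𝓜} {r : ℝ}
    (hr : 0 ≤ r)
    {w : 𝒳 → 𝓜 → ℝ} (hw : ∀ y, ∀ M ∈ 𝒞, |w y M| ≤ 2) :
    drawAvg μ (fun y M => r * (w y M ^ 2 - ∑ z, μ.real {z} * w z M ^ 2)) (supExp 𝒞) ≤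
      signAvg μ (fun y M => 8 * r * w y M) (supExp 𝒞) := by
  intro A
  set p : 𝒳 → ℝ≥0∞ := fun y => supExp 𝒞 fun M => A M + 2 * r * w y M ^ 2
  set q : 𝒳 → ℝ≥0∞ := fun y => supExp 𝒞 fun M => A M - 2 * r * w y M ^ 2
  have h1 : ∀ y, supExp 𝒞 (A + fun M => r * (w y M ^ 2 - ∑ z, μ.real {z} * w z M ^ 2)) ≤
      ∑ z, μ {z} * (2⁻¹ * (p y + q z)) := by
    intro y
    refine supExp_le fun M hM => ?_
    -- Jensen's inequality replaces the mean by an independent copy `z`. Midpoint convexity of `exp`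
    -- then separates `y` from `z`, doubling `r`.
    have hjensen : Real.exp (A M + r * (w y M ^ 2 - ∑ z, μ.real {z} * w z M ^ 2)) ≤
        ∑ z, μ.real {z} * (2⁻¹ * (Real.exp (A M + 2 * r * w y M ^ 2) +
          Real.exp (A M - 2 * r * w z M ^ 2))) := by
      have h2 := convexOn_exp.map_sum_le (t := Finset.univ) (w := fun z => μ.real {z})
        (p := fun z => A M + r * (w y M ^ 2 - w z M ^ 2)) (fun z _ => measureReal_nonneg)
        (sum_measureReal_singleton_univ μ) (fun z _ => Set.mem_univ _)
      simp only [smul_eq_mul] at h2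
      have h3 : ∑ z, μ.real {z} * (A M + r * (w y M ^ 2 - w z M ^ 2)) =
          A M + r * (w y M ^ 2 - ∑ z, μ.real {z} * w z M ^ 2) := by
        have h4 := sum_measureReal_singleton_univ μ
        calc ∑ z, μ.real {z} * (A M + r * (w y M ^ 2 - w z M ^ 2))
            = (∑ z, μ.real {z}) * (A M + r * w y M ^ 2) - r * ∑ z, μ.real {z} * w z M ^ 2 := by
              rw [Finset.sum_mul, Finset.mul_sum, ← Finset.sum_sub_distrib]
              exact Finset.sum_congr rfl fun z _ => by ring
          _ = _ := by rw [h4]; ring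
      rw [h3] at h2
      refine h2.trans (Finset.sum_le_sum fun z _ => mul_le_mul_of_nonneg_left ?_ measureReal_nonneg)
      have h5 := convexOn_exp.2 (Set.mem_univ (A M + 2 * r * w y M ^ 2))
        (Set.mem_univ (A M - 2 * r * w z M ^ 2)) (by norm_num : (0 : ℝ) ≤ 1 / 2)
        (by norm_num : (0 : ℝ) ≤ 1 / 2) (by norm_num)
      simp only [smul_eq_mul] at h5
      have h6 : 1 / 2 * (A M + 2 * r * w y M ^ 2) + 1 / 2 * (A M - 2 * r * w z M ^ 2) =
        A M + r * (w y M ^ 2 - w z M ^ 2) := by ring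
      rw [h6] at h5
      linarith
    refine (ENNReal.ofReal_le_ofReal hjensen).trans ?_
    rw [← sum_measure_mul_ofReal μ fun z => by positivity]
    gcongr with z _
    rw [ENNReal.ofReal_mul (by norm_num), ENNReal.ofReal_inv_of_pos (by norm_num),
      ENNReal.ofReal_ofNat, ENNReal.ofReal_add (Real.exp_pos _).le (Real.exp_pos _).le]
    gcongr
    · exact le_supExp (fun M => A M + 2 * r * w y M ^ 2) hM
    · exact le_supExp (fun M => A M - 2 * r * w z M ^ 2) hM
  -- After the separation the copy may be renamed: `y` and `z` have the same law, and a random sign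
  -- in front of a single draw remains.
  have h2 : ∑ y, μ {y} * ∑ z, μ {z} * (2⁻¹ * (p y + q z)) = ∑ y, μ {y} * (2⁻¹ * (p y + q y)) := by
    have hone := sum_measure_singleton_univ μ
    have e1 : ∑ y, μ {y} * ∑ z, μ {z} * (2⁻¹ * (p y + q z)) =
        2⁻¹ * ((∑ y, μ {y} * p y) * (∑ z, μ {z}) + (∑ y, μ {y}) * ∑ z, μ {z} * q z) := by
      rw [Finset.sum_mul_sum, Finset.sum_mul_sum, ← Finset.sum_add_distrib, Finset.mul_sum]
      refine Finset.sum_congr rfl fun y _ => ?_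
      rw [← Finset.sum_add_distrib, Finset.mul_sum, Finset.mul_sum]
      exact Finset.sum_congr rfl fun z _ => by ring
    have e2 : ∑ y, μ {y} * (2⁻¹ * (p y + q y)) =
        2⁻¹ * ((∑ y, μ {y} * p y) + ∑ z, μ {z} * q z) := by
      simp only [← Finset.sum_add_distrib, Finset.mul_sum]
      refine Finset.sum_congr rfl fun y _ => by ring
    rw [e1, e2, hone, mul_one, one_mul]
  calc drawAvg μ (fun y M => r * (w y M ^ 2 - ∑ z, μ.real {z} * w z M ^ 2)) (supExp 𝒞) A
      ≤ ∑ y, μ {y} * ∑ z, μ {z} * (2⁻¹ * (p y + q z)) := by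
        unfold drawAvg
        gcongr with y _
        exact h1 y
    _ = ∑ y, μ {y} * (2⁻¹ * (p y + q y)) := h2
    _ ≤ _ := by
        unfold signAvg
        refine Finset.sum_le_sum fun y _ => mul_le_mul_right (mul_le_mul_right ?_ _) _
        have h3 := supExp_sq_contraction (by positivity : 0 ≤ 2 * r) A (w y) (hw y)
        have e : 4 * (2 * r) = 8 * r := by ring
        rw [e] at h3
        exact h3

end Symmetrization

/-! ### Exponential moments over the max-norm class through online regret. -/

section Complexity

variable {m n : ℕ} {K : ℝ}

/-- Deviation of two completions at one entry, as a pairing. -/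
theorem sub_eq_pair (y : Fin m × Fin n) (M₁ M₂ : Matrix (Fin m) (Fin n) ℝ) (ε : ℝ) :
    pair (Matrix.single y.1 y.2 ε) M₁ + pair (-Matrix.single y.1 y.2 ε) M₂ =
      ε * (M₁ y.1 y.2 - M₂ y.1 y.2) := by
  rw [pair_neg_left, pair_single, pair_single]
  ring

/-- Exponential moment of the Rademacher process over the max-norm class, through the regret of
matrix multiplicative weights. -/
theorem signAvg_iterate_supExp_le (hK : 0 < K) {μ : Measure (Fin m × Fin n)}
    [IsProbabilityMeasure μ] {Mstar : Matrix (Fin m) (Fin n) ℝ}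
    {c η : ℝ} (hc : 0 ≤ c) (hη : 0 < η)
    {lift : Matrix (Fin m) (Fin n) ℝ → LiftMat m n}
    (hlift : ∀ M ∈ maxClass m n K, lift M ∈ liftSet m n K ∧ fst (lift M) = M ∧
      snd (lift M) = Mstar) (T : ℕ) :
    ∀ (X : LiftMat m n), X ∈ liftSet m n K → X.PosDef →
      ∀ (a : ℝ) (A : Matrix (Fin m) (Fin n) ℝ → ℝ),
      (∀ M ∈ maxClass m n K, A M ≤ a - c / (2 * η) * relEntropy (lift M) X) →
      (signAvg μ fun y M => c * (M y.1 y.2 - Mstar y.1 y.2))^[T] (supExp (maxClass m n K)) A ≤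
        ENNReal.ofReal (Real.exp (a + T * (32 * c * η * K + 2 * c ^ 2))) := by
  induction T with
  | zero =>
    intro X _ hXpd a A hA
    refine supExp_le fun M hM => ENNReal.ofReal_le_ofReal (Real.exp_le_exp.2 ?_)
    have h1 := relEntropy_nonneg (hlift M hM).1.1 hXpd
    have h2 : 0 ≤ c / (2 * η) * relEntropy (lift M) X := by positivity
    have h3 := hA M hM
    push_cast
    linarith
  | succ T ih =>
    intro X hX hXpd a A hA
    set κ := 32 * c * η * K + 2 * c ^ 2 with hκ
    rw [Function.iterate_succ_apply']
    -- The invariant says that `A` lies below a constant minus a multiple of the divergence from the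
    -- current weights `X`. Updating `X` with the signed entry preserves it: the gain of every `M`
    -- is at most the gain of the prediction read off from `X`, plus a drop in divergence and the
    -- second-order term `32 c η K`.
    have hbranch : ∀ (y : Fin m × Fin n) (ε : ℝ), |ε| = 1 →
        ∀ A' : Matrix (Fin m) (Fin n) ℝ → ℝ,
        (∀ M, A' M = A M + ε * (c * (M y.1 y.2 - Mstar y.1 y.2))) →
        (signAvg μ fun y M => c * (M y.1 y.2 - Mstar y.1 y.2))^[T] (supExp (maxClass m n K)) A' ≤
          ENNReal.ofReal (Real.exp (a + c * ε * (fst X y.1 y.2 - snd X y.1 y.2) +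
            32 * c * η * K + T * κ)) := by
      intro y ε hε A' hA'
      have hℓ : ∑ a, ∑ b, |liftFunctional (Matrix.single y.1 y.2 ε)
          (-Matrix.single y.1 y.2 ε) a b| ≤ 8 := by
        rw [sum_abs_liftFunctional, l1Norm_neg, l1Norm_single, hε]
        norm_num
      obtain ⟨h1, h2, h3⟩ := mwUpdate_spec hK (η := η) (liftFunctional_transpose _ _) hX hXpd hℓ
      refine ih _ h1 h2 _ A' fun M hM => ?_
      obtain ⟨g1, g2, g3⟩ := hlift M hM
      have h4 := h3 (lift M) g1
      rw [Matrix.sub_mul, trace_sub, trace_mul_liftFunctional g1.1.isHermitian,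
        trace_mul_liftFunctional hX.1.isHermitian, sub_eq_pair, sub_eq_pair, g2, g3] at h4
      have h5 := mul_le_mul_of_nonneg_left h4 (by positivity : 0 ≤ c / (2 * η))
      have h6 := hA M hM
      rw [hA' M]
      have e1 : c / (2 * η) * (η * (2 * (ε * (M y.1 y.2 - Mstar y.1 y.2)) -
          2 * (ε * (fst X y.1 y.2 - snd X y.1 y.2)))) =
          ε * (c * (M y.1 y.2 - Mstar y.1 y.2)) - c * ε * (fst X y.1 y.2 - snd X y.1 y.2) := by
        field_simp
      have e2 : ∀ u v : ℝ, c / (2 * η) * (u - v + η ^ 2 * K * 8 ^ 2) =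
          c / (2 * η) * u - c / (2 * η) * v + 32 * c * η * K := by
        intro u v
        field_simp
        ring
      rw [e1, e2] at h5
      linarith
    have hpt : ∀ y : Fin m × Fin n,
        2⁻¹ * ((signAvg μ fun y M => c * (M y.1 y.2 - Mstar y.1 y.2))^[T]
            (supExp (maxClass m n K)) (A + fun M => c * (M y.1 y.2 - Mstar y.1 y.2)) +
          (signAvg μ fun y M => c * (M y.1 y.2 - Mstar y.1 y.2))^[T]
            (supExp (maxClass m n K)) (A - fun M => c * (M y.1 y.2 - Mstar y.1 y.2))) ≤
        ENNReal.ofReal (Real.exp (a + (T + 1 : ℕ) * κ)) := by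
      intro y
      have h1 := hbranch y 1 (by simp) (A + fun M => c * (M y.1 y.2 - Mstar y.1 y.2))
        (fun M => by simp)
      have h2 := hbranch y (-1) (by simp) (A - fun M => c * (M y.1 y.2 - Mstar y.1 y.2))
        (fun M => by simp [sub_eq_add_neg])
      set w := fst X y.1 y.2 - snd X y.1 y.2 with hw
      have hw2 : |w| ≤ 2 := by
        have e1 := abs_fst_le hX y.1 y.2
        have e2 := abs_snd_le hX y.1 y.2
        exact (abs_sub _ _).trans (by linarith)
      -- The prediction `w` is made before the sign is seen, so averaging over the sign leaves `cosh
      -- (c w) ≤ exp (2 c²)`, as `|w| ≤ 2`.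
      have hcosh : Real.exp (a + c * 1 * w + 32 * c * η * K + T * κ) +
          Real.exp (a + c * (-1) * w + 32 * c * η * K + T * κ) ≤
          2 * Real.exp (a + (T + 1 : ℕ) * κ) := by
        set b := a + 32 * c * η * K + T * κ with hb
        have e1 : Real.exp (a + c * 1 * w + 32 * c * η * K + T * κ) +
            Real.exp (a + c * (-1) * w + 32 * c * η * K + T * κ) =
            2 * (Real.exp b * Real.cosh (c * w)) := by
          rw [show a + c * 1 * w + 32 * c * η * K + T * κ = b + c * w by rw [hb]; ring,
            show a + c * (-1) * w + 32 * c * η * K + T * κ = b + -(c * w) by rw [hb]; ring,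
            Real.exp_add b, Real.exp_add b, Real.cosh_eq]
          ring
        rw [e1]
        have e2 : Real.cosh (c * w) ≤ Real.exp (2 * c ^ 2) := by
          refine (Real.cosh_le_exp_half_sq _).trans (Real.exp_le_exp.2 ?_)
          have : w ^ 2 ≤ 4 := by
            rw [← sq_abs]
            nlinarith [abs_nonneg w]
          nlinarith [mul_le_mul_of_nonneg_left this (sq_nonneg c)]
        have e3 : Real.exp (a + (T + 1 : ℕ) * κ) = Real.exp b * Real.exp (2 * c ^ 2) := by
          rw [← Real.exp_add]
          congr 1
          rw [hb, hκ]
          push_cast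
          ring
        rw [e3]
        have := Real.exp_pos b
        gcongr
      have h3 := add_le_add h1 h2
      rw [← ENNReal.ofReal_add (Real.exp_pos _).le (Real.exp_pos _).le] at h3
      have h4 := h3.trans (ENNReal.ofReal_le_ofReal hcosh)
      rw [ENNReal.ofReal_mul (by norm_num), ENNReal.ofReal_ofNat] at h4
      calc _ ≤ 2⁻¹ * (2 * ENNReal.ofReal (Real.exp (a + (T + 1 : ℕ) * κ))) := by gcongr
        _ = _ := by
          rw [← mul_assoc, ENNReal.inv_mul_cancel (by norm_num) (by norm_num), one_mul]
    calc _ ≤ ∑ y, μ {y} * ENNReal.ofReal (Real.exp (a + (T + 1 : ℕ) * κ)) := by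
          conv_lhs => unfold signAvg
          gcongr with y _
          exact hpt y
      _ = _ := by rw [← Finset.sum_mul, sum_measure_singleton_univ, one_mul]

end Complexity

end PMC

/-! ### Concentration of empirical losses. -/

namespace PMC

open Matrix
open scoped ENNReal

section Concentration

variable {m n : ℕ} {s : Setting} {q : Params} {μ : Measure (Fin m × Fin n)}
  {Mstar : Matrix (Fin m) (Fin n) ℝ}

/-- Mean square deviation from `Mstar`. -/
noncomputable def sqRisk (μ : Measure (Fin m × Fin n)) (Mstar M : Matrix (Fin m) (Fin n) ℝ) : ℝ :=
  ∑ z, μ.real {z} * sqLoss Mstar M z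

theorem integral_sq_eq_sqRisk [IsProbabilityMeasure μ] (M : Matrix (Fin m) (Fin n) ℝ) :
    ∫ x, (M x.1 x.2 - Mstar x.1 x.2) ^ 2 ∂μ = sqRisk μ Mstar M := by
  rw [integral_fintype Integrable.of_finite]
  rfl

theorem sqLoss_nonneg (M : Matrix (Fin m) (Fin n) ℝ) (z : Fin m × Fin n) :
    0 ≤ sqLoss Mstar M z := sq_nonneg _

theorem sqRisk_nonneg (M : Matrix (Fin m) (Fin n) ℝ) : 0 ≤ sqRisk μ Mstar M :=
  Finset.sum_nonneg fun z _ => mul_nonneg measureReal_nonneg (sqLoss_nonneg M z)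

theorem sqLoss_le_four {M : Matrix (Fin m) (Fin n) ℝ} (hM : ∀ i j, |M i j| ≤ 1)
    (hMstar : ∀ i j, |Mstar i j| ≤ 1) (z : Fin m × Fin n) : sqLoss Mstar M z ≤ 4 := by
  have h1 := abs_le.1 (hM z.1 z.2)
  have h2 := abs_le.1 (hMstar z.1 z.2)
  unfold sqLoss
  nlinarith

theorem sqRisk_le_four [IsProbabilityMeasure μ] {M : Matrix (Fin m) (Fin n) ℝ}
    (hM : ∀ i j, |M i j| ≤ 1) (hMstar : ∀ i j, |Mstar i j| ≤ 1) : sqRisk μ Mstar M ≤ 4 := by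
  calc sqRisk μ Mstar M ≤ ∑ z, μ.real {z} * 4 :=
        Finset.sum_le_sum fun z _ =>
          mul_le_mul_of_nonneg_left (sqLoss_le_four hM hMstar z) measureReal_nonneg
    _ = 4 := by rw [← Finset.sum_mul, sum_measureReal_singleton_univ, one_mul]

theorem sum_measureReal_mul_sqRisk_sub_sqLoss [IsProbabilityMeasure μ]
    (M : Matrix (Fin m) (Fin n) ℝ) :
    ∑ z, μ.real {z} * (sqRisk μ Mstar M - sqLoss Mstar M z) = 0 := by
  simp only [mul_sub, Finset.sum_sub_distrib]
  rw [← Finset.sum_mul, sum_measureReal_singleton_univ, one_mul, sqRisk, sub_self]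

/-- The completions held at time `t` are determined before draw `t` is revealed, so their risk minus
loss is a martingale difference. -/
theorem dependsOnPrefix_oddState (s : Setting) (q : Params) (Mstar : Matrix (Fin m) (Fin n) ℝ)
    (t : ℕ) : DependsOnPrefix t fun a => oddState s q Mstar a t := by
  induction t with
  | zero => exact fun a b _ => rfl
  | succ t ih =>
    intro a b h
    have h1 : oddState s q Mstar a t = oddState s q Mstar b t :=
      ih a b fun r hr => h r (hr.trans t.lt_succ_self)
    simp only [oddState, h1, h t t.lt_succ_self]

variable {Ω : Type*} [MeasurableSpace Ω] {P : Measure Ω} {x : ℕ → Ω → Fin m × Fin n}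

/-- Uniform deviation of the empirical square loss over the max-norm class. -/
theorem measure_uniform_deviation_le [IsProbabilityMeasure P] [IsProbabilityMeasure μ]
    (hm : 1 ≤ m) (hn : 1 ≤ n) (hx : ∀ t, Measurable (x t)) (hind : iIndepFun x P)
    (hμ : ∀ t, P.map (x t) = μ) {K δ : ℝ} (hK : 0 < K) (hδ : 0 < δ) {T : ℕ} (hT : 1 ≤ T)
    (hMstar : Mstar ∈ maxClass m n K)
    (hsize : 256 * K * √(((m : ℝ) + n) * Real.log (4 * ((m : ℝ) + n)) * T) ≤ δ * T) :
    P {ω | ∃ M ∈ maxClass m n K,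
        T * (sqRisk μ Mstar M + δ) < ∑ t ∈ Finset.range T, sqLoss Mstar M (x t ω)} ≤
      ENNReal.ofReal (Real.exp (-(1 / 2048) * δ ^ 2 * T)) := by
  have hm' : (1 : ℝ) ≤ m := by exact_mod_cast hm
  have hn' : (1 : ℝ) ≤ n := by exact_mod_cast hn
  have hT' : (0 : ℝ) < T := by exact_mod_cast hT
  have : Nonempty (Fin m × Fin n) := ⟨(⟨0, hm⟩, ⟨0, hn⟩)⟩
  set Q : ℝ := ((m : ℝ) + n) * Real.log (4 * ((m : ℝ) + n)) with hQ
  have hQ0 : 0 < Q := mul_pos (by linarith) (Real.log_pos (by linarith))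
  set r : ℝ := δ / 512 with hr
  have hr0 : 0 < r := by positivity
  set w : Fin m × Fin n → Matrix (Fin m) (Fin n) ℝ → ℝ := fun y M => M y.1 y.2 - Mstar y.1 y.2
  have hw : ∀ y, ∀ M ∈ maxClass m n K, |w y M| ≤ 2 := fun y M hM => by
    have h1 := abs_le_one_of_mem_maxClass hM y.1 y.2
    have h2 := abs_le_one_of_mem_maxClass hMstar y.1 y.2
    exact (abs_sub _ _).trans (by linarith)
  set φ : Fin m × Fin n → Matrix (Fin m) (Fin n) ℝ → ℝ :=
    fun y M => r * (w y M ^ 2 - ∑ z, μ.real {z} * w z M ^ 2) with hφ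
  obtain ⟨lift, hlift⟩ : ∃ lift : Matrix (Fin m) (Fin n) ℝ → LiftMat m n,
      ∀ M ∈ maxClass m n K, lift M ∈ liftSet m n K ∧ fst (lift M) = M ∧ snd (lift M) = Mstar := by
    choose! lift hlift using fun M (hM : M ∈ maxClass m n K) => exists_lift hK hM hMstar
    exact ⟨lift, hlift⟩
  set R : ℝ := √(Q * T) with hR
  have hR0 : 0 < R := Real.sqrt_pos.2 (by positivity)
  have hRR : R ^ 2 = Q * T := Real.sq_sqrt (by positivity)
  -- The learning rate `R / (4T)` equalizes the initial divergence and the second-order terms, each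
  -- contributing `δ K R / 8` to the exponent.
  have hη : 0 < R / (4 * T) := by positivity
  have hstep := drawAvg_iterate_le (μ := μ) (drawAvg_supExp_le hr0.le hw) T
  have hmw := signAvg_iterate_supExp_le hK (μ := μ) (c := 8 * r) (by positivity) hη hlift T
    ((K / 2) • 1) (half_smul_one_mem_liftSet hK) (PosDef.one.smul (half_pos hK))
    (8 * r / (2 * (R / (4 * T))) * (4 * K * ((m : ℝ) + n) * Real.log (4 * ((m : ℝ) + n)))) 0
    (fun M hM => by
      have h1 := relEntropy_init_le hK hm hn (hlift M hM).1
      have h2 : 0 ≤ 8 * r / (2 * (R / (4 * T))) := by positivity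
      have h3 := mul_le_mul_of_nonneg_left h1 h2
      simp only [Pi.zero_apply]
      linarith)
  have hint : ∫⁻ ω, supExp (maxClass m n K) (0 + ∑ t ∈ Finset.range T, φ (x t ω)) ∂P ≤
      ENNReal.ofReal (Real.exp (3 / 2048 * δ ^ 2 * T)) := by
    rw [lintegral_iterate hx hind hμ φ T (supExp (maxClass m n K)) 0]
    refine (hstep 0).trans (hmw.trans (ENNReal.ofReal_le_ofReal (Real.exp_le_exp.2 ?_)))
    have e : 8 * r / (2 * (R / (4 * T))) * (4 * K * ((m : ℝ) + n) *
        Real.log (4 * ((m : ℝ) + n))) + T * (32 * (8 * r) * (R / (4 * T)) * K + 2 * (8 * r) ^ 2) =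
        δ / 4 * K * R + 2 * (δ / 64) ^ 2 * T := by
      rw [mul_assoc (4 * K), ← hQ, hr]
      have : Q = R ^ 2 / T := by rw [hRR]; field_simp
      rw [this]
      field_simp
      ring
    -- By `hsize` the first term is at most `(2/2048) δ² T`; the second equals `(1/2048) δ² T`.
    rw [e]
    nlinarith [mul_le_mul_of_nonneg_left hsize hδ.le]
  have hmeas : Measurable fun ω =>
      supExp (maxClass m n K) (0 + ∑ t ∈ Finset.range T, φ (x t ω)) := by
    refine DependsOnPrefix.measurable (t := T)
      (g := fun a => supExp (maxClass m n K) (0 + ∑ t ∈ Finset.range T, φ (a t))) ?_ hx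
    intro a b h
    have h1 : ∑ t ∈ Finset.range T, φ (a t) = ∑ t ∈ Finset.range T, φ (b t) :=
      Finset.sum_congr rfl fun t ht => by rw [h t (Finset.mem_range.1 ht)]
    simp only [h1]
  -- On the bad event the exponent exceeds `r δ T = (4/2048) δ² T`, one unit more than the moment
  -- bound allows.
  have h := measure_le_ofReal_exp (P := P) hmeas hint (v := 4 / 2048 * δ ^ 2 * T)
    (E := {ω | ∃ M ∈ maxClass m n K,
      T * (sqRisk μ Mstar M + δ) < ∑ t ∈ Finset.range T, sqLoss Mstar M (x t ω)}) (by
    rintro ω ⟨M, hM, hlt⟩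
    refine le_trans (ENNReal.ofReal_le_ofReal (Real.exp_le_exp.2 ?_))
      (le_supExp (0 + ∑ t ∈ Finset.range T, φ (x t ω)) hM)
    have e : (0 + ∑ t ∈ Finset.range T, φ (x t ω)) M =
        r * (∑ t ∈ Finset.range T, sqLoss Mstar M (x t ω) - T * sqRisk μ Mstar M) := by
      simp only [zero_add, Finset.sum_apply, hφ, ← Finset.mul_sum, Finset.sum_sub_distrib]
      simp [sqLoss, sqRisk, w]
    rw [e]
    have h1 : δ * T ≤ ∑ t ∈ Finset.range T, sqLoss Mstar M (x t ω) - T * sqRisk μ Mstar M := by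
      linarith
    have h2 := mul_le_mul_of_nonneg_left h1 hr0.le
    rw [hr] at h2 ⊢
    linarith)
  convert h using 3
  ring

/-- Deviation of the losses of the completions played from their conditional means. -/
theorem measure_played_deviation_le [IsProbabilityMeasure P] [IsProbabilityMeasure μ]
    (hm : 1 ≤ m) (hn : 1 ≤ n) (hx : ∀ t, Measurable (x t)) (hind : iIndepFun x P)
    (hμ : ∀ t, P.map (x t) = μ) (hT : 1 ≤ q.T) (hK : 0 < q.K) (hα : 0 ≤ q.α) {δ : ℝ}
    (hδ : 0 < δ) (hδ1 : δ ≤ 1) (hMstar : Mstar ∈ maxClass m n q.K) :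
    P {ω | ∑ t ∈ Finset.range q.T,
        (sqLoss Mstar (fst (oddState s q Mstar (fun r => x r ω) t).2) (x t ω) +
          sqLoss Mstar (snd (oddState s q Mstar (fun r => x r ω) t).2) (x t ω)) + δ * q.T <
      ∑ t ∈ Finset.range q.T,
        (sqRisk μ Mstar (fst (oddState s q Mstar (fun r => x r ω) t).2) +
          sqRisk μ Mstar (snd (oddState s q Mstar (fun r => x r ω) t).2))} ≤
      ENNReal.ofReal (Real.exp (-(1 / 2048) * δ ^ 2 * q.T)) := by
  have : Nonempty (Fin m × Fin n) := ⟨(⟨0, hm⟩, ⟨0, hn⟩)⟩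
  set d : (ℕ → Fin m × Fin n) → ℕ → Fin m × Fin n → ℝ := fun a t y =>
    (sqRisk μ Mstar (fst (oddState s q Mstar a t).2) -
      sqLoss Mstar (fst (oddState s q Mstar a t).2) y) +
    (sqRisk μ Mstar (snd (oddState s q Mstar a t).2) -
      sqLoss Mstar (snd (oddState s q Mstar a t).2) y) with hd
  have hpre : ∀ t, DependsOnPrefix t fun a => d a t := by
    intro t a b h
    have h1 : oddState s q Mstar a t = oddState s q Mstar b t :=
      dependsOnPrefix_oddState s q Mstar t a b h
    simp only [hd, h1]
  have hmean : ∀ a t, ∑ y, μ.real {y} * d a t y = 0 := by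
    intro a t
    simp only [hd, mul_add, Finset.sum_add_distrib]
    rw [sum_measureReal_mul_sqRisk_sub_sqLoss, sum_measureReal_mul_sqRisk_sub_sqLoss, add_zero]
  have hbound : ∀ a t y, |d a t y| ≤ 8 := by
    intro a t y
    have h0 := (oddState_spec (s := s) (Mstar := Mstar) (x := a) hm hn hT hK hα t).2.1
    have h1 := abs_fst_le h0
    have h2 := abs_snd_le h0
    have h3 := abs_le_one_of_mem_maxClass hMstar
    have e1 := sqLoss_nonneg (Mstar := Mstar) (fst (oddState s q Mstar a t).2) y
    have e2 := sqLoss_nonneg (Mstar := Mstar) (snd (oddState s q Mstar a t).2) y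
    have e3 := sqRisk_nonneg (μ := μ) (Mstar := Mstar) (fst (oddState s q Mstar a t).2)
    have e4 := sqRisk_nonneg (μ := μ) (Mstar := Mstar) (snd (oddState s q Mstar a t).2)
    have e5 := sqLoss_le_four h1 h3 y
    have e6 := sqLoss_le_four h2 h3 y
    have e7 := sqRisk_le_four (μ := μ) h1 h3
    have e8 := sqRisk_le_four (μ := μ) h2 h3
    rw [abs_le]
    constructor <;> simp only [hd] <;> linarith
  -- With `b = 8` the rate `δ / 128` gives `r b = δ / 16`, so the moment exponent `δ² T / 256` is
  -- half of the threshold `δ² T / 128`.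
  have hint := lintegral_exp_martingale_le (P := P) hx hind hμ hpre hmean hbound
    (r := δ / 128) (by positivity) (by linarith) q.T
  have hmeas : Measurable fun ω => ENNReal.ofReal (Real.exp
      (δ / 128 * ∑ t ∈ Finset.range q.T, d (fun s => x s ω) t (x t ω))) := by
    refine DependsOnPrefix.measurable (t := q.T) (g := fun a => ENNReal.ofReal (Real.exp
      (δ / 128 * ∑ t ∈ Finset.range q.T, d a t (a t)))) ?_ hx
    intro a b h
    have h1 : ∑ t ∈ Finset.range q.T, d a t (a t) = ∑ t ∈ Finset.range q.T, d b t (b t) := by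
      refine Finset.sum_congr rfl fun t ht => ?_
      have htT := Finset.mem_range.1 ht
      rw [h t htT]
      exact congrFun (hpre t a b fun r hr => h r (hr.trans htT)) _
    simp only [h1]
  refine (measure_le_ofReal_exp (P := P) hmeas hint (v := δ ^ 2 * q.T / 128) ?_).trans
    (ENNReal.ofReal_le_ofReal (Real.exp_le_exp.2 ?_))
  · intro ω hω
    refine ENNReal.ofReal_le_ofReal (Real.exp_le_exp.2 ?_)
    have h1 : δ * q.T ≤ ∑ t ∈ Finset.range q.T, d (fun s => x s ω) t (x t ω) := by
      have h2 := Set.mem_ofPred_eq.mp hω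
      simp only [hd, Finset.sum_add_distrib, Finset.sum_sub_distrib] at h2 ⊢
      linarith
    nlinarith [mul_le_mul_of_nonneg_left h1 hδ.le]
  · nlinarith [mul_nonneg (sq_nonneg δ) (Nat.cast_nonneg (α := ℝ) q.T)]

/-- Realizations along which empirical and population losses agree up to `δ`. -/
def Typical (s : Setting) (q : Params) (μ : Measure (Fin m × Fin n))
    (Mstar : Matrix (Fin m) (Fin n) ℝ) (δ : ℝ) (a : ℕ → Fin m × Fin n) : Prop :=
  (∑ t ∈ Finset.range q.T, (sqRisk μ Mstar (fst (oddState s q Mstar a t).2) +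
      sqRisk μ Mstar (snd (oddState s q Mstar a t).2)) ≤
    ∑ t ∈ Finset.range q.T, (sqLoss Mstar (fst (oddState s q Mstar a t).2) (a t) +
      sqLoss Mstar (snd (oddState s q Mstar a t).2) (a t)) + δ * q.T) ∧
  ∀ M ∈ maxClass m n q.K,
    ∑ t ∈ Finset.range q.T, sqLoss Mstar M (a t) ≤ q.T * (sqRisk μ Mstar M + δ)

theorem one_sub_le_measureReal_of_compl_subset [IsProbabilityMeasure P] {A B G : Set Ω} {ε : ℝ}
    (hε : 0 ≤ ε) (hA : P A ≤ ENNReal.ofReal ε) (hB : P B ≤ ENNReal.ofReal ε)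
    (h : ∀ ω, ω ∉ A → ω ∉ B → ω ∈ G) : 1 - 2 * ε ≤ P.real G := by
  have h1 : (1 : ℝ) = P.real Set.univ := by simp
  have h2 : Set.univ ⊆ A ∪ B ∪ G := fun ω _ => by
    by_cases hA : ω ∈ A
    · exact Or.inl (Or.inl hA)
    by_cases hB : ω ∈ B
    · exact Or.inl (Or.inr hB)
    exact Or.inr (h ω hA hB)
  have h3 := (measureReal_mono (μ := P) h2).trans (measureReal_union_le (μ := P) (A ∪ B) G)
  have h4 := measureReal_union_le (μ := P) A B
  have h5 : P.real A ≤ ε := ENNReal.toReal_le_of_le_ofReal hε hA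
  have h6 : P.real B ≤ ε := ENNReal.toReal_le_of_le_ofReal hε hB
  linarith

theorem one_sub_le_measureReal_typical [IsProbabilityMeasure P] [IsProbabilityMeasure μ]
    (hm : 1 ≤ m) (hn : 1 ≤ n) (hx : ∀ t, Measurable (x t)) (hind : iIndepFun x P)
    (hμ : ∀ t, P.map (x t) = μ) (hT : 1 ≤ q.T) (hK : 0 < q.K) (hα : 0 ≤ q.α) {δ : ℝ}
    (hδ : 0 < δ) (hδ1 : δ ≤ 1) (hMstar : Mstar ∈ maxClass m n q.K)
    (hsize : 256 * q.K * √(((m : ℝ) + n) * Real.log (4 * ((m : ℝ) + n)) * q.T) ≤ δ * q.T) :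
    1 - 2 * Real.exp (-(1 / 2048) * δ ^ 2 * q.T) ≤
      P.real {ω | Typical s q μ Mstar δ fun t => x t ω} := by
  refine one_sub_le_measureReal_of_compl_subset (Real.exp_pos _).le
    (measure_played_deviation_le (s := s) hm hn hx hind hμ hT hK hα hδ hδ1 hMstar)
    (measure_uniform_deviation_le hm hn hx hind hμ hK hδ hT hMstar hsize) fun ω h1 h2 => ?_
  refine ⟨not_lt.1 h1, fun M hM => ?_⟩
  by_contra h
  exact h2 ⟨M, hM, not_le.1 h⟩

end Concentration

end PMC

/-! ### Combining the two regrets on typical realizations. -/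

namespace PMC

open Matrix
open scoped ENNReal

section Output

variable {m n : ℕ} {s : Setting} {q : Params} {μ : Measure (Fin m × Fin n)}
  {Mstar : Matrix (Fin m) (Fin n) ℝ} {a : ℕ → Fin m × Fin n}

theorem coverage_nonneg {C : Matrix (Fin m) (Fin n) ℝ} (hC : C ∈ confidenceSet m n s) :
    0 ≤ coverage s C := by
  cases s with
  | simplex => exact entropy_nonneg hC
  | cube =>
    rw [coverage, l1Norm_eq_sum fun i j => (hC i j).1]
    exact Finset.sum_nonneg fun i _ => Finset.sum_nonneg fun j _ => (hC i j).1

theorem concaveOn_coverage (m n : ℕ) (s : Setting) :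
    ConcaveOn ℝ (confidenceSet m n s) (coverage s) := by
  refine ⟨convex_confidenceSet s, fun A hA B hB u v hu hv huv => ?_⟩
  have hAB := convex_confidenceSet s hA hB hu hv huv
  cases s with
  | simplex =>
    simp only [coverage, entropy, smul_eq_mul, Finset.mul_sum, ← Finset.sum_add_distrib]
    exact Finset.sum_le_sum fun i _ => Finset.sum_le_sum fun j _ =>
      Real.concaveOn_negMulLog.2 (hA.1 i j) (hB.1 i j) hu hv huv
  | cube =>
    simp only [coverage]
    rw [l1Norm_eq_sum fun i j => (hA i j).1, l1Norm_eq_sum fun i j => (hB i j).1,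
      l1Norm_eq_sum fun i j => (hAB i j).1]
    simp [Finset.mul_sum, Finset.sum_add_distrib]

theorem oddOutput_mem_confidenceSet (hm : 1 ≤ m) (hn : 1 ≤ n) (hT : 1 ≤ q.T) (hK : 0 < q.K)
    (hα : 0 ≤ q.α) : oddOutput s q Mstar a ∈ confidenceSet m n s := by
  have hT' : (0 : ℝ) < q.T := by exact_mod_cast hT
  rw [oddOutput, Finset.smul_sum]
  refine (convex_confidenceSet s).sum_mem (fun t _ => by positivity) ?_ fun t _ =>
    projectionSet_subset s (oddState_spec hm hn hT hK hα t).1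
  rw [Finset.sum_const, Finset.card_range, nsmul_eq_mul]
  field_simp

theorem sum_coverage_le (hm : 1 ≤ m) (hn : 1 ≤ n) (hT : 1 ≤ q.T) (hK : 0 < q.K)
    (hα : 0 ≤ q.α) :
    ∑ t ∈ Finset.range q.T, coverage s (oddState s q Mstar a t).1 ≤
      q.T * coverage s (oddOutput s q Mstar a) := by
  have hT' : (0 : ℝ) < q.T := by exact_mod_cast hT
  have h := (concaveOn_coverage m n s).le_map_sum (t := Finset.range q.T)
    (w := fun _ => 1 / (q.T : ℝ)) (p := fun t => (oddState s q Mstar a t).1)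
    (fun t _ => by positivity)
    (by rw [Finset.sum_const, Finset.card_range, nsmul_eq_mul]; field_simp)
    fun t _ => projectionSet_subset s (oddState_spec hm hn hT hK hα t).1
  rw [← Finset.smul_sum, ← Finset.smul_sum, smul_eq_mul] at h
  have h2 := mul_le_mul_of_nonneg_left h hT'.le
  rwa [← mul_assoc, mul_one_div_cancel hT'.ne', one_mul] at h2

theorem pair_sum_left {ι : Type*} (S : Finset ι) (A : ι → Matrix (Fin m) (Fin n) ℝ)
    (B : Matrix (Fin m) (Fin n) ℝ) : pair (∑ t ∈ S, A t) B = ∑ t ∈ S, pair (A t) B := by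
  classical
  induction S using Finset.induction_on with
  | empty => simp [pair]
  | insert t S ht ih => rw [Finset.sum_insert ht, Finset.sum_insert ht, pair_add_left, ih]

theorem sum_disagreement_eq (hT : 1 ≤ q.T) (M₁ M₂ : Matrix (Fin m) (Fin n) ℝ) :
    ∑ t ∈ Finset.range q.T, disagreement (oddState s q Mstar a t).1 M₁ M₂ =
      q.T * disagreement (oddOutput s q Mstar a) M₁ M₂ := by
  have hT' : (0 : ℝ) < q.T := by exact_mod_cast hT
  simp only [disagreement_eq_pair, oddOutput]
  rw [pair_smul_left, pair_sum_left]
  field_simp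

theorem abs_disagreement_le {C M₁ M₂ : Matrix (Fin m) (Fin n) ℝ} (h₁ : ∀ i j, |M₁ i j| ≤ 1)
    (h₂ : ∀ i j, |M₂ i j| ≤ 1) : |disagreement C M₁ M₂| ≤ l1Norm C * 2 := by
  rw [disagreement_eq_pair]
  exact abs_pair_le fun i j => (abs_sub _ _).trans (by linarith [h₁ i j, h₂ i j])

/-- Disagreement under a multiple of the sampling distribution. -/
theorem disagreement_le_sqRisk [IsProbabilityMeasure μ] {C : Matrix (Fin m) (Fin n) ℝ} {b ρ θ : ℝ}
    (hC : ∀ i j, C i j = b * μ.real {(i, j)}) (hb : 0 ≤ b) (hbρ : b ≤ ρ) (hθ : 0 < θ)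
    (M₁ M₂ : Matrix (Fin m) (Fin n) ℝ) :
    disagreement C M₁ M₂ ≤ θ * (sqRisk μ Mstar M₁ + sqRisk μ Mstar M₂) + ρ ^ 2 / (2 * θ) := by
  -- Arithmetic-geometric means; this turns linear disagreement under `μ` into the quadratic penalty
  -- of the completion player.
  have hpt : ∀ w : ℝ, b * |w| ≤ θ * w ^ 2 + ρ ^ 2 / (4 * θ) := by
    intro w
    have h1 : b * |w| ≤ ρ * |w| := mul_le_mul_of_nonneg_right hbρ (abs_nonneg w)
    have h2 : θ * w ^ 2 + ρ ^ 2 / (4 * θ) - ρ * |w| = (2 * θ * |w| - ρ) ^ 2 / (4 * θ) := by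
      rw [← sq_abs w]
      field_simp
      ring
    have h3 : 0 ≤ (2 * θ * |w| - ρ) ^ 2 / (4 * θ) := by positivity
    linarith
  calc disagreement C M₁ M₂
      = ∑ z, μ.real {z} * (b * (M₁ z.1 z.2 - M₂ z.1 z.2)) := by
        rw [Fintype.sum_prod_type, disagreement]
        exact Finset.sum_congr rfl fun i _ => Finset.sum_congr rfl fun j _ => by
          rw [hC]; ring
    _ ≤ ∑ z, μ.real {z} *
          (θ * (sqLoss Mstar M₁ z + sqLoss Mstar M₂ z) + ρ ^ 2 / (2 * θ)) := by
        refine Finset.sum_le_sum fun z _ => mul_le_mul_of_nonneg_left ?_ measureReal_nonneg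
        have h1 := hpt (M₁ z.1 z.2 - Mstar z.1 z.2)
        have h2 := hpt (M₂ z.1 z.2 - Mstar z.1 z.2)
        have h3 := mul_le_mul_of_nonneg_left (le_abs_self (M₁ z.1 z.2 - Mstar z.1 z.2)) hb
        have h4 := mul_le_mul_of_nonneg_left (neg_abs_le (M₂ z.1 z.2 - Mstar z.1 z.2)) hb
        have h5 : ρ ^ 2 / (4 * θ) + ρ ^ 2 / (4 * θ) = ρ ^ 2 / (2 * θ) := by
          field_simp
          ring
        unfold sqLoss
        linarith
    _ = (∑ z, μ.real {z}) * (ρ ^ 2 / (2 * θ)) +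
          θ * (sqRisk μ Mstar M₁ + sqRisk μ Mstar M₂) := by
        simp only [sqRisk, Finset.sum_mul, ← Finset.sum_add_distrib, Finset.mul_sum]
        exact Finset.sum_congr rfl fun z _ => by ring
    _ = _ := by rw [sum_measureReal_singleton_univ]; ring

theorem exists_mem_projectionSet_near (hm : 1 ≤ m) (hn : 1 ≤ n) {T : ℕ} (hT : 1 ≤ T)
    {C : Matrix (Fin m) (Fin n) ℝ} (hC : C ∈ confidenceSet m n s) :
    ∃ Z ∈ projectionSet m n T s, coverage s C ≤ coverage s Z ∧ l1Norm (Z - C) ≤ 2 / T ^ 2 := by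
  cases s with
  | simplex => exact exists_mixture_mem_projectionSet hm hn hT hC
  | cube =>
    refine ⟨C, hC, le_rfl, ?_⟩
    simp only [sub_self, l1Norm, Matrix.zero_apply, abs_zero, Finset.sum_const_zero]
    positivity

/-- Coverage of the output in terms of the disagreement of the completions played. -/
theorem coverage_add_sum_disagreement_le (hm : 1 ≤ m) (hn : 1 ≤ n)
    (hmn : s = .simplex → 2 ≤ m * n) (hT : 1 ≤ q.T) (hK : 0 < q.K) (hα : 0 ≤ q.α)
    {C : Matrix (Fin m) (Fin n) ℝ} (hC : C ∈ confidenceSet m n s) :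
    q.T * coverage s C + q.α * ∑ t ∈ Finset.range q.T, disagreement (oddState s q Mstar a t).1
        (fst (oddState s q Mstar a t).2) (snd (oddState s q Mstar a t).2) ≤
      q.T * coverage s (oddOutput s q Mstar a) +
        q.α * ∑ t ∈ Finset.range q.T, disagreement C
          (fst (oddState s q Mstar a t).2) (snd (oddState s q Mstar a t).2) +
        4 * q.α / q.T + coverageRegret m n q.T q.α s := by
  have hT' : (0 : ℝ) < q.T := by exact_mod_cast hT
  obtain ⟨Z, hZ, hCZ, hnear⟩ := exists_mem_projectionSet_near (T := q.T) hm hn hT hC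
  have h1 := coverage_regret (Mstar := Mstar) (x := a) hm hn hmn hT hK hα hZ
  have h2 := sum_coverage_le (s := s) (Mstar := Mstar) (a := a) hm hn hT hK hα
  have h3 : ∑ t ∈ Finset.range q.T, disagreement Z
      (fst (oddState s q Mstar a t).2) (snd (oddState s q Mstar a t).2) ≤
      ∑ t ∈ Finset.range q.T, disagreement C
      (fst (oddState s q Mstar a t).2) (snd (oddState s q Mstar a t).2) + 4 / q.T := by
    have h4 : ∀ t ∈ Finset.range q.T, disagreement Z
        (fst (oddState s q Mstar a t).2) (snd (oddState s q Mstar a t).2) ≤ disagreement C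
        (fst (oddState s q Mstar a t).2) (snd (oddState s q Mstar a t).2) + 4 / q.T ^ 2 := by
      intro t _
      have h5 := (oddState_spec (s := s) (Mstar := Mstar) (x := a) hm hn hT hK hα t).2.1
      have h6 := (abs_le.1 (abs_disagreement_le (C := Z - C) (abs_fst_le h5) (abs_snd_le h5))).2
      rw [disagreement_eq_pair, pair_sub_left] at h6
      simp only [disagreement_eq_pair]
      have h7 : 2 / (q.T : ℝ) ^ 2 * 2 = 4 / q.T ^ 2 := by ring
      linarith
    refine (Finset.sum_le_sum h4).trans ?_
    rw [Finset.sum_add_distrib, Finset.sum_const, Finset.card_range, nsmul_eq_mul]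
    apply le_of_eq
    congr 1
    field_simp
  have h4 := mul_le_mul_of_nonneg_left h3 hα
  have h5 := mul_le_mul_of_nonneg_left hCZ hT'.le
  simp only [Finset.sum_sub_distrib, ← Finset.mul_sum, Finset.sum_const, Finset.card_range,
    nsmul_eq_mul] at h1
  have h6 : q.α * (4 / q.T) = 4 * q.α / q.T := by ring
  linarith

/-- The error made by the algorithm along typical realizations, multiplied by `T`. -/
noncomputable def typicalError (m n : ℕ) (s : Setting) (q : Params) (δ : ℝ) : ℝ :=
  q.T * (q.α * (5 * (q.θ * δ) + massBound m n s ^ 2 / (2 * q.θ))) + 4 * q.α / q.T +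
    q.α * (20 * q.K * (1 + 8 * q.θ) *
      √(((m : ℝ) + n) * Real.log (4 * ((m : ℝ) + n)) * q.T)) +
    coverageRegret m n q.T q.α s

/-- The two regret inequalities are added. The empirical losses `f` of the completions played enter
with weight `α θ` from the coverage side and `-α θ` from the completion side, and cancel. -/
theorem oddOutput_of_typical [IsProbabilityMeasure μ] (hm : 1 ≤ m) (hn : 1 ≤ n)
    (hmn : s = .simplex → 2 ≤ m * n) (hT : 1 ≤ q.T) (hK : 0 < q.K) (hα : 0 ≤ q.α)
    (hθ : 0 < q.θ) (hρ : massBound m n s ≤ 1 + 4 * q.θ) (hMstar : Mstar ∈ maxClass m n q.K)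
    {C : Matrix (Fin m) (Fin n) ℝ} (hC : C ∈ confidenceSet m n s) {b : ℝ}
    (hCμ : ∀ i j, C i j = b * μ.real {(i, j)}) (hb : 0 ≤ b) (hbρ : b ≤ massBound m n s)
    {δ : ℝ} (hδ : 0 < δ) (h : Typical s q μ Mstar δ a) :
    q.T * coverage s C ≤ q.T * coverage s (oddOutput s q Mstar a) + typicalError m n s q δ ∧
      ∀ M₁ ∈ versionSpace μ Mstar q.K δ, ∀ M₂ ∈ versionSpace μ Mstar q.K δ,
        q.T * (q.α * disagreement (oddOutput s q Mstar a) M₁ M₂) ≤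
          q.T * coverage s (oddOutput s q Mstar a) + typicalError m n s q δ := by
  have hT' : (0 : ℝ) < q.T := by exact_mod_cast hT
  have h1 := coverage_add_sum_disagreement_le (Mstar := Mstar) (a := a) hm hn hmn hT hK hα hC
  have h2 : ∑ t ∈ Finset.range q.T, disagreement C
        (fst (oddState s q Mstar a t).2) (snd (oddState s q Mstar a t).2) ≤
      q.θ * ∑ t ∈ Finset.range q.T, (sqRisk μ Mstar (fst (oddState s q Mstar a t).2) +
        sqRisk μ Mstar (snd (oddState s q Mstar a t).2)) +
        q.T * (massBound m n s ^ 2 / (2 * q.θ)) := by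
    refine (Finset.sum_le_sum fun t _ =>
      disagreement_le_sqRisk (Mstar := Mstar) hCμ hb hbρ hθ _ _).trans_eq ?_
    rw [Finset.sum_add_distrib, Finset.sum_const, Finset.card_range, nsmul_eq_mul, Finset.mul_sum]
  have h3 := mul_le_mul_of_nonneg_left (h2.trans
    (add_le_add_left (mul_le_mul_of_nonneg_left h.1 hθ.le) _)) hα
  have hreg : ∀ M₁ ∈ maxClass m n q.K, ∀ M₂ ∈ maxClass m n q.K, _ := fun M₁ h₁ M₂ h₂ =>
    completion_regret (s := s) (x := a) hm hn hT hK hα hθ.le hρ hMstar h₁ h₂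
  simp only [completionReward, Finset.sum_sub_distrib, ← Finset.mul_sum] at hreg
  set G := ∑ t ∈ Finset.range q.T, disagreement (oddState s q Mstar a t).1
    (fst (oddState s q Mstar a t).2) (snd (oddState s q Mstar a t).2)
  set f := ∑ t ∈ Finset.range q.T, (sqLoss Mstar (fst (oddState s q Mstar a t).2) (a t) +
      sqLoss Mstar (snd (oddState s q Mstar a t).2) (a t))
  have hθδ : 0 ≤ q.T * (q.α * (q.θ * δ)) := by positivity
  constructor
  -- The pair `(Mstar, Mstar)` has reward zero, so `G` is at least `θ f` minus the regret.
  · have h4 := mul_le_mul_of_nonneg_left (hreg Mstar hMstar Mstar hMstar) hα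
    simp only [sqLoss, disagreement, sub_self, mul_zero, Finset.sum_const_zero, zero_sub,
      ne_eq, OfNat.ofNat_ne_zero, not_false_eq_true, zero_pow, add_zero] at h4
    unfold typicalError
    linarith
  · intro M₁ h₁ M₂ h₂
    have h4 := mul_le_mul_of_nonneg_left (hreg M₁ h₁.1 M₂ h₂.1) hα
    rw [sum_disagreement_eq hT] at h4
    -- One `δ` is the radius of the version space, the other the uniform deviation. Two completions
    -- give `4 θ δ`; the deviation of the completions played brings the total to `5 θ δ`.
    have hver : ∀ M ∈ versionSpace μ Mstar q.K δ,
        ∑ t ∈ Finset.range q.T, sqLoss Mstar M (a t) ≤ 2 * (q.T * δ) := by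
      intro M hM
      have h5 := h.2 M hM.1
      have h6 := hM.2
      rw [integral_sq_eq_sqRisk] at h6
      nlinarith [mul_le_mul_of_nonneg_left h6 hT'.le]
    have h5 : ∑ t ∈ Finset.range q.T, (sqLoss Mstar M₁ (a t) + sqLoss Mstar M₂ (a t)) ≤
        4 * (q.T * δ) := by
      rw [Finset.sum_add_distrib]
      linarith [hver M₁ h₁, hver M₂ h₂]
    have h6 := mul_le_mul_of_nonneg_left (mul_le_mul_of_nonneg_left h5 hθ.le) hα
    have h7 := mul_nonneg hT'.le (coverage_nonneg hC)
    unfold typicalError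
    linarith

end Output

end PMC

/-! ### Numerical rates. -/

namespace PMC

open Matrix
open scoped ENNReal

section Rates

variable {m n : ℕ} {s : Setting} {q : Params}

theorem one_le_massBound (hm : 1 ≤ m) (s : Setting) : 1 ≤ massBound m n s := by
  have hm' : (1 : ℝ) ≤ m := by exact_mod_cast hm
  have hn' : (0 : ℝ) ≤ n := n.cast_nonneg
  cases s with
  | simplex => exact le_rfl
  | cube => exact Real.one_le_sqrt.2 (by linarith)

theorem coverageRegret_le (hm : 1 ≤ m) (hn : 1 ≤ n) {T : ℕ} (hT : 1 ≤ T)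
    (hmnT : (m : ℝ) * n ≤ (T : ℝ) ^ 4) {α : ℝ} (hαT : α ≤ (T : ℝ) ^ (1 / 12 : ℝ)) (s : Setting) :
    coverageRegret m n T α s ≤ 600 * massBound m n s * (T * (T : ℝ) ^ (-(1 / 12) : ℝ)) := by
  have hm' : (1 : ℝ) ≤ m := by exact_mod_cast hm
  have hn' : (1 : ℝ) ≤ n := by exact_mod_cast hn
  have hT' : (1 : ℝ) ≤ T := by exact_mod_cast hT
  have hT0 : (0 : ℝ) ≤ T := by linarith
  -- All exponents become integers in terms of `u`. Logarithms are absorbed by `log T ≤ (24/5) u⁵`,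
  -- and the budget is `T · T^{-1/12} = u²²`; the simplex attains it as `u⁵ · u¹⁷`.
  set u : ℝ := (T : ℝ) ^ (1 / 24 : ℝ) with hu
  have hu1 : 1 ≤ u := Real.one_le_rpow hT' (by norm_num)
  have hpow : ∀ k : ℕ, u ^ k = (T : ℝ) ^ ((k : ℝ) / 24) := by
    intro k
    rw [hu, ← Real.rpow_natCast, ← Real.rpow_mul hT0]
    congr 1
    ring
  have h24 : (T : ℝ) = u ^ 24 := by rw [hpow]; norm_num
  have h2 : (T : ℝ) ^ (1 / 12 : ℝ) = u ^ 2 := by rw [hpow]; norm_num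
  have h22 : T * (T : ℝ) ^ (-(1 / 12) : ℝ) = u ^ 22 := by
    rw [hpow, ← Real.rpow_one_add' hT0 (by norm_num)]
    norm_num
  have h12 : √(T : ℝ) = u ^ 12 := by
    rw [h24, show u ^ 24 = (u ^ 12) ^ 2 by ring, Real.sqrt_sq (by positivity)]
  have hlog : Real.log T ≤ 24 / 5 * u ^ 5 := by
    have h := Real.log_le_rpow_div hT0 (by norm_num : (0 : ℝ) < 5 / 24)
    have e : (T : ℝ) ^ (5 / 24 : ℝ) = u ^ 5 := by rw [hpow]; norm_num
    rw [e] at h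
    linarith
  have hmono : ∀ {j k : ℕ}, j ≤ k → u ^ j ≤ u ^ k := fun h => pow_le_pow_right₀ hu1 h
  rw [h22]
  rw [h2] at hαT
  cases s with
  | simplex =>
    simp only [coverageRegret, massBound, truncation]
    have hlmn : Real.log ((m : ℝ) * n) ≤ 4 * Real.log T := by
      have h := Real.log_le_log (by positivity) hmnT
      rwa [Real.log_pow] at h
    have hlmnT : Real.log ((m : ℝ) * n * T) ≤ 5 * Real.log T := by
      rw [Real.log_mul (by positivity) (by positivity)]
      linarith
    have hs : √(T * Real.log ((m : ℝ) * n)) ≤ 5 * u ^ 17 := by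
      refine Real.sqrt_le_iff.2 ⟨by positivity, ?_⟩
      have h3 : Real.log ((m : ℝ) * n) ≤ 25 * u ^ 10 := by
        have := hmono (show 5 ≤ 10 by norm_num)
        have : 0 ≤ u ^ 10 := by positivity
        linarith
      calc T * Real.log ((m : ℝ) * n) ≤ T * (25 * u ^ 10) := by gcongr
        _ = _ := by rw [h24]; ring
    have hf : 1 + 2 * Real.log ((m : ℝ) * n * T) + 2 * α ≤ 51 * u ^ 5 := by
      have e1 := hmono (show 2 ≤ 5 by norm_num)
      have e2 := hmono (show 0 ≤ 5 by norm_num)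
      rw [pow_zero] at e2
      linarith
    calc 2 * (1 + 2 * Real.log ((m : ℝ) * n * T) + 2 * α) * √(T * Real.log ((m : ℝ) * n))
        ≤ 2 * (51 * u ^ 5) * √(T * Real.log ((m : ℝ) * n)) := by gcongr
      _ ≤ 2 * (51 * u ^ 5) * (5 * u ^ 17) := by gcongr
      _ = 510 * u ^ 22 := by ring
      _ ≤ _ := by
        have : 0 ≤ u ^ 22 := by positivity
        linarith
  | cube =>
    simp only [coverageRegret, massBound]
    have hN := Real.sqrt_nonneg ((m : ℝ) + n)
    have hf : 1 + 2 * α ≤ 3 * u ^ 2 := by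
      have := hmono (show 0 ≤ 2 by norm_num)
      rw [pow_zero] at this
      linarith
    calc (1 + 2 * α) * √((m : ℝ) + n) * √(T : ℝ)
        ≤ 3 * u ^ 2 * √((m : ℝ) + n) * u ^ 12 := by rw [h12]; gcongr
      _ = 3 * √((m : ℝ) + n) * u ^ 14 := by ring
      _ ≤ 600 * √((m : ℝ) + n) * u ^ 22 := by
        have := hmono (show 14 ≤ 22 by norm_num)
        gcongr
        norm_num

/-- Here `v = δ^{1/6}`. The penalty term `α θ δ` equals `4 ρ v` and `α ρ² / (2θ)` equals `ρ v³ / 8`,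
while `v¹² T ≥ 1` makes `T^{-1/12} ≤ v`. The constants `600 + 21 + 4 + 3` fit into `640`. -/
theorem typicalError_le (hm : 1 ≤ m) (hn : 1 ≤ n) (hT : 1 ≤ q.T) {v : ℝ} (hv : 0 < v)
    (hv1 : v ≤ 1) (hα : q.α = v⁻¹) (hθ : q.θ = 4 * (v ^ 4)⁻¹ * massBound m n s)
    (hvT : 1 ≤ v ^ 12 * q.T) (hmnT : (m : ℝ) * n ≤ (q.T : ℝ) ^ 4)
    (hsize : 256 * q.K * √(((m : ℝ) + n) * Real.log (4 * ((m : ℝ) + n)) * q.T) ≤ v ^ 6 * q.T) :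
    typicalError m n s q (v ^ 6) ≤ q.T * (640 * massBound m n s * v) := by
  have hT' : (1 : ℝ) ≤ q.T := by exact_mod_cast hT
  have hT0 : (0 : ℝ) < q.T := by linarith
  have hρ := one_le_massBound (n := n) hm s
  set ρ := massBound m n s
  have hρ0 : 0 < ρ := by linarith
  set S := √(((m : ℝ) + n) * Real.log (4 * ((m : ℝ) + n)) * q.T)
  have hpow : ∀ k : ℕ, 1 ≤ k → v ^ k ≤ v := fun k hk => by
    simpa using pow_le_pow_of_le_one hv.le hv1 hk
  have hvT' : v⁻¹ ≤ (q.T : ℝ) ^ (1 / 12 : ℝ) := by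
    have h1 : (v⁻¹) ^ 12 ≤ q.T := by
      rw [inv_pow, inv_le_iff_one_le_mul₀ (by positivity), mul_comm]
      exact hvT
    have h2 := Real.rpow_le_rpow (by positivity) h1 (by norm_num : (0 : ℝ) ≤ 1 / 12)
    rw [← Real.rpow_natCast, ← Real.rpow_mul (by positivity)] at h2
    norm_num at h2
    simpa using h2
  have hreg := coverageRegret_le hm hn hT hmnT (hα.le.trans hvT') s
  have hdecay : (q.T : ℝ) ^ (-(1 / 12) : ℝ) ≤ v := by
    rw [Real.rpow_neg hT0.le]
    exact inv_le_of_inv_le₀ hv hvT'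
  have h1 : coverageRegret m n q.T q.α s ≤ q.T * (600 * ρ * v) := by
    refine hreg.trans ?_
    calc 600 * ρ * (q.T * (q.T : ℝ) ^ (-(1 / 12) : ℝ)) ≤ 600 * ρ * (q.T * v) := by gcongr
      _ = _ := by ring
  have h2 : q.T * (q.α * (5 * (q.θ * v ^ 6) + ρ ^ 2 / (2 * q.θ))) ≤ q.T * (21 * ρ * v) := by
    refine mul_le_mul_of_nonneg_left ?_ hT0.le
    have e : q.α * (5 * (q.θ * v ^ 6) + ρ ^ 2 / (2 * q.θ)) = 20 * ρ * v + ρ * v ^ 3 / 8 := by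
      rw [hα, hθ]
      field_simp
      ring
    rw [e]
    have := mul_le_mul_of_nonneg_left (hpow 3 (by norm_num)) hρ0.le
    have : 0 ≤ ρ * v := by positivity
    linarith
  have h3 : 4 * q.α / q.T ≤ q.T * (4 * ρ * v) := by
    rw [hα, div_le_iff₀ hT0]
    have e1 : v⁻¹ ≤ v * q.T := by
      rw [inv_le_iff_one_le_mul₀ hv]
      have e2 : v ^ 12 ≤ v * v := by
        have := pow_le_pow_of_le_one hv.le hv1 (show 2 ≤ 12 by norm_num)
        rwa [sq] at this
      have := mul_le_mul_of_nonneg_right e2 hT0.le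
      linarith
    have e3 : v * q.T ≤ v * q.T * (ρ * q.T) :=
      le_mul_of_one_le_right (by positivity) (one_le_mul_of_one_le_of_one_le hρ hT')
    linarith
  have h4 : q.α * (20 * q.K * (1 + 8 * q.θ) * S) ≤ q.T * (3 * ρ * v) := by
    have hθ0 : 0 < q.θ := by rw [hθ]; positivity
    calc q.α * (20 * q.K * (1 + 8 * q.θ) * S)
        = q.α * (20 / 256 * (1 + 8 * q.θ)) * (256 * q.K * S) := by ring
      _ ≤ q.α * (20 / 256 * (1 + 8 * q.θ)) * (v ^ 6 * q.T) := by
        have : 0 ≤ q.α := by rw [hα]; positivity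
        gcongr
      _ = q.T * (20 / 256 * (v ^ 5 + 32 * (ρ * v))) := by
        rw [hα, hθ]
        field_simp
        ring
      _ ≤ _ := by
        refine mul_le_mul_of_nonneg_left ?_ hT0.le
        have e1 := hpow 5 (by norm_num)
        have e2 : v ≤ ρ * v := le_mul_of_one_le_left hv.le hρ
        linarith
  unfold typicalError
  have : 0 ≤ q.T * (ρ * v) := by positivity
  linarith

/-- The logarithmic factor of the sample size. -/
theorem log_four_mul_le (hm : 1 ≤ m) (hn : 1 ≤ n) {K δ : ℝ} (hδ : 0 < δ) (hδ1 : δ ≤ 1) :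
    Real.log (4 * ((m : ℝ) + n)) ≤
      3 * Real.log (Real.exp 1 + ((m : ℝ) + n) * max 1 K / δ) := by
  have hm' : (1 : ℝ) ≤ m := by exact_mod_cast hm
  have hn' : (1 : ℝ) ≤ n := by exact_mod_cast hn
  have hN : (0 : ℝ) < (m : ℝ) + n := by linarith
  have hκ : (1 : ℝ) ≤ max 1 K := le_max_left _ _
  have h1 : (m : ℝ) + n ≤ ((m : ℝ) + n) * max 1 K / δ := by
    rw [le_div_iff₀ hδ]
    nlinarith
  have h2 : Real.log ((m : ℝ) + n) ≤ Real.log (Real.exp 1 + ((m : ℝ) + n) * max 1 K / δ) :=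
    Real.log_le_log hN (by linarith [Real.exp_pos 1])
  have h3 : 1 ≤ Real.log (Real.exp 1 + ((m : ℝ) + n) * max 1 K / δ) := by
    rw [Real.le_log_iff_exp_le (by positivity)]
    have : 0 < ((m : ℝ) + n) * max 1 K / δ := by positivity
    linarith
  have h4 : Real.log 4 ≤ 2 := by
    rw [show (4 : ℝ) = 2 ^ 2 by norm_num, Real.log_pow]
    push_cast
    linarith [Real.log_two_lt_d9]
  rw [Real.log_mul (by norm_num) hN.ne']
  linarith

theorem sampleSize_spec (hm : 1 ≤ m) (hn : 1 ≤ n) {K δ : ℝ} (hK : 0 < K) (hδ : 0 < δ) {T : ℕ}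
    (hT : 200000 * (δ ^ (-2 : ℝ) * (max 1 K) ^ 2 * ((m : ℝ) + n) *
      Real.log (Real.exp 1 + ((m : ℝ) + n) * max 1 K / δ) ^ 1) ≤ T) :
    1 ≤ T ∧ (m : ℝ) + n ≤ δ ^ 2 * T ∧ (δ ≤ 1 →
      256 * K * √(((m : ℝ) + n) * Real.log (4 * ((m : ℝ) + n)) * T) ≤ δ * T) := by
  have hm' : (1 : ℝ) ≤ m := by exact_mod_cast hm
  have hn' : (1 : ℝ) ≤ n := by exact_mod_cast hn
  have hN : (0 : ℝ) < (m : ℝ) + n := by linarith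
  have hκ : (1 : ℝ) ≤ max 1 K := le_max_left _ _
  have hKκ : K ≤ max 1 K := le_max_right _ _
  have hlog := log_four_mul_le (K := K) hm hn hδ
  set κ := max 1 K
  set Λ := Real.log (Real.exp 1 + ((m : ℝ) + n) * κ / δ)
  have hΛ : 1 ≤ Λ := by
    rw [Real.le_log_iff_exp_le (by positivity)]
    have : 0 < ((m : ℝ) + n) * κ / δ := by positivity
    linarith
  have hmain : 200000 * (κ ^ 2 * ((m : ℝ) + n) * Λ) ≤ δ ^ 2 * T := by
    have h1 := mul_le_mul_of_nonneg_left hT (sq_nonneg δ)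
    have h2 : δ ^ (-2 : ℝ) = (δ ^ 2)⁻¹ := by
      rw [Real.rpow_neg hδ.le]
      norm_cast
    rw [h2] at h1
    refine le_trans (le_of_eq ?_) h1
    field_simp
  have hκ2 : 1 ≤ κ ^ 2 := one_le_pow₀ hκ
  have hbase : (m : ℝ) + n ≤ κ ^ 2 * ((m : ℝ) + n) * Λ :=
    (le_mul_of_one_le_left hN.le hκ2).trans (le_mul_of_one_le_right (by positivity) hΛ)
  have hT0 : 0 < T := by
    rcases Nat.eq_zero_or_pos T with h | h
    · rw [h, Nat.cast_zero, mul_zero] at hmain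
      linarith
    · exact h
  have hT0' : (0 : ℝ) < T := by exact_mod_cast hT0
  refine ⟨hT0, by linarith, fun hδ1 => ?_⟩
  have hlog := hlog hδ1
  have hL0 : 0 ≤ Real.log (4 * ((m : ℝ) + n)) := Real.log_nonneg (by linarith)
  refine le_of_sq_le_sq ?_ (by positivity)
  rw [mul_pow, Real.sq_sqrt (by positivity)]
  have h5 : K ^ 2 * (((m : ℝ) + n) * Real.log (4 * ((m : ℝ) + n))) ≤
      κ ^ 2 * (((m : ℝ) + n) * (3 * Λ)) := by gcongr
  -- The constant `200000` is chosen to exceed `3 · 256²`, where `3` comes from `log_four_mul_le`.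
  have h6 : 65536 * (K ^ 2 * (((m : ℝ) + n) * Real.log (4 * ((m : ℝ) + n)))) ≤ δ ^ 2 * T := by
    have : 0 ≤ κ ^ 2 * ((m : ℝ) + n) * Λ := by positivity
    linarith
  have h7 := mul_le_mul_of_nonneg_right h6 hT0'.le
  linarith

theorem mul_le_pow_four (hm : 1 ≤ m) (hn : 1 ≤ n) {T : ℝ} (h : (m : ℝ) + n ≤ T ^ 2) :
    (m : ℝ) * n ≤ T ^ 4 := by
  have hm' : (1 : ℝ) ≤ m := by exact_mod_cast hm
  have hn' : (1 : ℝ) ≤ n := by exact_mod_cast hn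
  calc (m : ℝ) * n ≤ ((m : ℝ) + n) ^ 2 := by nlinarith
    _ ≤ (T ^ 2) ^ 2 := by gcongr
    _ = T ^ 4 := by ring

end Rates

/-! ### Assembly, including radii larger than one. -/

section Main

variable {m n : ℕ} {s : Setting} {μ : Measure (Fin m × Fin n)}
  {Mstar : Matrix (Fin m) (Fin n) ℝ} {Ω : Type*} [MeasurableSpace Ω] {P : Measure Ω}
  {x : ℕ → Ω → Fin m × Fin n}

theorem tuning_θ (K δ : ℝ) (T : ℕ) :
    (tuning m n K δ T s).θ = 4 * δ ^ (-(2 / 3) : ℝ) * massBound m n s := by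
  cases s with
  | simplex => simp [tuning, massBound]
  | cube => rfl

theorem one_sub_le_measureReal_oddOutput [IsProbabilityMeasure P] [IsProbabilityMeasure μ]
    (hm : 1 ≤ m) (hn : 1 ≤ n) (hmn : s = .simplex → 2 ≤ m * n)
    (hx : ∀ t, Measurable (x t)) (hind : iIndepFun x P) (hμ : ∀ t, P.map (x t) = μ)
    {K δ : ℝ} (hK : 0 < K) (hδ : 0 < δ) (hδ1 : δ ≤ 1) (hMstar : Mstar ∈ maxClass m n K) {T : ℕ}
    (hT : 1 ≤ T) (hNT : (m : ℝ) + n ≤ δ ^ 2 * T)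
    (hsize : 256 * K * √(((m : ℝ) + n) * Real.log (4 * ((m : ℝ) + n)) * T) ≤ δ * T)
    {C : Matrix (Fin m) (Fin n) ℝ} (hC : C ∈ confidenceSet m n s) {b : ℝ}
    (hCμ : ∀ i j, C i j = b * μ.real {(i, j)}) (hb : 0 ≤ b) (hbρ : b ≤ massBound m n s) :
    1 - 2 * Real.exp (-(1 / 2048) * δ ^ 2 * T) ≤ P.real {ω |
      coverage s C - 640 * massBound m n s * δ ^ (1 / 6 : ℝ) ≤
        coverage s (oddOutput s (tuning m n K δ T s) Mstar fun t => x t ω) ∧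
      ∀ M₁ ∈ versionSpace μ Mstar K δ, ∀ M₂ ∈ versionSpace μ Mstar K δ,
        disagreement (oddOutput s (tuning m n K δ T s) Mstar fun t => x t ω) M₁ M₂ ≤
          δ ^ (1 / 6 : ℝ) * (coverage s (oddOutput s (tuning m n K δ T s) Mstar fun t => x t ω) +
            640 * massBound m n s)} := by
  have hm' : (1 : ℝ) ≤ m := by exact_mod_cast hm
  have hn' : (1 : ℝ) ≤ n := by exact_mod_cast hn
  have hT' : (1 : ℝ) ≤ T := by exact_mod_cast hT
  have hT0 : (0 : ℝ) < T := by linarith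
  have hρ := one_le_massBound (n := n) hm s
  set v : ℝ := δ ^ (1 / 6 : ℝ) with hvdef
  have hv : 0 < v := Real.rpow_pos_of_pos hδ _
  have hv1 : v ≤ 1 := Real.rpow_le_one hδ.le hδ1 (by norm_num)
  have hv6 : v ^ 6 = δ := by
    rw [hvdef, ← Real.rpow_natCast, ← Real.rpow_mul hδ.le]
    norm_num
  have hα : (tuning m n K δ T s).α = v⁻¹ := by
    rw [hvdef, ← Real.rpow_neg hδ.le]
    rfl
  have hθ : (tuning m n K δ T s).θ = 4 * (v ^ 4)⁻¹ * massBound m n s := by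
    rw [tuning_θ, hvdef, ← Real.rpow_natCast, ← Real.rpow_mul hδ.le, ← Real.rpow_neg hδ.le]
    norm_num
  have hvT : 1 ≤ v ^ 12 * T := by
    rw [show v ^ 12 = (v ^ 6) ^ 2 by ring, hv6]
    linarith
  have hmnT : (m : ℝ) * n ≤ (T : ℝ) ^ 4 := by
    refine mul_le_pow_four hm hn (hNT.trans ?_)
    have : δ ^ 2 ≤ 1 := pow_le_one₀ hδ.le hδ1
    nlinarith
  have herr := typicalError_le (s := s) (q := tuning m n K δ T s) hm hn hT hv hv1 hα hθ hvT hmnT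
    (by rw [hv6]; exact hsize)
  rw [hv6] at herr
  have hα0 : 0 < (tuning m n K δ T s).α := by rw [hα]; positivity
  have hθ0 : 0 < (tuning m n K δ T s).θ := by
    rw [hθ]
    have := massBound_pos (n := n) hm s
    positivity
  have hρθ : massBound m n s ≤ 1 + 4 * (tuning m n K δ T s).θ := by
    have h1 : 1 ≤ (v ^ 4)⁻¹ := (one_le_inv₀ (by positivity)).2 (pow_le_one₀ hv.le hv1)
    rw [hθ]
    nlinarith [mul_le_mul_of_nonneg_right h1 (zero_le_one.trans hρ)]
  refine (one_sub_le_measureReal_typical (s := s) (q := tuning m n K δ T s) hm hn hx hind hμ hT hK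
    hα0.le hδ hδ1 hMstar hsize).trans (measureReal_mono fun ω hω => ?_)
  obtain ⟨h1, h2⟩ := oddOutput_of_typical hm hn hmn hT hK hα0.le hθ0 hρθ hMstar hC hCμ hb hbρ hδ hω
  set Cbar := oddOutput s (tuning m n K δ T s) Mstar fun t => x t ω
  refine ⟨?_, fun M₁ hM₁ M₂ hM₂ => ?_⟩
  · have h3 : (T : ℝ) * coverage s C ≤ T * (coverage s Cbar + 640 * massBound m n s * v) := by
      rw [mul_add]
      exact h1.trans (add_le_add_right herr _)
    linarith [le_of_mul_le_mul_left h3 hT0]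
  · have h3 : (T : ℝ) * (v⁻¹ * disagreement Cbar M₁ M₂) ≤
        T * (coverage s Cbar + 640 * massBound m n s * v) := by
      rw [mul_add, ← hα]
      exact (h2 M₁ hM₁ M₂ hM₂).trans (add_le_add_right herr _)
    have h4 := le_of_mul_le_mul_left h3 hT0
    rw [inv_mul_le_iff₀ hv] at h4
    refine h4.trans (mul_le_mul_of_nonneg_left ?_ hv.le)
    have := mul_le_mul_of_nonneg_left hv1 (by linarith : 0 ≤ 640 * massBound m n s)
    linarith

/-- For large radius the coverage guarantee on the simplex holds along every realization. -/
theorem entropy_sub_le_of_one_le (hm : 1 ≤ m) (hn : 1 ≤ n) (hmn : 2 ≤ m * n)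
    {K δ : ℝ} (hK : 0 < K) (hδ1 : 1 ≤ δ) {T : ℕ} (hT : 1 ≤ T) (hNT : (m : ℝ) + n ≤ δ ^ 2 * T)
    {C : Matrix (Fin m) (Fin n) ℝ} (hC : C ∈ confidenceSet m n .simplex)
    (a : ℕ → Fin m × Fin n) :
    entropy C - 640 * δ ^ (1 / 6 : ℝ) ≤
      entropy (oddOutput .simplex (tuning m n K δ T .simplex) Mstar a) := by
  have hm' : (1 : ℝ) ≤ m := by exact_mod_cast hm
  have hn' : (1 : ℝ) ≤ n := by exact_mod_cast hn
  have hT' : (1 : ℝ) ≤ T := by exact_mod_cast hT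
  have hT0 : (0 : ℝ) < T := by linarith
  have hδ : 0 < δ := by linarith
  have hα0 : 0 ≤ (tuning m n K δ T .simplex).α := Real.rpow_nonneg hδ.le _
  have hα1 : (tuning m n K δ T .simplex).α ≤ 1 := Real.rpow_le_one_of_one_le_of_nonpos hδ1
    (by norm_num)
  have hv1 : 1 ≤ δ ^ (1 / 6 : ℝ) := Real.one_le_rpow hδ1 (by norm_num)
  have hout : oddOutput .simplex (tuning m n K δ T .simplex) Mstar a ∈
      confidenceSet m n .simplex := oddOutput_mem_confidenceSet hm hn hT hK hα0
  -- If the matrix is small compared with `δ⁴`, then already `log (mn) ≤ 48 δ^{1/6}`. Otherwise `m +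
  -- n ≤ δ² T` forces `m + n ≤ T²`, so the regret of the coverage player is `O(T)`.
  rcases le_or_gt ((m : ℝ) + n) (δ ^ 4) with hsmall | hlarge
  · have h1 := entropy_le_log hm hn hC
    have h2 : Real.log ((m : ℝ) * n) ≤ 2 * Real.log ((m : ℝ) + n) := by
      have h := Real.log_le_log (x := (m : ℝ) * n) (y := ((m : ℝ) + n) ^ 2) (by positivity)
        (by nlinarith)
      rw [Real.log_pow] at h
      exact_mod_cast h
    have h3 := Real.log_le_rpow_div (by linarith : (0 : ℝ) ≤ (m : ℝ) + n)
      (by norm_num : (0 : ℝ) < 1 / 24)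
    have h4 := Real.rpow_le_rpow (by linarith) hsmall (by norm_num : (0 : ℝ) ≤ 1 / 24)
    rw [← Real.rpow_natCast, ← Real.rpow_mul hδ.le,
      show ((4 : ℕ) : ℝ) * (1 / 24) = 1 / 6 by norm_num] at h4
    have h5 := entropy_nonneg hout
    linarith
  · have hNT2 : (m : ℝ) + n ≤ (T : ℝ) ^ 2 := by
      have h1 : ((m : ℝ) + n) ^ 2 ≤ (δ ^ 2 * T) ^ 2 := by gcongr
      have h2 : (δ ^ 2 * T) ^ 2 ≤ ((m : ℝ) + n) * T ^ 2 := by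
        rw [mul_pow, ← pow_mul]
        gcongr
      rw [sq ((m : ℝ) + n)] at h1
      exact le_of_mul_le_mul_left (h1.trans h2) (by linarith)
    have h1 := coverage_add_sum_disagreement_le (s := .simplex) (q := tuning m n K δ T .simplex)
      (Mstar := Mstar) (a := a) hm hn (fun _ => hmn) hT hK hα0 hC
    have h2 := coverageRegret_le hm hn hT (mul_le_pow_four hm hn hNT2)
      (hα1.trans (Real.one_le_rpow hT' (by norm_num))) .simplex
    have h3 : (T : ℝ) ^ (-(1 / 12) : ℝ) ≤ 1 :=
      Real.rpow_le_one_of_one_le_of_nonpos hT' (by norm_num)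
    have h4 := mul_le_mul_of_nonneg_left h3 hT0.le
    have hbound : ∀ (D : ℕ → Matrix (Fin m) (Fin n) ℝ), (∀ t, D t ∈ confidenceSet m n .simplex) →
        |∑ t ∈ Finset.range T, disagreement (D t)
          (fst (oddState .simplex (tuning m n K δ T .simplex) Mstar a t).2)
          (snd (oddState .simplex (tuning m n K δ T .simplex) Mstar a t).2)| ≤ T * 2 := by
      intro D hD
      refine (Finset.abs_sum_le_sum_abs _ _).trans ?_
      rw [← nsmul_eq_mul, ← Finset.card_range T, ← Finset.sum_const, Finset.card_range]
      refine Finset.sum_le_sum fun t _ => ?_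
      have e1 := (oddState_spec (s := .simplex) (q := tuning m n K δ T .simplex) (Mstar := Mstar)
        (x := a) hm hn hT hK hα0 t).2.1
      have e2 := abs_disagreement_le (C := D t) (abs_fst_le e1) (abs_snd_le e1)
      have e3 := l1Norm_le_massBound hm hn (hD t)
      simp only [massBound] at e3
      linarith
    have h5 := (abs_le.1 (hbound (fun _ => C) fun _ => hC)).2
    have h6 := (abs_le.1 (hbound
      (fun t => (oddState .simplex (tuning m n K δ T .simplex) Mstar a t).1) fun t =>
        projectionSet_subset _ (oddState_spec hm hn hT hK hα0 t).1)).1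
    have h7 := mul_le_mul_of_nonneg_left h5 hα0
    have h8 := mul_le_mul_of_nonneg_left h6 hα0
    have h9 := mul_le_mul_of_nonneg_right hα1 hT0.le
    have h10 : 4 * (tuning m n K δ T .simplex).α / T ≤ 4 * T := by
      rw [div_le_iff₀ hT0]
      nlinarith
    have eT : (tuning m n K δ T .simplex).T = T := rfl
    rw [eT] at h1
    simp only [coverage, massBound] at h1 h2
    -- The constant is `600` from the regret, `2 + 2` from disagreements bounded trivially with `α ≤
    -- 1`, and `4` from the truncation of the comparator.
    have h11 : (T : ℝ) * entropy C ≤ T *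
        (entropy (oddOutput .simplex (tuning m n K δ T .simplex) Mstar a) + 608) := by
      linarith
    have h12 := le_of_mul_le_mul_left h11 hT0
    linarith

theorem one_sub_le_measureReal_of_forall [IsProbabilityMeasure P] {p : Ω → Prop}
    (h : ∀ ω, p ω) (e : ℝ) : 1 - 2 * Real.exp e ≤ P.real {ω | p ω} := by
  have h1 : {ω | p ω} = Set.univ := Set.eq_univ_of_forall h
  rw [h1, probReal_univ]
  linarith [Real.exp_pos e]

end Main

end PMC

theorem mainTheorem6 :
    ∃ (c₁ c₂ A B : ℝ) (k : ℕ), 0 < c₁ ∧ 0 < c₂ ∧ 0 < A ∧ 0 < B ∧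
      ∀ (m n : ℕ) (K δ : ℝ), 0 < K → 0 < δ →
      ∀ (μ : MeasureTheory.Measure (Fin m × Fin n)), MeasureTheory.IsProbabilityMeasure μ →
      ∀ Mstar ∈ PMC.maxClass m n K,
      ∀ T : ℕ,
        B * (δ ^ (-2 : ℝ) * (max 1 K) ^ 2 * ((m : ℝ) + n) *
          Real.log (Real.exp 1 + ((m : ℝ) + n) * max 1 K / δ) ^ k) ≤ T →
      ∀ (Ω : Type) (_ : MeasurableSpace Ω) (P : MeasureTheory.Measure Ω),
        MeasureTheory.IsProbabilityMeasure P →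
      ∀ x : ℕ → Ω → Fin m × Fin n,
        (∀ t, Measurable (x t)) → ProbabilityTheory.iIndepFun x P →
        (∀ t, P.map (x t) = μ) →
        (∀ Cμ : Matrix (Fin m) (Fin n) ℝ, (∀ i j, Cμ i j = μ.real {(i, j)}) →
          1 - c₁ * Real.exp (-c₂ * δ ^ 2 * T) ≤ P.real {ω |
            let Cbar := PMC.oddOutput .simplex (PMC.tuning m n K δ T .simplex) Mstar
              (fun t => x t ω)
            PMC.entropy Cμ - A * δ ^ (1 / 6 : ℝ) ≤ PMC.entropy Cbar ∧
            (2 ≤ m * n →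
              ∀ M₁ ∈ PMC.versionSpace μ Mstar K δ, ∀ M₂ ∈ PMC.versionSpace μ Mstar K δ,
                PMC.disagreement Cbar M₁ M₂ ≤
                  A * (δ ^ (1 / 6 : ℝ) * Real.log ((m : ℝ) * n)))}) ∧
        (∀ Cμ ∈ PMC.confidenceSet m n .cube,
          (∀ i j, Cμ i j / PMC.l1Norm Cμ = μ.real {(i, j)}) →
          1 - c₁ * Real.exp (-c₂ * δ ^ 2 * T) ≤ P.real {ω |
            let Cbar := PMC.oddOutput .cube (PMC.tuning m n K δ T .cube) Mstar
              (fun t => x t ω)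
            PMC.l1Norm Cμ - A * (δ ^ (1 / 6 : ℝ) * Real.sqrt ((m : ℝ) + n)) ≤
              PMC.l1Norm Cbar ∧
            ∀ M₁ ∈ PMC.versionSpace μ Mstar K δ, ∀ M₂ ∈ PMC.versionSpace μ Mstar K δ,
              PMC.disagreement Cbar M₁ M₂ ≤
                A * (δ ^ (1 / 6 : ℝ) * Real.sqrt ((m : ℝ) + n))}) := by
  refine ⟨2, 1 / 2048, 2000, 200000, 1, by norm_num, by norm_num, by norm_num, by norm_num, ?_⟩
  intro m n K δ hK hδ μ _ Mstar hMstar T hT Ω _ P _ x hx hind hμ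
  -- The existence of a probability measure forces both dimensions to be positive.
  obtain ⟨⟨i₀, j₀⟩⟩ : Nonempty (Fin m × Fin n) := nonempty_of_isProbabilityMeasure μ
  have hm : 1 ≤ m := i₀.pos
  have hn : 1 ≤ n := j₀.pos
  obtain ⟨hT1, hNT, hsize⟩ := PMC.sampleSize_spec hm hn hK hδ hT
  have hα0 : ∀ s, 0 ≤ (PMC.tuning m n K δ T s).α := fun s => Real.rpow_nonneg hδ.le _
  have hv0 : 0 < δ ^ (1 / 6 : ℝ) := Real.rpow_pos_of_pos hδ _
  have hsum := PMC.sum_measureReal_singleton_univ μ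
  have hout : ∀ s ω, PMC.oddOutput s (PMC.tuning m n K δ T s) Mstar (fun t => x t ω) ∈
      PMC.confidenceSet m n s := fun s ω =>
    PMC.oddOutput_mem_confidenceSet hm hn hT1 hK (hα0 s)
  have hdis : ∀ s ω, ∀ M₁ ∈ PMC.versionSpace μ Mstar K δ, ∀ M₂ ∈ PMC.versionSpace μ Mstar K δ,
      PMC.disagreement (PMC.oddOutput s (PMC.tuning m n K δ T s) Mstar (fun t => x t ω)) M₁ M₂ ≤
        PMC.massBound m n s * 2 := fun s ω M₁ h₁ M₂ h₂ => by
    have e1 := (abs_le.1 (PMC.abs_disagreement_le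
      (C := PMC.oddOutput s (PMC.tuning m n K δ T s) Mstar (fun t => x t ω))
      (PMC.abs_le_one_of_mem_maxClass h₁.1) (PMC.abs_le_one_of_mem_maxClass h₂.1))).2
    have e2 := PMC.l1Norm_le_massBound hm hn (hout s ω)
    linarith
  constructor
  · intro Cμ hCμ
    have hC : Cμ ∈ PMC.confidenceSet m n .simplex := by
      refine ⟨fun i j => (hCμ i j).symm ▸ MeasureTheory.measureReal_nonneg, ?_⟩
      rw [← hsum, Fintype.sum_prod_type]
      exact Finset.sum_congr rfl fun i _ => Finset.sum_congr rfl fun j _ => hCμ i j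
    by_cases hmn : 2 ≤ m * n
    · have hmn' : (2 : ℝ) ≤ (m : ℝ) * n := by exact_mod_cast hmn
      -- Lets additive constants be absorbed into multiples of `log (mn)`.
      have hlog : 1 / 2 ≤ Real.log ((m : ℝ) * n) :=
        le_trans (by linarith [Real.log_two_gt_d9]) (Real.log_le_log (by norm_num) hmn')
      rcases le_or_gt δ 1 with hδ1 | hδ1
      · refine (PMC.one_sub_le_measureReal_oddOutput (s := .simplex) hm hn (fun _ => hmn) hx hind hμ
          hK hδ hδ1 hMstar hT1 hNT (hsize hδ1) hC (b := 1) (fun i j => by rw [hCμ, one_mul])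
          zero_le_one le_rfl).trans (MeasureTheory.measureReal_mono fun ω hω => ?_)
        obtain ⟨h1, h2⟩ := hω
        simp only [PMC.coverage, PMC.massBound] at h1 h2
        refine ⟨by linarith, fun _ M₁ hM₁ M₂ hM₂ => (h2 M₁ hM₁ M₂ hM₂).trans ?_⟩
        rw [mul_left_comm]
        refine mul_le_mul_of_nonneg_left ?_ hv0.le
        have h3 := PMC.entropy_le_log hm hn (hout .simplex ω)
        linarith
      · have hv1 : 1 ≤ δ ^ (1 / 6 : ℝ) := Real.one_le_rpow hδ1.le (by norm_num)
        refine PMC.one_sub_le_measureReal_of_forall (fun ω => ⟨?_, fun _ M₁ hM₁ M₂ hM₂ => ?_⟩) _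
        · have h1 := PMC.entropy_sub_le_of_one_le (Mstar := Mstar) hm hn hmn hK hδ1.le hT1 hNT hC
            fun t => x t ω
          linarith
        · have h1 := hdis .simplex ω M₁ hM₁ M₂ hM₂
          simp only [PMC.massBound] at h1
          nlinarith
    -- With a single entry every entropy vanishes.
    · refine PMC.one_sub_le_measureReal_of_forall (fun ω => ⟨?_, fun h => absurd h hmn⟩) _
      have h1 := PMC.entropy_le_log hm hn hC
      have h2 := PMC.entropy_nonneg (hout .simplex ω)
      have h3 : (m : ℝ) * n ≤ 1 := by exact_mod_cast Nat.lt_succ_iff.1 (not_le.1 hmn)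
      have h4 := Real.log_nonpos (by positivity) h3
      linarith
  · intro Cμ hC hCμ
    have hN1 : 1 ≤ √((m : ℝ) + n) := PMC.one_le_massBound hm .cube
    have hl0 : 0 ≤ PMC.l1Norm Cμ := PMC.coverage_nonneg (s := .cube) hC
    have hl1 := PMC.l1Norm_le_sqrt_of_mem_cube hm hn hC
    -- Division by zero gives `0`, so a vanishing norm would make `μ` the zero measure.
    have hlne : PMC.l1Norm Cμ ≠ 0 := by
      intro h0
      rw [Fintype.sum_prod_type] at hsum
      simp [← hCμ, h0] at hsum
    rcases le_or_gt δ 1 with hδ1 | hδ1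
    · refine (PMC.one_sub_le_measureReal_oddOutput (s := .cube) hm hn (fun h => nomatch h) hx hind hμ
        hK hδ hδ1 hMstar hT1 hNT (hsize hδ1) hC (b := PMC.l1Norm Cμ)
        (fun i j => by rw [← hCμ, mul_div_cancel₀ _ hlne])
        hl0 (PMC.l1Norm_le_massBound hm hn hC)).trans
        (MeasureTheory.measureReal_mono fun ω hω => ?_)
      obtain ⟨h1, h2⟩ := hω
      simp only [PMC.coverage, PMC.massBound] at h1 h2
      have h3 : 0 ≤ δ ^ (1 / 6 : ℝ) * √((m : ℝ) + n) := by positivity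
      refine ⟨by linarith, fun M₁ hM₁ M₂ hM₂ => (h2 M₁ hM₁ M₂ hM₂).trans ?_⟩
      rw [mul_left_comm]
      refine mul_le_mul_of_nonneg_left ?_ hv0.le
      have h4 := PMC.l1Norm_le_sqrt_of_mem_cube hm hn (hout .cube ω)
      linarith
    -- On the cube coverage and disagreement are at most multiples of `√(m + n)`, so nothing remains
    -- to prove for `δ > 1`.
    · have hv1 : 1 ≤ δ ^ (1 / 6 : ℝ) := Real.one_le_rpow hδ1.le (by norm_num)
      have hvN : √((m : ℝ) + n) ≤ δ ^ (1 / 6 : ℝ) * √((m : ℝ) + n) :=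
        le_mul_of_one_le_left (by linarith) hv1
      refine PMC.one_sub_le_measureReal_of_forall (fun ω => ⟨?_, fun M₁ hM₁ M₂ hM₂ => ?_⟩) _
      · have h1 : 0 ≤ PMC.l1Norm
            (PMC.oddOutput .cube (PMC.tuning m n K δ T .cube) Mstar (fun t => x t ω)) :=
          PMC.coverage_nonneg (s := .cube) (hout .cube ω)
        linarith
      · have h1 := hdis .cube ω M₁ hM₁ M₂ hM₂
        simp only [PMC.massBound] at h1
        linarith
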